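/- Let $k\ge 0$ be a locally integrable function on $(0,\infty)$ (integrable on $(0,T]$ for each $T>0$) whose Laplace transform $\mathcal K(p)=\int_0^\infty e^{-pt}k(t)\,dt$ converges for all $p>0$ and is a Stieltjes function, i.e. $\mathcal K(p)=\frac ap+b+\int_{[0,\infty)}\frac{\sigma(dr)}{p+r}$ with $a,b\ge0$ and a Borel measure $\sigma$ such that $\int_{[0,\infty)}\frac{\sigma(dr)}{1+r}<\infty$. Put $\mathcal L(p)=p\mathcal K(p)$ and assume that $\mathcal K(p)\to\infty$, $\mathcal L(p)\to0$ as $p\to0+$, and $\mathcal K(p)\to0$, $\mathcal L(p)\to\infty$ as $p\to\infty$. For $s\ge0$ let $\mu_s$ be the probability measure on $[0,\infty)$ with $\int e^{-p\tau}\mu_s(d\tau)=e^{-s\mathcal L(p)}$ for all $p>0$, and put, for $t>0$, $$G(s,t)=\int_{[0,t]}k(t-\tau)\,\mu_s(d\tau),\qquad A(t,z)=\int_0^\infty e^{zs}G(s,t)\,ds .$$ For $\beta>0$ let $\varkappa_t^{(n)}=\int_0^\infty G(s,t)\,(e^{-\beta s})^n\,ds=A(t,-n\beta)$, $n\ge1$,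 be the correlation functions of the fractional kinetic hierarchy in the model in which the first correlation function of the non-fractional hierarchy is $e^{-\beta s}$. **Theorem 4.2.** Suppose that $\mathcal K(p)\sim p^{-\gamma}Q(1/p)$ as $p\to0+$, where $0\le\gamma\le1$ and $Q$ is slowly varying at infinity (that is, $Q$ is eventually positive and $Q(xt)/Q(t)\to1$ as $t\to\infty$ for each $x>0$). Then: 1. For every $z>0$, $A(t,-z)$ is finite for all $t>0$, and, as $t\to\infty$, $$A(t,-z)\sim\frac{t^{\gamma-1}Q(t)}{\Gamma(\gamma)\,z}\quad\text{if }\gamma>0,\qquad A(t,-z)=o\big(t^{-1}Q(t)\big)\quad\text{if }\gamma=0 .$$ 2. The intermittency property holds: for every $\beta>0$, every $n>1$ and all natural numbers $m_1,\dots,m_l\ge1$ with $l\ge2$ and $m_1+\dots+m_l=n$, $$\frac{\varkappa_t^{(n)}}{\prod_{j=1}^l\varkappa_t^{(m_j)}}\longrightarrow\infty,\qquad t\to\infty .$$ -/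

import Mathlib

open Real Set Filter Topology MeasureTheory Asymptotics
open scoped ENNReal

noncomputable section

namespace FractionalKinetics

/-- Laplace transform `𝒦(p) = ∫₀^∞ e^{-pt} k(t) dt` of a kernel on the half-line. -/
def laplaceK (k : ℝ → ℝ) (p : ℝ) : ℝ :=
  ∫ t in Ioi (0 : ℝ), exp (-p * t) * k t

/-- `ℒ(p) = p 𝒦(p)`. -/
def laplaceL (k : ℝ → ℝ) (p : ℝ) : ℝ := p * laplaceK k p

/-- Stieltjes functions on `(0, ∞)`:
`φ(p) = a / p + b + ∫_{[0,∞)} (p + r)⁻¹ σ(dr)` with `a, b ≥ 0` and `∫_{[0,∞)} (1 + r)⁻¹ σ(dr) < ∞`.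
Only the restriction of `σ` to `[0, ∞)` matters. -/
def IsStieltjes (φ : ℝ → ℝ) : Prop :=
  ∃ (a b : ℝ) (σ : Measure ℝ), 0 ≤ a ∧ 0 ≤ b ∧
    IntegrableOn (fun r : ℝ => (1 + r)⁻¹) (Ici 0) σ ∧
    ∀ p : ℝ, 0 < p → φ p = a / p + b + ∫ r in Ici (0 : ℝ), (p + r)⁻¹ ∂σ

/-- The standing assumptions on the kernel `k` of the differential-convolution operator
`(𝔻_{(k)} u)(t) = d/dt ∫₀ᵗ k(t - τ) u(τ) dτ - k(t) u(0)`. -/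
structure IsAdmissibleKernel (k : ℝ → ℝ) : Prop where
  nonneg : ∀ t : ℝ, 0 < t → 0 ≤ k t
  locallyIntegrable : ∀ T : ℝ, 0 < T → IntegrableOn k (Ioc 0 T)
  laplace_integrable : ∀ p : ℝ, 0 < p → IntegrableOn (fun t => exp (-p * t) * k t) (Ioi 0)
  stieltjes : IsStieltjes (laplaceK k)
  laplaceK_zero : Tendsto (laplaceK k) (𝓝[>] 0) atTop
  laplaceK_infty : Tendsto (laplaceK k) atTop (𝓝 0)
  laplaceL_zero : Tendsto (laplaceL k) (𝓝[>] 0) (𝓝 0)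
  laplaceL_infty : Tendsto (laplaceL k) atTop atTop

/-- `ν` is a probability measure on `[0, ∞)` with `∫ e^{-pτ} ν(dτ) = e^{-s ℒ(p)}`, `p > 0`.
There is at most one such measure, since its Laplace transform is prescribed. -/
def IsSubordinatorLaw (k : ℝ → ℝ) (s : ℝ) (ν : Measure ℝ) : Prop :=
  IsProbabilityMeasure ν ∧ ν (Iio 0) = 0 ∧
    ∀ p : ℝ, 0 < p → ∫ τ, exp (-p * τ) ∂ν = exp (-s * laplaceL k p)

open Classical in
/-- The measure `μ_s(dτ)` with Laplace transform `e^{-s ℒ(p)}` (and `0` if there were none). -/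
def subordinatorLaw (k : ℝ → ℝ) (s : ℝ) : Measure ℝ :=
  if h : ∃ ν : Measure ℝ, IsSubordinatorLaw k s ν then h.choose else 0

/-- The subordination kernel `G(s, t) = ∫_{[0,t]} k(t - τ) μ_s(dτ)`, a nonnegative integral. -/
def subKernel (k : ℝ → ℝ) (s t : ℝ) : ℝ≥0∞ :=
  ∫⁻ τ in Icc 0 t, ENNReal.ofReal (k (t - τ)) ∂(subordinatorLaw k s)

/-- `A(t, z) = ∫₀^∞ e^{zs} G(s, t) ds`, a nonnegative integral, for real `z` of either sign. -/
def subExp (k : ℝ → ℝ) (t z : ℝ) : ℝ≥0∞ :=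
  ∫⁻ s in Ioi (0 : ℝ), ENNReal.ofReal (exp (z * s)) * subKernel k s t

/-- The correlation function of order `n` at time `t` of the fractional kinetic hierarchy,
`ϰ_t^{(n)} = ∫₀^∞ G(s, t) ∏_{j=1}^n ρ_s ds`, where `ρ_s ≥ 0` is the (spatially constant)
first correlation function of the kinetic hierarchy without fractional derivative. -/
def correlation (k : ℝ → ℝ) (ρ : ℝ → ℝ) (n : ℕ) (t : ℝ) : ℝ≥0∞ :=
  ∫⁻ s in Ioi (0 : ℝ), subKernel k s t * ∏ _j : Fin n, ENNReal.ofReal (ρ s)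

/-- Slow variation at infinity. -/
def IsSlowlyVarying (Q : ℝ → ℝ) : Prop :=
  (∀ᶠ t in atTop, 0 < Q t) ∧
    ∀ x : ℝ, 0 < x → Tendsto (fun t => Q (x * t) / Q t) atTop (𝓝 1)

end FractionalKinetics

end

noncomputable section

namespace FractionalKinetics

/-! The limits assumed of 𝒦 and ℒ force a = b = 0 in the Stieltjes representation, so `k` agrees
almost everywhere with g(x) = ∫ e^{-rx} σ(dr), a decreasing log-convex function
(`exists_logConvexKernel`). Averaging μ_s against e^{-zs} ds gives z⁻¹ P, where P is the law on [0,
∞) with Laplace transform z / (z + ℒ(p)); hence A(t, -z) = z⁻¹ (g * P)(t) (`subExp_eq`). The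
identity 𝒦/(z + ℒ) + p⁻¹ z/(z + ℒ) = p⁻¹ says that this convolution is the tail P(t, ∞), which is
finite and nonincreasing (`resolventConv_eq`).

The law P is a limit of lattice laws. By Kaluza's theorem the convolution inverse, relative to the
constant sequence 1, of the log-convex sequence z + g(h), z + g(2h), … is nonnegative and
nonincreasing, hence gives point masses; then the mesh h tends to 0
(`exists_isResolventLaw_Ioo_le`). Monotonicity of the masses also bounds the density of P by 1/D on
(D, ∞), which is what makes the tail identity hold at every t > 0 rather than almost every t. The
laws μ_s are limits of convolution powers of resolvent laws.

For the asymptotics, ℒ → 0 at the origin, so the Laplace transform 𝒦/(z + ℒ) of the tail is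
equivalent to 𝒦/z, and Karamata's theorem for monotone functions applies
(`tendsto_mul_of_lap_regularlyVarying`).

Intermittency needs lower bounds as well, which the asymptotics do not give for γ = 0. For every z
the tail satisfies g(t)/(2z) ≤ P(t, ∞) ≤ g(t)^{3/4} for large t (`eventually_le_measure_Ioi`,
`eventually_measure_Ioi_le`). A product of at least two tails is then at most g^{3/2}, so the ratio
is at least of order g^{-1/2}, and g → 0. -/

/-- The Laplace transform of a measure on the line, as a nonnegative integral. -/
def lap (μ : Measure ℝ) (p : ℝ) : ℝ≥0∞ := ∫⁻ x, ENNReal.ofReal (exp (-p * x)) ∂μ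

lemma measurable_ofReal_exp_mul (p : ℝ) : Measurable fun x : ℝ => ENNReal.ofReal (exp (p * x)) := by
  fun_prop

/-! ### Uniqueness for Laplace transforms -/

open ProbabilityTheory in
-- The complex moment generating functions are analytic on Re z < 1 and agree at real points near 0,
-- hence on the whole half-plane. It contains the imaginary axis, where they are the characteristic
-- functions.
lemma ext_of_mgf_eq_of_lt_one {μ ν : Measure ℝ} [IsFiniteMeasure μ] [IsFiniteMeasure ν]
    (hμ : ∀ t < 1, Integrable (fun x => exp (t * x)) μ)
    (hν : ∀ t < 1, Integrable (fun x => exp (t * x)) ν)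
    (h : ∀ t < 1, mgf id μ t = mgf id ν t) : μ = ν := by
  have sub : ∀ {ρ : Measure ℝ}, (∀ t < 1, Integrable (fun x => exp (t * x)) ρ) →
      AnalyticOnNhd ℂ (complexMGF id ρ) {z : ℂ | z.re ∈ Iio (1 : ℝ)} := by
    intro ρ hρ
    refine analyticOnNhd_complexMGF.mono ?_
    intro z hz
    exact interior_maximal (s := integrableExpSet id ρ) (fun t ht => hρ t ht) isOpen_Iio hz
  have key : Set.EqOn (complexMGF id μ) (complexMGF id ν) {z : ℂ | z.re ∈ Iio (1 : ℝ)} := by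
    refine AnalyticOnNhd.eqOn_of_preconnected_of_frequently_eq (sub hμ) (sub hν)
      ((convex_Iio (1 : ℝ)).linear_preimage Complex.reLm).isPreconnected
      (z₀ := ((0 : ℝ) : ℂ)) (by simp) ?_
    have h_real : ∃ᶠ x : ℝ in 𝓝[≠] (0 : ℝ), complexMGF id μ x = complexMGF id ν x := by
      refine Eventually.frequently ?_
      filter_upwards [nhdsWithin_le_nhds (Iio_mem_nhds (zero_lt_one (α := ℝ)))] with y hy
      rw [complexMGF_ofReal, complexMGF_ofReal, h y hy]
    rw [frequently_iff_seq_forall] at h_real ⊢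
    obtain ⟨xs, hx_tendsto, hx_eq⟩ := h_real
    refine ⟨fun n ↦ xs n, ?_, fun n ↦ hx_eq n⟩
    rw [tendsto_nhdsWithin_iff] at hx_tendsto ⊢
    constructor
    · exact (Complex.continuous_ofReal.tendsto 0).comp hx_tendsto.1
    · simpa using hx_tendsto.2
  refine Measure.ext_of_charFun ?_
  ext t
  rw [← complexMGF_id_mul_I, ← complexMGF_id_mul_I]
  exact key (by simp)

/-- A measure is determined by its Laplace transform on `(0, ∞)`, when that is finite. -/
theorem ext_of_lap {μ ν : Measure ℝ} (h : ∀ p, 0 < p → lap μ p = lap ν p)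
    (hfin : ∀ p, 0 < p → lap μ p ≠ ⊤) : μ = ν := by
  -- Tilting by e^{-x} makes both measures finite and moves the half-line p > 0 to t = 1 - p < 1,
  -- which has 0 in its interior. The tilt is undone at the end.
  set w : ℝ → ℝ≥0∞ := fun x => ENNReal.ofReal (exp (-1 * x)) with hw
  have hwm : Measurable w := measurable_ofReal_exp_mul _
  have tilt : ∀ (ρ : Measure ℝ) (t : ℝ),
      ∫⁻ x, ENNReal.ofReal (exp (t * x)) ∂(ρ.withDensity w) = lap ρ (1 - t) := by
    intro ρ t
    rw [lintegral_withDensity_eq_lintegral_mul _ hwm (measurable_ofReal_exp_mul t)]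
    refine lintegral_congr fun x => ?_
    simp only [hw, Pi.mul_apply]
    rw [← ENNReal.ofReal_mul (exp_pos _).le, ← Real.exp_add]
    ring_nf
  have integ : ∀ ρ : Measure ℝ, (∀ p, 0 < p → lap ρ p ≠ ⊤) → ∀ t < 1,
      Integrable (fun x => exp (t * x)) (ρ.withDensity w) := by
    intro ρ hρ t ht
    refine ⟨by fun_prop, ?_⟩
    rw [hasFiniteIntegral_iff_ofReal (ae_of_all _ fun x => (exp_pos _).le), tilt]
    exact (hρ _ (by linarith)).lt_top
  have fin : ∀ ρ : Measure ℝ, (∀ p, 0 < p → lap ρ p ≠ ⊤) → IsFiniteMeasure (ρ.withDensity w) := by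
    intro ρ hρ
    refine ⟨?_⟩
    have := tilt ρ 0
    simp only [zero_mul, exp_zero, ENNReal.ofReal_one, lintegral_one, sub_zero] at this
    rw [this]
    exact (hρ 1 one_pos).lt_top
  have hfin' : ∀ p, 0 < p → lap ν p ≠ ⊤ := fun p hp => h p hp ▸ hfin p hp
  have := fin μ hfin
  have := fin ν hfin'
  have key : μ.withDensity w = ν.withDensity w := by
    refine ext_of_mgf_eq_of_lt_one (integ μ hfin) (integ ν hfin') fun t ht => ?_
    simp only [ProbabilityTheory.mgf, id]
    rw [integral_eq_lintegral_of_nonneg_ae (ae_of_all _ fun x => (exp_pos _).le) (by fun_prop),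
      integral_eq_lintegral_of_nonneg_ae (ae_of_all _ fun x => (exp_pos _).le) (by fun_prop),
      tilt, tilt, h _ (by linarith)]
  have inv : ∀ ρ : Measure ℝ, (ρ.withDensity w).withDensity (w⁻¹) = ρ := fun ρ =>
    withDensity_inv_same hwm (ae_of_all _ fun x => by simp [hw, exp_pos])
      (ae_of_all _ fun x => by simp [hw])
  rw [← inv μ, key, inv ν]

/-! ### Convolution powers and the continuity theorem -/

lemma lap_conv (μ ν : Measure ℝ) [SFinite ν] (p : ℝ) : lap (μ.conv ν) p = lap μ p * lap ν p := by
  rw [lap, Measure.lintegral_conv (measurable_ofReal_exp_mul _)]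
  have : ∀ x y : ℝ, ENNReal.ofReal (exp (-p * (x + y))) =
      ENNReal.ofReal (exp (-p * x)) * ENNReal.ofReal (exp (-p * y)) := by
    intro x y
    rw [← ENNReal.ofReal_mul (exp_pos _).le, ← Real.exp_add]
    ring_nf
  simp_rw [this]
  simp_rw [lintegral_const_mul _ (measurable_ofReal_exp_mul (-p))]
  rw [lintegral_mul_const _ (measurable_ofReal_exp_mul (-p))]
  rfl

lemma ae_nonneg_of_Iio {μ : Measure ℝ} (hμ : μ (Iio 0) = 0) : ∀ᵐ x ∂μ, 0 ≤ x := by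
  rw [ae_iff]; convert hμ using 2; ext; simp

lemma lap_le_one {μ : Measure ℝ} [IsProbabilityMeasure μ] (hμ : μ (Iio 0) = 0) {p : ℝ}
    (hp : 0 ≤ p) : lap μ p ≤ 1 := by
  have h1 : ∫⁻ _, (1 : ℝ≥0∞) ∂μ = 1 := by simp
  rw [← h1]
  refine lintegral_mono_ae ?_
  filter_upwards [ae_nonneg_of_Iio hμ] with x hx
  rw [ENNReal.ofReal_le_one, exp_le_one_iff]
  have := mul_nonneg hp hx
  linarith

lemma conv_Iio_zero {μ ν : Measure ℝ} [SFinite ν] (hμ : μ (Iio 0) = 0) (hν : ν (Iio 0) = 0) :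
    (μ.conv ν) (Iio 0) = 0 := by
  rw [← lintegral_indicator_one measurableSet_Iio,
    Measure.lintegral_conv (measurable_one.indicator measurableSet_Iio)]
  rw [← lintegral_zero (μ := μ)]
  refine lintegral_congr_ae ?_
  filter_upwards [ae_nonneg_of_Iio hμ] with x hx
  rw [← lintegral_zero (μ := ν)]
  refine lintegral_congr_ae ?_
  filter_upwards [ae_nonneg_of_Iio hν] with y hy
  simp [add_nonneg hx hy]

lemma exists_lap_pow (μ : Measure ℝ) [IsProbabilityMeasure μ] (hμ : μ (Iio 0) = 0) (n : ℕ) :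
    ∃ ν : Measure ℝ, IsProbabilityMeasure ν ∧ ν (Iio 0) = 0 ∧ ∀ p, lap ν p = lap μ p ^ n := by
  induction n with
  | zero => exact ⟨Measure.dirac 0, inferInstance, by simp, fun p => by simp [lap]⟩
  | succ n ih =>
    obtain ⟨ν, h1, h2, h3⟩ := ih
    exact ⟨ν.conv μ, inferInstance, conv_Iio_zero h2 hμ, fun p => by rw [lap_conv, h3, pow_succ]⟩

/-- The bounded continuous function on the line agreeing with `e^{-px}` on `[0, ∞)`. -/
def expBCF (p : ℝ) (hp : 0 ≤ p) : BoundedContinuousFunction ℝ NNReal :=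
  BoundedContinuousFunction.mkOfBound ⟨fun x => Real.toNNReal (exp (-p * max x 0)), by fun_prop⟩ 1
    (by
      intro x y
      have key : ∀ x : ℝ, ((Real.toNNReal (exp (-p * max x 0)) : NNReal) : ℝ) ∈ Icc (0 : ℝ) 1 := by
        intro x
        rw [Real.coe_toNNReal _ (exp_pos _).le]
        refine ⟨(exp_pos _).le, exp_le_one_iff.2 ?_⟩
        have := mul_nonneg hp (le_max_right x 0)
        linarith
      have hx := key x
      have hy := key y
      simp only [ContinuousMap.coe_mk, NNReal.dist_eq, abs_le]
      constructor <;> linarith [hx.1, hx.2, hy.1, hy.2])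

lemma lintegral_expBCF {μ : Measure ℝ} (hμ : μ (Iio 0) = 0) (p : ℝ) (hp : 0 ≤ p) :
    ∫⁻ x, expBCF p hp x ∂μ = lap μ p := by
  refine lintegral_congr_ae ?_
  filter_upwards [ae_nonneg_of_Iio hμ] with x hx
  simp [expBCF, max_eq_left hx, ENNReal.ofReal]

/-- Markov's inequality: 1 - e^{-x/r} ≥ 1 - e^{-1} for x > r. It turns convergence of the transform
to 1 at the origin into tightness. -/
lemma measure_Ioi_le_lap {μ : Measure ℝ} [IsProbabilityMeasure μ] (hμ : μ (Iio 0) = 0)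
    {r : ℝ} (hr : 0 < r) :
    μ (Ioi r) ≤ (1 - lap μ r⁻¹) / ENNReal.ofReal (1 - exp (-1)) := by
  have hc : 0 < 1 - exp (-1 : ℝ) := by
    rw [sub_pos, exp_lt_one_iff]; norm_num
  rw [ENNReal.le_div_iff_mul_le (Or.inl (by simp)) (Or.inl ENNReal.ofReal_ne_top)]
  have hl : lap μ r⁻¹ ≤ 1 := lap_le_one hμ (inv_pos.2 hr).le
  have h1 : ∫⁻ _, (1 : ℝ≥0∞) ∂μ = 1 := by simp
  refine ENNReal.le_sub_of_add_le_right (ne_top_of_le_ne_top ENNReal.one_ne_top hl) ?_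
  rw [mul_comm, ← lintegral_indicator_const measurableSet_Ioi, lap,
    ← lintegral_add_left (measurable_const.indicator measurableSet_Ioi), ← h1]
  refine lintegral_mono_ae ?_
  filter_upwards [ae_nonneg_of_Iio hμ] with x hx
  by_cases hxr : x ∈ Ioi r
  · rw [indicator_of_mem hxr, ← ENNReal.ofReal_add hc.le (exp_pos _).le, ENNReal.ofReal_le_one]
    have : exp (-r⁻¹ * x) ≤ exp (-1) := by
      rw [exp_le_exp, neg_mul, neg_le_neg_iff, inv_mul_eq_div, one_le_div hr]
      exact (mem_Ioi.1 hxr).le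
    linarith
  · rw [indicator_of_notMem hxr, zero_add, ENNReal.ofReal_le_one, exp_le_one_iff]
    have : 0 ≤ r⁻¹ * x := by positivity
    linarith

/-- Existence part of the continuity theorem for Laplace transforms. -/
theorem exists_tendsto_of_tendsto_lap {P : ℕ → ProbabilityMeasure ℝ}
    (hP : ∀ n, (P n : Measure ℝ) (Iio 0) = 0) {φ : ℝ → ℝ≥0∞}
    (hφ : ∀ p, 0 < p → Tendsto (fun n => lap (P n) p) atTop (𝓝 (φ p)))
    (hφ1 : Tendsto φ (𝓝[>] 0) (𝓝 1)) :
    ∃ Q : ProbabilityMeasure ℝ, (Q : Measure ℝ) (Iio 0) = 0 ∧ (∀ p, 0 < p → lap Q p = φ p) ∧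
      Tendsto P atTop (𝓝 Q) := by
  have htight : IsTightMeasureSet (Set.range fun n => (P n : Measure ℝ)) := by
    refine isTightMeasureSet_range_of_tendsto_limsup_measure_norm_gt ?_
    have hc : ENNReal.ofReal (1 - exp (-1 : ℝ)) ≠ 0 := by simp
    have lim : Tendsto (fun r : ℝ => (1 - φ r⁻¹) / ENNReal.ofReal (1 - exp (-1))) atTop (𝓝 0) := by
      have h1 : Tendsto (fun r : ℝ => φ r⁻¹) atTop (𝓝 1) :=
        hφ1.comp tendsto_inv_atTop_nhdsGT_zero
      have h2 := ENNReal.Tendsto.div_const (b := ENNReal.ofReal (1 - exp (-1)))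
        (ENNReal.Tendsto.sub tendsto_const_nhds h1 (Or.inl ENNReal.one_ne_top)) (Or.inr hc)
      simpa using h2
    refine tendsto_of_tendsto_of_tendsto_of_le_of_le' tendsto_const_nhds lim
      (Eventually.of_forall fun _ => zero_le) ?_
    filter_upwards [eventually_gt_atTop 0] with r hr
    have h2 : Tendsto (fun n => (1 - lap (P n) r⁻¹) / ENNReal.ofReal (1 - exp (-1))) atTop
        (𝓝 ((1 - φ r⁻¹) / ENNReal.ofReal (1 - exp (-1)))) :=
      ENNReal.Tendsto.div_const
        (ENNReal.Tendsto.sub tendsto_const_nhds (hφ _ (inv_pos.2 hr)) (Or.inl ENNReal.one_ne_top))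
        (Or.inr hc)
    rw [← h2.limsup_eq]
    refine limsup_le_limsup (Eventually.of_forall fun n => ?_)
    refine le_trans ?_ (measure_Ioi_le_lap (hP n) hr)
    refine measure_mono_ae ?_
    filter_upwards [ae_nonneg_of_Iio (hP n)] with x hx h
    have h' : r < ‖x‖ := h
    rw [Real.norm_of_nonneg hx] at h'
    exact h'
  have hcomp : IsCompact (closure (Set.range P)) := by
    refine isCompact_closure_of_isTightMeasureSet ?_
    convert htight using 1
    ext μ
    simp
  -- Every subsequential limit has transform φ, so by uniqueness there is only one, and compactness
  -- gives convergence of the whole sequence. No mass appears on the open set `Iio 0`, by the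
  -- portmanteau theorem.
  have cluster : ∀ Q : ProbabilityMeasure ℝ, ∀ ns : ℕ → ℕ, StrictMono ns →
      Tendsto (P ∘ ns) atTop (𝓝 Q) →
      (Q : Measure ℝ) (Iio 0) = 0 ∧ ∀ p, 0 < p → lap Q p = φ p := by
    intro Q ns hns hQ
    have h0 : (Q : Measure ℝ) (Iio 0) = 0 := by
      have := ProbabilityMeasure.le_liminf_measure_open_of_tendsto hQ (G := Iio 0) isOpen_Iio
      simpa [hP] using this
    refine ⟨h0, fun p hp => ?_⟩
    have h1 := (ProbabilityMeasure.tendsto_iff_forall_lintegral_tendsto.1 hQ) (expBCF p hp.le)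
    rw [lintegral_expBCF h0] at h1
    have h2 : Tendsto (fun n => lap (P (ns n)) p) atTop (𝓝 (lap Q p)) := by
      refine h1.congr fun n => ?_
      exact lintegral_expBCF (hP _) p hp.le
    exact tendsto_nhds_unique h2 ((hφ p hp).comp hns.tendsto_atTop)
  obtain ⟨Q, -, ns, hns, hQ⟩ := hcomp.tendsto_subseq (x := P) fun n => subset_closure ⟨n, rfl⟩
  obtain ⟨hQ0, hQφ⟩ := cluster Q ns hns hQ
  refine ⟨Q, hQ0, hQφ, ?_⟩
  refine hcomp.tendsto_nhds_of_unique_mapClusterPt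
    (Eventually.of_forall fun n => subset_closure ⟨n, rfl⟩) fun R _ hR => ?_
  obtain ⟨ms, hms, hR'⟩ := hR.tendsto_subseq
  obtain ⟨hR0, hRφ⟩ := cluster R ms hms hR'
  have h : (R : Measure ℝ) = Q :=
    ext_of_lap (fun p hp => (hRφ p hp).trans (hQφ p hp).symm) fun p hp =>
      ne_top_of_le_ne_top ENNReal.one_ne_top (lap_le_one hR0 hp.le)
  exact Subtype.ext h

/-! ### The log-convex representative of the kernel -/

lemma lintegral_exp_neg_mul_Ioi {p : ℝ} (hp : 0 < p) :
    ∫⁻ t in Ioi (0 : ℝ), ENNReal.ofReal (exp (-p * t)) = ENNReal.ofReal p⁻¹ := by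
  rw [← ofReal_integral_eq_lintegral_ofReal (exp_neg_integrableOn_Ioi 0 hp)
    (ae_of_all _ fun x => (exp_pos _).le), integral_exp_mul_Ioi (neg_lt_zero.2 hp)]
  simp

/-- The measure `g(x) dx` on `(0, ∞)`. -/
def kernelMeasure (g : ℝ → ℝ) : Measure ℝ :=
  (volume.restrict (Ioi 0)).withDensity fun x => ENNReal.ofReal (g x)

lemma aemeasurable_of_laplace_integrable {g : ℝ → ℝ}
    (hi : ∀ p : ℝ, 0 < p → IntegrableOn (fun t => exp (-p * t) * g t) (Ioi 0)) :
    AEMeasurable g (volume.restrict (Ioi 0)) := by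
  have h1 := (hi 1 one_pos).aemeasurable
  have h2 : AEMeasurable (fun t : ℝ => exp t * (exp (-1 * t) * g t)) (volume.restrict (Ioi 0)) :=
    (by fun_prop : AEMeasurable (fun t : ℝ => exp t) _).mul h1
  refine h2.congr (ae_of_all _ fun t => ?_)
  simp only
  rw [← mul_assoc, ← Real.exp_add]
  simp

lemma lap_kernelMeasure {g : ℝ → ℝ} (h0 : ∀ t, 0 < t → 0 ≤ g t)
    (hi : ∀ p : ℝ, 0 < p → IntegrableOn (fun t => exp (-p * t) * g t) (Ioi 0)) {p : ℝ}
    (hp : 0 < p) : lap (kernelMeasure g) p = ENNReal.ofReal (laplaceK g p) := by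
  rw [lap, kernelMeasure, lintegral_withDensity_eq_lintegral_mul₀
    (aemeasurable_of_laplace_integrable hi).ennreal_ofReal
    (measurable_ofReal_exp_mul _).aemeasurable, laplaceK,
    ofReal_integral_eq_lintegral_ofReal (hi p hp)]
  · refine lintegral_congr fun x => ?_
    simp only [Pi.mul_apply]
    rw [ENNReal.ofReal_mul (exp_pos _).le, mul_comm]
  · filter_upwards [ae_restrict_mem measurableSet_Ioi] with t ht
    exact mul_nonneg (exp_pos _).le (h0 t ht)

/-- Log-convex nonincreasing kernels with the limit behaviour of `𝒦` and `ℒ` required of an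
admissible kernel. -/
structure LogConvexKernel (g : ℝ → ℝ) : Prop where
  measurable : Measurable g
  pos : ∀ x, 0 < x → 0 < g x
  antitone : AntitoneOn g (Ioi 0)
  continuousOn : ContinuousOn g (Ioi 0)
  le_rpow_mul_rpow : ∀ x y θ : ℝ, 0 < x → 0 < y → 0 ≤ θ → θ ≤ 1 →
    g ((1 - θ) * x + θ * y) ≤ g x ^ (1 - θ) * g y ^ θ
  tendsto_zero : Tendsto g atTop (𝓝 0)
  integrable : ∀ p : ℝ, 0 < p → IntegrableOn (fun t => exp (-p * t) * g t) (Ioi 0)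
  laplaceK_zero : Tendsto (laplaceK g) (𝓝[>] 0) atTop
  laplaceL_zero : Tendsto (laplaceL g) (𝓝[>] 0) (𝓝 0)
  laplaceL_infty : Tendsto (laplaceL g) atTop atTop

/-- The constants vanish because a ≤ ℒ(p) → 0 at the origin and b ≤ 𝒦(p) → 0 at infinity. -/
lemma IsAdmissibleKernel.exists_stieltjes_measure {k : ℝ → ℝ} (hk : IsAdmissibleKernel k) :
    ∃ ρ : Measure ℝ, SFinite ρ ∧ ρ (Iio 0) = 0 ∧
      ∀ p, 0 < p → ∫⁻ r, ENNReal.ofReal (p + r)⁻¹ ∂ρ = ENNReal.ofReal (laplaceK k p) := by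
  obtain ⟨a, b, σ, ha, hb, hσ, hK⟩ := hk.stieltjes
  set ρ := σ.restrict (Ici 0) with hρ
  have hρ0 : ρ (Iio 0) = 0 := by
    rw [hρ, Measure.restrict_apply measurableSet_Iio]
    convert measure_empty (μ := σ)
    ext x
    simp
  have hnn : ∀ᵐ r ∂ρ, 0 ≤ r := ae_nonneg_of_Iio hρ0
  have hint : ∀ p, 0 < p → Integrable (fun r => (p + r)⁻¹) ρ := by
    intro p hp
    refine Integrable.mono' ((hσ : Integrable _ ρ).const_mul (max 1 p⁻¹)) (by fun_prop) ?_
    filter_upwards [hnn] with r hr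
    rw [Real.norm_of_nonneg (by positivity), ← div_eq_mul_inv, inv_eq_one_div,
      div_le_div_iff₀ (by positivity) (by positivity), one_mul]
    have h1 : 1 ≤ max 1 p⁻¹ * p := by
      calc 1 = p⁻¹ * p := (inv_mul_cancel₀ hp.ne').symm
        _ ≤ _ := by gcongr; exact le_max_right _ _
    nlinarith [le_max_left 1 p⁻¹]
  have hnonneg : ∀ p, 0 < p → 0 ≤ ∫ r, (p + r)⁻¹ ∂ρ := by
    intro p hp
    refine integral_nonneg_of_ae ?_
    filter_upwards [hnn] with r hr
    simp only [Pi.zero_apply]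
    positivity
  have ha0 : a = 0 := by
    refine le_antisymm ?_ ha
    refine ge_of_tendsto hk.laplaceL_zero ?_
    filter_upwards [self_mem_nhdsWithin] with p hp
    have hp : 0 < p := hp
    rw [laplaceL, hK p hp, mul_add, mul_add, mul_div_cancel₀ _ hp.ne']
    have := mul_nonneg hp.le (hnonneg p hp)
    have := mul_nonneg hp.le hb
    linarith
  have hb0 : b = 0 := by
    refine le_antisymm ?_ hb
    refine ge_of_tendsto hk.laplaceK_infty ?_
    filter_upwards [eventually_gt_atTop 0] with p hp
    rw [hK p hp, ha0]
    have := hnonneg p hp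
    simp
    linarith
  refine ⟨ρ, ?_, hρ0, fun p hp => ?_⟩
  -- The measure with density 1/(1 + r) is finite, and ρ is recovered from it by the inverse
  -- density. This makes ρ s-finite, as Tonelli's theorem requires.
  · set w : ℝ → ℝ≥0∞ := fun r => ENNReal.ofReal |1 + r|⁻¹ with hw
    have hwm : Measurable w := by fun_prop
    have hfin : IsFiniteMeasure (ρ.withDensity w) := by
      refine isFiniteMeasure_withDensity_ofReal ?_
      have := (hσ : Integrable _ ρ).2
      refine this.congr ?_
      filter_upwards [hnn] with r hr
      rw [abs_of_nonneg (by positivity)]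
    rw [← withDensity_inv_same (μ := ρ) hwm ?_ (ae_of_all _ fun x => by simp [hw])]
    · infer_instance
    · filter_upwards [hnn] with r hr
      simp only [hw, ne_eq, ENNReal.ofReal_eq_zero, not_le]
      positivity
  · rw [hK p hp, ha0, hb0, ← ofReal_integral_eq_lintegral_ofReal (hint p hp)]
    · simp [hρ]
    · filter_upwards [hnn] with r hr
      simp only [Pi.zero_apply]
      positivity

/-- From 1 + rx ≤ e^{rx}. Integrated in r, it bounds the completely monotone function at x by
ℒ(1/x), giving both finiteness and decay at infinity. -/
lemma exp_neg_mul_le_div {x r : ℝ} (hx : 0 < x) (hr : 0 ≤ r) :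
    exp (-r * x) ≤ x⁻¹ * (x⁻¹ + r)⁻¹ := by
  have h1 : x⁻¹ * (x⁻¹ + r)⁻¹ = (1 + r * x)⁻¹ := by
    rw [← mul_inv, mul_add, mul_inv_cancel₀ hx.ne']; ring
  rw [h1, neg_mul, Real.exp_neg]
  refine inv_anti₀ (by positivity) ?_
  linarith [add_one_le_exp (r * x)]

/-- An admissible kernel agrees almost everywhere with a completely monotone, hence log-convex,
kernel. -/
theorem IsAdmissibleKernel.exists_logConvexKernel {k : ℝ → ℝ} (hk : IsAdmissibleKernel k) :
    ∃ g, LogConvexKernel g ∧ k =ᵐ[volume.restrict (Ioi 0)] g := by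
  obtain ⟨ρ, hsf, hρ0, hρ⟩ := hk.exists_stieltjes_measure
  have hnn : ∀ᵐ r ∂ρ, 0 ≤ r := ae_nonneg_of_Iio hρ0
  set G : ℝ → ℝ≥0∞ := fun x => ∫⁻ r, ENNReal.ofReal (exp (-r * x)) ∂ρ with hG
  have hGm : Measurable G := by
    refine Measurable.lintegral_prod_right'
      (f := fun z : ℝ × ℝ => ENNReal.ofReal (exp (-z.2 * z.1))) (by fun_prop)
  have hGle : ∀ x, 0 < x → G x ≤ ENNReal.ofReal (laplaceL k x⁻¹) := by
    intro x hx
    rw [laplaceL, ENNReal.ofReal_mul (by positivity), ← hρ _ (inv_pos.2 hx),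
      ← lintegral_const_mul _ (by fun_prop)]
    refine lintegral_mono_ae ?_
    filter_upwards [hnn] with r hr
    rw [← ENNReal.ofReal_mul (by positivity)]
    exact ENNReal.ofReal_le_ofReal (exp_neg_mul_le_div hx hr)
  have hGfin : ∀ x, 0 < x → G x ≠ ⊤ := fun x hx =>
    ne_top_of_le_ne_top ENNReal.ofReal_ne_top (hGle x hx)
  -- By Tonelli the Laplace transform of G is the Stieltjes integral, so uniqueness identifies `k`
  -- with G almost everywhere.
  have hGlap : ∀ p, 0 < p → lap ((volume.restrict (Ioi 0)).withDensity G) p =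
      ENNReal.ofReal (laplaceK k p) := by
    intro p hp
    rw [lap, lintegral_withDensity_eq_lintegral_mul _ hGm (measurable_ofReal_exp_mul _),
      ← hρ p hp]
    have h1 : ∀ x : ℝ, (G * fun x => ENNReal.ofReal (exp (-p * x))) x =
        ∫⁻ r, ENNReal.ofReal (exp (-(p + r) * x)) ∂ρ := by
      intro x
      simp only [Pi.mul_apply, hG]
      rw [← lintegral_mul_const _ (by fun_prop)]
      refine lintegral_congr fun r => ?_
      rw [← ENNReal.ofReal_mul (exp_pos _).le, ← Real.exp_add]
      ring_nf
    simp_rw [h1]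
    rw [lintegral_lintegral_swap (by fun_prop)]
    refine lintegral_congr_ae ?_
    filter_upwards [hnn] with r hr
    exact lintegral_exp_neg_mul_Ioi (by linarith)
  have hkm := aemeasurable_of_laplace_integrable hk.laplace_integrable
  have hkG : (fun x => ENNReal.ofReal (k x)) =ᵐ[volume.restrict (Ioi 0)] G := by
    rw [← withDensity_eq_iff_of_sigmaFinite hkm.ennreal_ofReal hGm.aemeasurable]
    refine ext_of_lap (fun p hp => ?_) fun p hp => ?_
    · rw [hGlap p hp]
      exact lap_kernelMeasure hk.nonneg hk.laplace_integrable hp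
    · exact (lap_kernelMeasure hk.nonneg hk.laplace_integrable hp).trans_ne ENNReal.ofReal_ne_top
  set g : ℝ → ℝ := fun x => (G x).toReal with hg
  have hkg : k =ᵐ[volume.restrict (Ioi 0)] g := by
    filter_upwards [hkG, ae_restrict_mem measurableSet_Ioi] with x hx hx0
    rw [hg]
    simp only
    rw [← hx, ENNReal.toReal_ofReal (hk.nonneg x hx0)]
  have hKeq : laplaceK g = laplaceK k := by
    funext p
    refine integral_congr_ae ?_
    filter_upwards [hkg] with x hx
    rw [hx]
  have hLeq : laplaceL g = laplaceL k := by
    funext p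
    rw [laplaceL, laplaceL, hKeq]
  have hρne : ρ ≠ 0 := by
    intro h
    obtain ⟨p, hp1, hp0⟩ := ((hk.laplaceK_zero.eventually_gt_atTop 0).and
      self_mem_nhdsWithin).exists
    have := hρ p hp0
    rw [h, lintegral_zero_measure, eq_comm, ENNReal.ofReal_eq_zero] at this
    linarith
  refine ⟨g, ⟨hGm.ennreal_toReal, fun x hx => ?_, fun x hx y hy hxy => ?_, fun x hx => ?_,
    fun x y θ hx hy h0 h1 => ?_, ?_, fun p hp => ?_, ?_, ?_, ?_⟩, hkg⟩
  · refine ENNReal.toReal_pos (fun h => hρne ?_) (hGfin x hx)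
    rw [lintegral_eq_zero_iff (by fun_prop)] at h
    rw [← ae_eq_bot]
    by_contra hne
    have : NeBot (ae ρ) := ⟨hne⟩
    obtain ⟨r, hr⟩ := h.exists
    simp only [Pi.zero_apply, ENNReal.ofReal_eq_zero] at hr
    exact absurd hr (not_le.2 (exp_pos _))
  · refine ENNReal.toReal_mono (hGfin x hx) (lintegral_mono_ae ?_)
    filter_upwards [hnn] with r hr
    refine ENNReal.ofReal_le_ofReal (exp_le_exp.2 ?_)
    nlinarith
  · refine ContinuousAt.continuousWithinAt ?_
    have hx : 0 < x := hx
    refine (ENNReal.tendsto_toReal (hGfin x hx)).comp ?_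
    refine tendsto_lintegral_filter_of_dominated_convergence
      (fun r => ENNReal.ofReal (exp (-r * (x / 2)))) (Eventually.of_forall fun _ => by fun_prop)
      ?_ (hGfin _ (by linarith)) (ae_of_all _ fun r => ?_)
    · filter_upwards [eventually_gt_nhds (show x / 2 < x by linarith)] with y hy
      filter_upwards [hnn] with r hr
      refine ENNReal.ofReal_le_ofReal (exp_le_exp.2 ?_)
      nlinarith
    · have : Continuous fun y : ℝ => ENNReal.ofReal (exp (-r * y)) :=
        ENNReal.continuous_ofReal.comp (by fun_prop)
      exact this.tendsto x
  -- Log-convexity is Hölder's inequality for e^{-rx} and e^{-ry} with weights 1 - θ and θ.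
  · have h := ENNReal.lintegral_mul_norm_pow_le (μ := ρ)
      (f := fun r => ENNReal.ofReal (exp (-r * x))) (g := fun r => ENNReal.ofReal (exp (-r * y)))
      (by fun_prop) (by fun_prop) (sub_nonneg.2 h1) h0 (by ring)
    have h2 : G ((1 - θ) * x + θ * y) ≤ G x ^ (1 - θ) * G y ^ θ := by
      refine le_trans (le_of_eq (lintegral_congr fun r => ?_)) h
      rw [ENNReal.ofReal_rpow_of_pos (exp_pos _), ENNReal.ofReal_rpow_of_pos (exp_pos _),
        ← ENNReal.ofReal_mul (rpow_nonneg (exp_pos _).le _), ← Real.exp_mul, ← Real.exp_mul,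
        ← Real.exp_add]
      ring_nf
    simp only [hg]
    rw [ENNReal.toReal_rpow, ENNReal.toReal_rpow, ← ENNReal.toReal_mul]
    refine ENNReal.toReal_mono (ENNReal.mul_ne_top ?_ ?_) h2
    · exact ENNReal.rpow_ne_top_of_nonneg (sub_nonneg.2 h1) (hGfin x hx)
    · exact ENNReal.rpow_ne_top_of_nonneg h0 (hGfin y hy)
  · refine tendsto_of_tendsto_of_tendsto_of_le_of_le' tendsto_const_nhds
      (hk.laplaceL_zero.comp tendsto_inv_atTop_nhdsGT_zero)
      (Eventually.of_forall fun _ => ENNReal.toReal_nonneg) ?_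
    filter_upwards [eventually_gt_atTop 0] with x hx
    refine ENNReal.toReal_le_of_le_ofReal ?_ (hGle x hx)
    refine mul_nonneg (inv_pos.2 hx).le (integral_nonneg_of_ae ?_)
    filter_upwards [ae_restrict_mem measurableSet_Ioi] with t ht
    exact mul_nonneg (exp_pos _).le (hk.nonneg t ht)
  · refine (hk.laplace_integrable p hp).congr ?_
    filter_upwards [hkg] with x hx
    rw [hx]
  · rw [hKeq]; exact hk.laplaceK_zero
  · rw [hLeq]; exact hk.laplaceL_zero
  · rw [hLeq]; exact hk.laplaceL_infty

/-! ### Kaluza's theorem for log-convex sequences -/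

/-- The convolution inverse of a sequence `g` with respect to the constant sequence `1`:
`∑_{i + j = n} g i * U j = 1`. -/
def renewalSeq (g : ℕ → ℝ) : ℕ → ℝ
  | n => (1 - ∑ j : Fin n, g (n - j) * renewalSeq g j) / g 0

lemma renewalSeq_eq (g : ℕ → ℝ) (n : ℕ) :
    renewalSeq g n = (1 - ∑ j ∈ Finset.range n, g (n - j) * renewalSeq g j) / g 0 := by
  rw [renewalSeq, Finset.sum_range fun j => g (n - j) * renewalSeq g j]

lemma sum_mul_renewalSeq {g : ℕ → ℝ} (h0 : g 0 ≠ 0) (n : ℕ) :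
    ∑ j ∈ Finset.range (n + 1), g (n - j) * renewalSeq g j = 1 := by
  rw [Finset.sum_range_succ, renewalSeq_eq g n, Nat.sub_self, mul_div_cancel₀ _ h0]
  ring

/-- Kaluza's theorem for the differences of `renewalSeq`. -/
lemma renewalSeq_succ_le {g : ℕ → ℝ} (hpos : ∀ n, 0 < g n)
    (hlc : ∀ n, g (n + 1) ^ 2 ≤ g n * g (n + 2)) (n : ℕ) :
    renewalSeq g (n + 1) ≤ renewalSeq g n := by
  -- Log-convexity as monotonicity of the ratios g(n+1)/g(n), with denominators cleared.
  have hratio : ∀ m n, m ≤ n → g (m + 1) * g n ≤ g (n + 1) * g m := by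
    intro m n hmn
    induction n, hmn using Nat.le_induction with
    | base => exact le_rfl
    | succ n hmn ih =>
      have h1 := hlc n
      have h2 := hpos n
      have h3 := hpos (n + 1)
      refine le_of_mul_le_mul_right ?_ h2
      calc g (m + 1) * g (n + 1) * g n = (g (m + 1) * g n) * g (n + 1) := by ring
        _ ≤ (g (n + 1) * g m) * g (n + 1) := by gcongr
        _ = g (n + 1) ^ 2 * g m := by ring
        _ ≤ (g n * g (n + 2)) * g m := by
          gcongr
          exact (hpos m).le
        _ = g (n + 1 + 1) * g m * g n := by ring
  -- Subtracting two consecutive convolution identities shows that the differences d_j = U_j -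
  -- U_{j+1} solve a renewal equation of their own.
  have hdiff : ∀ n, g (n + 1) * renewalSeq g 0 =
      ∑ j ∈ Finset.range (n + 1), g (n - j) * (renewalSeq g j - renewalSeq g (j + 1)) := by
    intro n
    have h1 := sum_mul_renewalSeq (hpos 0).ne' (n + 1)
    have h2 := sum_mul_renewalSeq (hpos 0).ne' n
    rw [Finset.sum_range_succ'] at h1
    simp only [mul_sub, Finset.sum_sub_distrib, h2]
    simp only [Nat.reduceSubDiff, Nat.sub_zero] at h1
    linarith
  have hU0 : 0 < renewalSeq g 0 := by
    rw [renewalSeq_eq]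
    simpa using hpos 0
  rw [← sub_nonneg]
  induction n using Nat.strong_induction_on with
  | _ n ih =>
    have h1 := hdiff n
    rw [Finset.sum_range_succ, Nat.sub_self] at h1
    rcases Nat.eq_zero_or_pos n with rfl | hn
    · simp only [Finset.range_zero, Finset.sum_empty, zero_add] at h1
      exact nonneg_of_mul_nonneg_right (h1 ▸ (mul_pos (hpos _) hU0).le) (hpos 0)
    · obtain ⟨m, rfl⟩ : ∃ m, n = m + 1 := ⟨n - 1, by omega⟩
      have h2 := hdiff m
      -- Cross-multiplying the equations for indices m and m + 1 cancels their left sides. The ratio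
      -- inequality and d_j ≥ 0 for j ≤ m order the sums, and the leftover term is a positive
      -- multiple of d_{m+1}.
      have h3 : g (m + 1) * ∑ j ∈ Finset.range (m + 1),
          g (m + 1 - j) * (renewalSeq g j - renewalSeq g (j + 1)) ≤
          g (m + 2) * ∑ j ∈ Finset.range (m + 1),
          g (m - j) * (renewalSeq g j - renewalSeq g (j + 1)) := by
        rw [Finset.mul_sum, Finset.mul_sum]
        refine Finset.sum_le_sum fun j hj => ?_
        have hj' := Finset.mem_range.1 hj
        rw [← mul_assoc, ← mul_assoc]
        refine mul_le_mul_of_nonneg_right ?_ (ih j hj')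
        have := hratio (m - j) (m + 1) (by omega)
        rw [show m + 1 - j = m - j + 1 by omega]
        linarith
      rw [← h2] at h3
      have h4 : 0 ≤ g (m + 1) * (g 0 * (renewalSeq g (m + 1) - renewalSeq g (m + 1 + 1))) := by
        have h5 : g (m + 1) * (g (m + 1 + 1) * renewalSeq g 0) =
          g (m + 2) * (g (m + 1) * renewalSeq g 0) := by ring
        rw [h1, mul_add] at h5
        linarith
      exact nonneg_of_mul_nonneg_right (nonneg_of_mul_nonneg_right h4 (hpos _)) (hpos 0)

lemma renewalSeq_nonneg {g : ℕ → ℝ} (hpos : ∀ n, 0 < g n) (hanti : Antitone g)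
    (hlc : ∀ n, g (n + 1) ^ 2 ≤ g n * g (n + 2)) (n : ℕ) : 0 ≤ renewalSeq g n := by
  rcases Nat.eq_zero_or_pos n with rfl | hn
  · rw [renewalSeq_eq]
    simpa using (hpos 0).le
  obtain ⟨m, rfl⟩ : ∃ m, n = m + 1 := ⟨n - 1, by omega⟩
  have h2 := sum_mul_renewalSeq (hpos 0).ne' m
  by_contra hneg
  push Not at hneg
  have h3 : g (m + 1) * renewalSeq g 0 =
      ∑ j ∈ Finset.range (m + 1), g (m - j) * (renewalSeq g j - renewalSeq g (j + 1)) := by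
    have h1 := sum_mul_renewalSeq (hpos 0).ne' (m + 1)
    rw [Finset.sum_range_succ'] at h1
    simp only [mul_sub, Finset.sum_sub_distrib, h2]
    simp only [Nat.reduceSubDiff, Nat.sub_zero] at h1
    linarith
  -- Replacing each weight by the smaller g(m+1) makes the sum telescope, which leaves g(m+1)
  -- U_{m+1} ≥ 0.
  have h4 : g (m + 1) * (renewalSeq g 0 - renewalSeq g (m + 1)) ≤ g (m + 1) * renewalSeq g 0 := by
    rw [h3, ← Finset.sum_range_sub', Finset.mul_sum]
    refine Finset.sum_le_sum fun j _ => mul_le_mul_of_nonneg_right (hanti (by omega)) ?_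
    exact sub_nonneg.2 (renewalSeq_succ_le hpos hlc j)
  have := mul_pos_of_neg_of_neg hneg (neg_lt_zero.2 (hpos (m + 1)))
  nlinarith

/-- Let n → ∞ in the convolution identity, by dominated convergence: z ∑ U_j = 1. Hence the lattice
law has total mass one. -/
lemma hasSum_renewalSeq {g : ℕ → ℝ} (hpos : ∀ n, 0 < g n) (hanti : Antitone g)
    (hlc : ∀ n, g (n + 1) ^ 2 ≤ g n * g (n + 2)) {z : ℝ} (hz : 0 < z)
    (hlim : Tendsto g atTop (𝓝 z)) : HasSum (renewalSeq g) z⁻¹ := by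
  have hnn := renewalSeq_nonneg hpos hanti hlc
  have hge : ∀ n, z ≤ g n := fun n => hanti.le_of_tendsto hlim n
  have hs : Summable (renewalSeq g) := by
    refine summable_of_sum_range_le (c := z⁻¹) hnn fun n => ?_
    rcases Nat.eq_zero_or_pos n with rfl | hn
    · simpa using hz.le
    obtain ⟨m, rfl⟩ : ∃ m, n = m + 1 := ⟨n - 1, by omega⟩
    rw [← mul_le_mul_iff_right₀ hz, mul_inv_cancel₀ hz.ne', ← sum_mul_renewalSeq (hpos 0).ne' m,
      Finset.mul_sum]
    exact Finset.sum_le_sum fun j _ => mul_le_mul_of_nonneg_right (hge _) (hnn j)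
  have h1 : Tendsto (fun n => ∑' j, (if j ≤ n then g (n - j) * renewalSeq g j else 0)) atTop
      (𝓝 (∑' j, z * renewalSeq g j)) := by
    refine tendsto_tsum_of_dominated_convergence (bound := fun j => g 0 * renewalSeq g j)
      (hs.mul_left _) (fun j => ?_) (Eventually.of_forall fun n j => ?_)
    · have h2 : Tendsto (fun n => g (n - j) * renewalSeq g j) atTop (𝓝 (z * renewalSeq g j)) :=
        (hlim.comp (tendsto_sub_atTop_nat j)).mul_const _
      refine h2.congr' ?_
      filter_upwards [eventually_ge_atTop j] with n hn
      rw [if_pos hn]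
    · split_ifs
      · rw [Real.norm_of_nonneg (mul_nonneg (hpos _).le (hnn j))]
        exact mul_le_mul_of_nonneg_right (hanti (Nat.zero_le _)) (hnn j)
      · simpa using mul_nonneg (hpos 0).le (hnn j)
  have h2 : ∀ n, ∑' j, (if j ≤ n then g (n - j) * renewalSeq g j else 0) = 1 := by
    intro n
    rw [tsum_eq_sum (s := Finset.range (n + 1))]
    · rw [← sum_mul_renewalSeq (hpos 0).ne' n]
      refine Finset.sum_congr rfl fun j hj => if_pos ?_
      exact Nat.lt_succ_iff.1 (Finset.mem_range.1 hj)
    · intro j hj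
      refine if_neg fun h => hj (Finset.mem_range.2 (Nat.lt_succ_iff.2 h))
  simp_rw [h2] at h1
  have h3 := tendsto_nhds_unique h1 tendsto_const_nhds
  rw [tsum_mul_left] at h3
  rw [← eq_inv_of_mul_eq_one_right h3]
  exact hs.hasSum

/-- The convolution identity read as a Cauchy product of generating functions. -/
lemma tsum_renewalSeq_mul_pow {g : ℕ → ℝ} (hpos : ∀ n, 0 < g n) (hanti : Antitone g)
    (hlc : ∀ n, g (n + 1) ^ 2 ≤ g n * g (n + 2)) {x : ℝ} (hx0 : 0 < x) (hx1 : x < 1) :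
    (∑' n, renewalSeq g n * x ^ n) * (∑' n, g n * x ^ n) = (1 - x)⁻¹ := by
  have hnn := renewalSeq_nonneg hpos hanti hlc
  have hUanti : Antitone (renewalSeq g) := antitone_nat_of_succ_le (renewalSeq_succ_le hpos hlc)
  have hgeo := summable_geometric_of_lt_one hx0.le hx1
  have hs : ∀ u : ℕ → ℝ, (∀ n, 0 ≤ u n) → Antitone u → Summable fun n => ‖u n * x ^ n‖ := by
    intro u hu hua
    refine Summable.of_nonneg_of_le (fun _ => norm_nonneg _) (fun n => ?_) (hgeo.mul_left (u 0))
    rw [Real.norm_of_nonneg (mul_nonneg (hu n) (by positivity))]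
    exact mul_le_mul_of_nonneg_right (hua (Nat.zero_le n)) (by positivity)
  rw [tsum_mul_tsum_eq_tsum_sum_range_of_summable_norm (hs _ hnn hUanti)
    (hs _ (fun n => (hpos n).le) hanti), ← tsum_geometric_of_lt_one hx0.le hx1]
  refine tsum_congr fun n => ?_
  rw [← one_mul (x ^ n), ← sum_mul_renewalSeq (hpos 0).ne' n, Finset.sum_mul]
  refine Finset.sum_congr rfl fun j hj => ?_
  have hj' : j + (n - j) = n := by have := Finset.mem_range.1 hj; omega
  calc renewalSeq g j * x ^ j * (g (n - j) * x ^ (n - j))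
      = g (n - j) * renewalSeq g j * x ^ (j + (n - j)) := by rw [pow_add]; ring
    _ = _ := by rw [hj']

/-! ### Riemann sums and lattice approximation of the resolvent law -/

section

lemma monotone_mesh {h : ℝ} (hh : 0 < h) (c : ℝ) : Monotone fun n : ℕ => h * (n + c) := by
  intro m n hmn
  have : (m : ℝ) ≤ n := by exact_mod_cast hmn
  exact mul_le_mul_of_nonneg_left (by linarith) hh.le

lemma pairwise_disjoint_mesh {h : ℝ} (hh : 0 < h) (c : ℝ) :
    Pairwise (Function.onFun Disjoint fun n : ℕ => Ioc (h * (n + c)) (h * (n + 1 + c))) := by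
  have := (monotone_mesh hh c).pairwise_disjoint_on_Ioc_succ
  simpa using this

lemma iUnion_Ioc_mesh {h : ℝ} (hh : 0 < h) (c : ℝ) :
    ⋃ n : ℕ, Ioc (h * (n + c)) (h * (n + 1 + c)) = Ioi (h * c) := by
  have h1 : ¬ BddAbove (range fun n : ℕ => h * (n + c)) := by
    have : Tendsto (fun n : ℕ => h * (n + c)) atTop atTop :=
      (tendsto_natCast_atTop_atTop.atTop_add tendsto_const_nhds).const_mul_atTop hh
    exact not_bddAbove_of_tendsto_atTop this
  have := iUnion_Ioc_map_succ_eq_Ioi (f := fun n : ℕ => h * (n + c))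
    (fun n => monotone_mesh hh c (Nat.zero_le n)) h1
  simpa using this

lemma volume_Ioc_mesh (h : ℝ) (c : ℝ) (n : ℕ) :
    volume (Ioc (h * (n + c)) (h * (n + 1 + c))) = ENNReal.ofReal h := by
  rw [Real.volume_Ioc]; congr 1; ring

lemma tsum_mesh_le {F : ℝ → ℝ≥0∞} (hF : AntitoneOn F (Ioi 0)) {h : ℝ} (hh : 0 < h) :
    ∑' n : ℕ, F (h * (n + 1)) * ENNReal.ofReal h ≤ ∫⁻ t in Ioi 0, F t := by
  have h0 := iUnion_Ioc_mesh hh 0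
  rw [mul_zero] at h0
  rw [← h0, lintegral_iUnion (fun _ => measurableSet_Ioc) (pairwise_disjoint_mesh hh 0)]
  refine ENNReal.tsum_le_tsum fun n => ?_
  rw [← volume_Ioc_mesh h 0 n, ← setLIntegral_const]
  refine setLIntegral_mono' measurableSet_Ioc fun t ht => ?_
  simp only [add_zero] at ht
  have hn : (0 : ℝ) ≤ h * n := by positivity
  exact hF (lt_of_le_of_lt hn ht.1) (show (0 : ℝ) < _ by positivity) ht.2

lemma le_tsum_mesh {F : ℝ → ℝ≥0∞} (hF : AntitoneOn F (Ioi 0)) {h : ℝ} (hh : 0 < h) :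
    ∫⁻ t in Ioi h, F t ≤ ∑' n : ℕ, F (h * (n + 1)) * ENNReal.ofReal h := by
  have h0 := iUnion_Ioc_mesh hh 1
  rw [mul_one] at h0
  rw [← h0, lintegral_iUnion (fun _ => measurableSet_Ioc) (pairwise_disjoint_mesh hh 1)]
  refine ENNReal.tsum_le_tsum fun n => ?_
  rw [← volume_Ioc_mesh h 1 n, ← setLIntegral_const]
  refine setLIntegral_mono' measurableSet_Ioc fun t ht => ?_
  have hn : (0 : ℝ) < h * (n + 1) := by positivity
  exact hF hn (hn.trans ht.1) ht.1.le

/-- For a decreasing function the right-endpoint sums lie between the integrals over (h, ∞) and (0,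
∞), so a singularity at 0 does no harm. -/
lemma tendsto_tsum_mesh {F : ℝ → ℝ≥0∞} (hF : AntitoneOn F (Ioi 0)) :
    Tendsto (fun N : ℕ => ∑' n : ℕ, F (1 / ((N : ℝ) + 1) * (n + 1)) *
      ENNReal.ofReal (1 / ((N : ℝ) + 1))) atTop (𝓝 (∫⁻ t in Ioi 0, F t)) := by
  have hpos : ∀ N : ℕ, 0 < 1 / ((N : ℝ) + 1) := fun N => Nat.one_div_pos_of_nat
  have hmono : Monotone fun N : ℕ => Ioi (1 / ((N : ℝ) + 1)) := fun m n hmn =>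
    Ioi_subset_Ioi (Nat.one_div_le_one_div hmn)
  have hU : ⋃ N : ℕ, Ioi (1 / ((N : ℝ) + 1)) = Ioi 0 := by
    ext x
    simp only [mem_iUnion, mem_Ioi]
    exact ⟨fun ⟨N, hN⟩ => (hpos N).trans hN, fun hx => exists_nat_one_div_lt hx⟩
  have hlow : Tendsto (fun N : ℕ => ∫⁻ t in Ioi (1 / ((N : ℝ) + 1)), F t) atTop
      (𝓝 (∫⁻ t in Ioi 0, F t)) := by
    have h1 := tendsto_measure_iUnion_atTop (μ := volume.withDensity F) hmono
    rw [hU, withDensity_apply _ measurableSet_Ioi] at h1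
    refine h1.congr fun N => ?_
    exact withDensity_apply _ measurableSet_Ioi
  exact tendsto_of_tendsto_of_tendsto_of_le_of_le hlow tendsto_const_nhds
    (fun N => le_tsum_mesh hF (hpos N)) (fun N => tsum_mesh_le hF (hpos N))

/-- The sequence `z + g(h), z + g(2h), …`. -/
def meshSeq (g : ℝ → ℝ) (z h : ℝ) (n : ℕ) : ℝ := z + g (h * (n + 1))

/-- The discrete approximation `∑ z U_n δ_{hn}` of the resolvent measure. -/
def meshMeasure (g : ℝ → ℝ) (z h : ℝ) : Measure ℝ :=
  Measure.sum fun n : ℕ => ENNReal.ofReal (z * renewalSeq (meshSeq g z h) n) •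
    Measure.dirac (h * n)

section Mesh
variable {g : ℝ → ℝ} {z h : ℝ}

lemma LogConvexKernel.meshSeq_pos (hg : LogConvexKernel g) (hz : 0 < z) (hh : 0 < h) (n : ℕ) :
    0 < meshSeq g z h n := add_pos hz (hg.pos _ (by positivity))

lemma LogConvexKernel.meshSeq_antitone (hg : LogConvexKernel g) (hh : 0 < h) :
    Antitone (meshSeq g z h) := by
  intro m n hmn
  have : (m : ℝ) ≤ n := by exact_mod_cast hmn
  refine add_le_add le_rfl (hg.antitone (show (0 : ℝ) < _ by positivity)
    (show (0 : ℝ) < _ by positivity) ?_)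
  gcongr

/-- Adding the constant z preserves v² ≤ uw, because the cross term needs only 2v ≤ u + w, the
arithmetic-geometric mean inequality. -/
lemma LogConvexKernel.meshSeq_logConvex (hg : LogConvexKernel g) (hz : 0 < z) (hh : 0 < h)
    (n : ℕ) : meshSeq g z h (n + 1) ^ 2 ≤ meshSeq g z h n * meshSeq g z h (n + 2) := by
  have hp : ∀ m : ℕ, 0 < h * ((m : ℝ) + 1) := fun m => by positivity
  have h1 := hg.le_rpow_mul_rpow _ _ (1 / 2) (hp n) (hp (n + 2)) (by norm_num) (by norm_num)
  have e : (1 - 1 / 2) * (h * ((n : ℝ) + 1)) + 1 / 2 * (h * (((n + 2 : ℕ) : ℝ) + 1)) =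
      h * (((n + 1 : ℕ) : ℝ) + 1) := by push_cast; ring
  rw [e, show (1 - 1 / 2 : ℝ) = 1 / 2 by norm_num, ← Real.sqrt_eq_rpow, ← Real.sqrt_eq_rpow] at h1
  simp only [meshSeq]
  set u := g (h * ((n : ℝ) + 1))
  set v := g (h * (((n + 1 : ℕ) : ℝ) + 1))
  set w := g (h * (((n + 2 : ℕ) : ℝ) + 1))
  have hu : 0 < u := hg.pos _ (hp _)
  have hw : 0 < w := hg.pos _ (hp _)
  have su := Real.sq_sqrt hu.le
  have sw := Real.sq_sqrt hw.le
  have hu' := Real.sqrt_nonneg u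
  have hw' := Real.sqrt_nonneg w
  have hv : 0 < v := hg.pos _ (hp _)
  have h2 : v ^ 2 ≤ u * w := by
    calc v ^ 2 ≤ (√u * √w) ^ 2 := by gcongr
      _ = u * w := by rw [mul_pow, su, sw]
  have h3 : 2 * v ≤ u + w := by nlinarith [sq_nonneg (√u - √w)]
  nlinarith

lemma LogConvexKernel.meshSeq_tendsto (hg : LogConvexKernel g) (hh : 0 < h) :
    Tendsto (meshSeq g z h) atTop (𝓝 z) := by
  have h1 : Tendsto (fun n : ℕ => h * ((n : ℝ) + 1)) atTop atTop :=
    (tendsto_natCast_atTop_atTop.atTop_add tendsto_const_nhds).const_mul_atTop hh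
  have h2 := (hg.tendsto_zero.comp h1).const_add z
  rw [add_zero] at h2
  exact h2

lemma LogConvexKernel.hasSum_meshSeq (hg : LogConvexKernel g) (hz : 0 < z) (hh : 0 < h) :
    HasSum (fun n => z * renewalSeq (meshSeq g z h) n) 1 := by
  have := (hasSum_renewalSeq (hg.meshSeq_pos hz hh) (hg.meshSeq_antitone hh)
    (hg.meshSeq_logConvex hz hh) hz (hg.meshSeq_tendsto hh)).mul_left z
  rwa [mul_inv_cancel₀ hz.ne'] at this

lemma LogConvexKernel.mul_renewalSeq_nonneg (hg : LogConvexKernel g) (hz : 0 < z) (hh : 0 < h)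
    (n : ℕ) : 0 ≤ z * renewalSeq (meshSeq g z h) n :=
  mul_nonneg hz.le (renewalSeq_nonneg (hg.meshSeq_pos hz hh) (hg.meshSeq_antitone hh)
    (hg.meshSeq_logConvex hz hh) n)

lemma LogConvexKernel.isProbabilityMeasure_meshMeasure (hg : LogConvexKernel g) (hz : 0 < z)
    (hh : 0 < h) : IsProbabilityMeasure (meshMeasure g z h) := by
  refine ⟨?_⟩
  rw [meshMeasure, Measure.sum_apply _ MeasurableSet.univ]
  simp only [Measure.smul_apply, measure_univ, smul_eq_mul, mul_one]
  rw [← ENNReal.ofReal_tsum_of_nonneg (hg.mul_renewalSeq_nonneg hz hh)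
    (hg.hasSum_meshSeq hz hh).summable, (hg.hasSum_meshSeq hz hh).tsum_eq, ENNReal.ofReal_one]

lemma meshMeasure_Iio (hh : 0 < h) : meshMeasure g z h (Iio 0) = 0 := by
  rw [meshMeasure, Measure.sum_apply _ measurableSet_Iio, ENNReal.tsum_eq_zero]
  intro n
  have : (0 : ℝ) ≤ h * n := by positivity
  simp [this]

/-- The generating function identity at x = e^{-ph}, arranged to show the limit: (1 - e^{-ph})/h → p
and the series is a Riemann sum for the Laplace transform of `g`. The factor e^{ph} arises because
the samples of `g` start at h while the atoms start at 0. -/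
lemma LogConvexKernel.lap_meshMeasure (hg : LogConvexKernel g) (hz : 0 < z) (hh : 0 < h) {p : ℝ}
    (hp : 0 < p) : lap (meshMeasure g z h) p = ENNReal.ofReal (z / (z + (1 - exp (-p * h)) / h *
      exp (p * h) * ∑' n : ℕ, exp (-p * (h * (n + 1))) * g (h * (n + 1)) * h)) := by
  have hx0 := exp_pos (-p * h)
  have hx1 : exp (-p * h) < 1 := by
    rw [exp_lt_one_iff]
    nlinarith [mul_pos hp hh]
  have hgeo := hasSum_geometric_of_lt_one hx0.le hx1
  have hpow : ∀ n : ℕ, exp (-p * h) ^ n = exp (-p * (h * n)) := fun n => by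
    rw [← Real.exp_nat_mul]; ring_nf
  have hs1 : Summable fun n : ℕ => g (h * (n + 1)) * exp (-p * h) ^ n := by
    refine Summable.of_nonneg_of_le (fun n => mul_nonneg (hg.pos _ (by positivity)).le
      (by positivity)) (fun n => ?_) (hgeo.summable.mul_left (g h))
    refine mul_le_mul_of_nonneg_right (hg.antitone hh (show (0 : ℝ) < _ by positivity) ?_)
      (by positivity)
    have : (0 : ℝ) ≤ n := by positivity
    nlinarith
  have hs2 : ∑' n : ℕ, exp (-p * (h * (n + 1))) * g (h * (n + 1)) * h =
      exp (-p * h) * h * ∑' n : ℕ, g (h * (n + 1)) * exp (-p * h) ^ n := by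
    rw [← tsum_mul_left]
    refine tsum_congr fun n => ?_
    rw [hpow, show -p * (h * ((n : ℝ) + 1)) = -p * (h * n) + -p * h by ring, Real.exp_add]
    ring
  have hs3 : ∑' n : ℕ, meshSeq g z h n * exp (-p * h) ^ n = z * (1 - exp (-p * h))⁻¹ +
      ∑' n : ℕ, g (h * (n + 1)) * exp (-p * h) ^ n := by
    simp only [meshSeq, add_mul]
    rw [(hgeo.summable.mul_left z).tsum_add hs1, tsum_mul_left, hgeo.tsum_eq]
  have key := tsum_renewalSeq_mul_pow (hg.meshSeq_pos hz hh) (hg.meshSeq_antitone hh)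
    (hg.meshSeq_logConvex hz hh) hx0 hx1
  have hS : 0 ≤ ∑' n : ℕ, g (h * (n + 1)) * exp (-p * h) ^ n :=
    tsum_nonneg fun n => mul_nonneg (hg.pos _ (by positivity)).le (by positivity)
  rw [hs3] at key
  rw [hs2]
  set S := ∑' n : ℕ, g (h * (n + 1)) * exp (-p * h) ^ n
  set x := exp (-p * h)
  have hxe : exp (p * h) = x⁻¹ := by rw [← Real.exp_neg]; ring_nf
  rw [lap, meshMeasure, lintegral_sum_measure]
  simp only [lintegral_smul_measure, lintegral_dirac, smul_eq_mul]
  have hterm : ∀ n : ℕ, ENNReal.ofReal (z * renewalSeq (meshSeq g z h) n) *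
      ENNReal.ofReal (exp (-p * (h * n))) =
      ENNReal.ofReal (z * (renewalSeq (meshSeq g z h) n * x ^ n)) := by
    intro n
    rw [← ENNReal.ofReal_mul (hg.mul_renewalSeq_nonneg hz hh n), hpow, mul_assoc]
  simp_rw [hterm]
  have hb : ∀ n, z * (renewalSeq (meshSeq g z h) n * x ^ n) ≤
      z * renewalSeq (meshSeq g z h) n := fun n => by
    rw [← mul_assoc]
    exact mul_le_of_le_one_right (hg.mul_renewalSeq_nonneg hz hh n) (pow_le_one₀ hx0.le hx1.le)
  have hnn : ∀ n, 0 ≤ z * (renewalSeq (meshSeq g z h) n * x ^ n) := fun n => by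
    rw [← mul_assoc]
    exact mul_nonneg (hg.mul_renewalSeq_nonneg hz hh n) (by positivity)
  rw [← ENNReal.ofReal_tsum_of_nonneg hnn
    (Summable.of_nonneg_of_le hnn hb (hg.hasSum_meshSeq hz hh).summable), tsum_mul_left]
  congr 1
  have h1x : 0 < 1 - x := by linarith
  rw [div_eq_mul_inv]
  congr 1
  rw [hxe]
  refine eq_inv_of_mul_eq_one_left ?_
  have e : z + (1 - x) / h * x⁻¹ * (x * h * S) = (1 - x) * (z * (1 - x)⁻¹ + S) := by
    field_simp
  rw [e, mul_left_comm, key, mul_inv_cancel₀ h1x.ne']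

lemma LogConvexKernel.meshMeasure_Ioo_inter_Ioi_le (hg : LogConvexKernel g) (hz : 0 < z)
    (hh : 0 < h) {D : ℝ} (hD : 0 < D) (a b : ℝ) :
    meshMeasure g z h (Ioo a b ∩ Ioi D) ≤ ENNReal.ofReal ((b - a + h) / D) := by
  have hnn := hg.mul_renewalSeq_nonneg hz hh
  have hUanti : Antitone fun n => z * renewalSeq (meshSeq g z h) n := fun m n hmn =>
    mul_le_mul_of_nonneg_left (antitone_nat_of_succ_le
      (renewalSeq_succ_le (hg.meshSeq_pos hz hh) (hg.meshSeq_logConvex hz hh)) hmn) hz.le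
  -- Nonincreasing masses of total 1: the n-th is at most 1/(n+1), so an atom at hn > D has mass at
  -- most h/D.
  have hmass : ∀ n : ℕ, ((n : ℝ) + 1) * (z * renewalSeq (meshSeq g z h) n) ≤ 1 := by
    intro n
    have h1 := sum_le_hasSum (Finset.range (n + 1)) (fun i _ => hnn i) (hg.hasSum_meshSeq hz hh)
    have h2 := Finset.card_nsmul_le_sum (Finset.range (n + 1))
      (fun i => z * renewalSeq (meshSeq g z h) i) (z * renewalSeq (meshSeq g z h) n)
      (fun i hi => hUanti (Nat.lt_succ_iff.1 (Finset.mem_range.1 hi)))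
    rw [Finset.card_range, nsmul_eq_mul] at h2
    push_cast at h2
    exact h2.trans h1
  rw [meshMeasure, Measure.sum_apply _ (measurableSet_Ioo.inter measurableSet_Ioi)]
  -- Each atom is charged to its own cell of length h. The cells are disjoint and those that count
  -- lie in (a, b + h].
  have hle : ∀ n : ℕ, (ENNReal.ofReal (z * renewalSeq (meshSeq g z h) n) •
      Measure.dirac (h * n)) (Ioo a b ∩ Ioi D) ≤ ENNReal.ofReal D⁻¹ *
      (volume.restrict (Ioc a (b + h))) (Ioc (h * (n + 0)) (h * (n + 1 + 0))) := by
    intro n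
    rw [Measure.smul_apply, Measure.dirac_apply' _ (measurableSet_Ioo.inter measurableSet_Ioi),
      smul_eq_mul]
    by_cases hn : h * n ∈ Ioo a b ∩ Ioi D
    · rw [indicator_of_mem hn, Pi.one_apply, mul_one, Measure.restrict_apply measurableSet_Ioc,
        inter_eq_self_of_subset_left, volume_Ioc_mesh, ← ENNReal.ofReal_mul (by positivity)]
      · refine ENNReal.ofReal_le_ofReal ?_
        have h1 : D < h * n := hn.2
        have h2 := hmass n
        have h3 := hnn n
        rw [inv_mul_eq_div, le_div_iff₀ hD]
        nlinarith [mul_nonneg h3 hh.le]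
      · intro x hx
        simp only [add_zero] at hx
        refine ⟨hn.1.1.trans hx.1, hx.2.trans ?_⟩
        have := hn.1.2
        linarith
    · rw [indicator_of_notMem hn, mul_zero]
      exact zero_le
  refine (ENNReal.tsum_le_tsum hle).trans ?_
  rw [ENNReal.tsum_mul_left, ← measure_iUnion (pairwise_disjoint_mesh hh 0)
    (fun _ => measurableSet_Ioc), div_eq_inv_mul, ENNReal.ofReal_mul (inv_pos.2 hD).le]
  gcongr
  refine (measure_mono (subset_univ _)).trans ?_
  rw [Measure.restrict_apply_univ, Real.volume_Ioc]
  exact ENNReal.ofReal_le_ofReal (by linarith)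

end Mesh

end

/-! ### The resolvent law and its density -/

section Resolvent
variable {g : ℝ → ℝ} {z : ℝ}

lemma LogConvexKernel.lap_kernelMeasure (hg : LogConvexKernel g) {p : ℝ} (hp : 0 < p) :
    lap (kernelMeasure g) p = ENNReal.ofReal (laplaceK g p) :=
  FractionalKinetics.lap_kernelMeasure (fun t ht => (hg.pos t ht).le) hg.integrable hp

lemma LogConvexKernel.lintegral_exp_mul (hg : LogConvexKernel g) {p : ℝ} (hp : 0 < p) :
    ∫⁻ t in Ioi 0, ENNReal.ofReal (exp (-p * t) * g t) = ENNReal.ofReal (laplaceK g p) := by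
  rw [laplaceK, ofReal_integral_eq_lintegral_ofReal (hg.integrable p hp)]
  filter_upwards [ae_restrict_mem measurableSet_Ioi] with t ht
  exact mul_nonneg (exp_pos _).le (hg.pos t ht).le

lemma LogConvexKernel.laplaceK_nonneg (hg : LogConvexKernel g) (p : ℝ) : 0 ≤ laplaceK g p := by
  refine setIntegral_nonneg measurableSet_Ioi fun t ht => ?_
  exact mul_nonneg (exp_pos _).le (hg.pos t ht).le

lemma LogConvexKernel.laplaceL_nonneg (hg : LogConvexKernel g) {p : ℝ} (hp : 0 < p) :
    0 ≤ laplaceL g p := mul_nonneg hp.le (hg.laplaceK_nonneg p)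

lemma LogConvexKernel.tendsto_tsum_mesh (hg : LogConvexKernel g) {p : ℝ} (hp : 0 < p) :
    Tendsto (fun N : ℕ => ∑' n : ℕ, exp (-p * (1 / ((N : ℝ) + 1) * (n + 1))) *
      g (1 / ((N : ℝ) + 1) * (n + 1)) * (1 / ((N : ℝ) + 1))) atTop (𝓝 (laplaceK g p)) := by
  have hF : AntitoneOn (fun t => ENNReal.ofReal (exp (-p * t) * g t)) (Ioi 0) := by
    intro x hx y hy hxy
    refine ENNReal.ofReal_le_ofReal (mul_le_mul (exp_le_exp.2 ?_) (hg.antitone hx hy hxy)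
      (hg.pos y hy).le (exp_pos _).le)
    nlinarith
  have h1 := FractionalKinetics.tendsto_tsum_mesh hF
  rw [hg.lintegral_exp_mul hp] at h1
  have h2 := (ENNReal.tendsto_toReal ENNReal.ofReal_ne_top).comp h1
  rw [ENNReal.toReal_ofReal (hg.laplaceK_nonneg p)] at h2
  refine h2.congr fun N => ?_
  simp only [Function.comp]
  rw [ENNReal.tsum_toReal_eq fun n => ENNReal.mul_ne_top ENNReal.ofReal_ne_top
    ENNReal.ofReal_ne_top]
  refine tsum_congr fun n => ?_
  have hpos : 0 < 1 / ((N : ℝ) + 1) := Nat.one_div_pos_of_nat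
  rw [ENNReal.toReal_mul, ENNReal.toReal_ofReal, ENNReal.toReal_ofReal hpos.le]
  exact mul_nonneg (exp_pos _).le (hg.pos _ (by positivity)).le

lemma tendsto_one_sub_exp_div (p : ℝ) :
    Tendsto (fun N : ℕ => (1 - exp (-p * (1 / ((N : ℝ) + 1)))) / (1 / ((N : ℝ) + 1))) atTop
      (𝓝 p) := by
  have h1 : HasDerivAt (fun h : ℝ => 1 - exp (-p * h)) p 0 := by
    have h := ((((hasDerivAt_id (0 : ℝ)).const_mul (-p)).exp).const_sub 1)
    simpa using h
  have h2 := h1.tendsto_slope_zero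
  have h3 : Tendsto (fun N : ℕ => 1 / ((N : ℝ) + 1)) atTop (𝓝[≠] 0) := by
    refine tendsto_nhdsWithin_iff.2 ⟨tendsto_one_div_add_atTop_nhds_zero_nat, ?_⟩
    exact Eventually.of_forall fun N => (Nat.one_div_pos_of_nat (n := N) (α := ℝ)).ne'
  refine (h2.comp h3).congr fun N => ?_
  simp [div_eq_inv_mul]

lemma LogConvexKernel.tendsto_lap_meshMeasure (hg : LogConvexKernel g) (hz : 0 < z) {p : ℝ}
    (hp : 0 < p) : Tendsto (fun N : ℕ => lap (meshMeasure g z (1 / ((N : ℝ) + 1))) p) atTop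
      (𝓝 (ENNReal.ofReal (z / (z + laplaceL g p)))) := by
  have hpos : ∀ N : ℕ, 0 < 1 / ((N : ℝ) + 1) := fun N => Nat.one_div_pos_of_nat
  simp_rw [fun N => hg.lap_meshMeasure hz (hpos N) hp]
  refine ENNReal.tendsto_ofReal (tendsto_const_nhds.div (tendsto_const_nhds.add ?_) ?_)
  · have h1 : Tendsto (fun N : ℕ => exp (p * (1 / ((N : ℝ) + 1)))) atTop (𝓝 1) := by
      have : Continuous fun h : ℝ => exp (p * h) := by fun_prop
      have := (this.tendsto 0).comp (tendsto_one_div_add_atTop_nhds_zero_nat (𝕜 := ℝ))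
      simpa [Function.comp_def] using this
    have h2 := ((tendsto_one_sub_exp_div p).mul h1).mul (hg.tendsto_tsum_mesh hp)
    rw [mul_one] at h2
    exact h2
  · have := hg.laplaceL_nonneg hp
    positivity

/-- The probability measure on `[0, ∞)` with Laplace transform `z / (z + ℒ(p))`. -/
structure IsResolventLaw (g : ℝ → ℝ) (z : ℝ) (P : Measure ℝ) : Prop where
  isProbabilityMeasure : IsProbabilityMeasure P
  Iio_zero : P (Iio 0) = 0
  lap_eq : ∀ p, 0 < p → lap P p = ENNReal.ofReal (z / (z + laplaceL g p))

lemma IsResolventLaw.unique {P Q : Measure ℝ} (hP : IsResolventLaw g z P)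
    (hQ : IsResolventLaw g z Q) : P = Q :=
  ext_of_lap (fun p hp => (hP.lap_eq p hp).trans (hQ.lap_eq p hp).symm) fun p hp =>
    (hP.lap_eq p hp).trans_ne ENNReal.ofReal_ne_top

lemma LogConvexKernel.exists_isResolventLaw_Ioo_le (hg : LogConvexKernel g) (hz : 0 < z) :
    ∃ P : Measure ℝ, IsResolventLaw g z P ∧
      ∀ D a b : ℝ, 0 < D → P (Ioo a b ∩ Ioi D) ≤ ENNReal.ofReal ((b - a) / D) := by
  have hpos : ∀ N : ℕ, 0 < 1 / ((N : ℝ) + 1) := fun N => Nat.one_div_pos_of_nat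
  set R : ℕ → ProbabilityMeasure ℝ := fun N =>
    ⟨meshMeasure g z (1 / ((N : ℝ) + 1)), hg.isProbabilityMeasure_meshMeasure hz (hpos N)⟩ with hR
  have hlim : Tendsto (fun p => ENNReal.ofReal (z / (z + laplaceL g p))) (𝓝[>] 0) (𝓝 1) := by
    rw [← ENNReal.ofReal_one]
    refine ENNReal.tendsto_ofReal ?_
    have := (tendsto_const_nhds (x := z)).div (hg.laplaceL_zero.const_add z) (by simpa using hz.ne')
    rwa [add_zero, div_self hz.ne'] at this
  obtain ⟨Q, hQ0, hQφ, hQ⟩ := exists_tendsto_of_tendsto_lap (P := R)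
    (fun N => meshMeasure_Iio (hpos N)) (fun p hp => hg.tendsto_lap_meshMeasure hz hp) hlim
  refine ⟨Q, ⟨Q.2, hQ0, hQφ⟩, fun D a b hD => ?_⟩
  -- The bound on lattice laws survives weak convergence because the set is open.
  have h1 := ProbabilityMeasure.le_liminf_measure_open_of_tendsto hQ
    ((isOpen_Ioo (a := a) (b := b)).inter (isOpen_Ioi (a := D)))
  refine h1.trans ?_
  have h2 : Tendsto (fun N : ℕ => ENNReal.ofReal ((b - a + 1 / ((N : ℝ) + 1)) / D)) atTop
      (𝓝 (ENNReal.ofReal ((b - a) / D))) := by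
    refine ENNReal.tendsto_ofReal ?_
    have := ((tendsto_one_div_add_atTop_nhds_zero_nat (𝕜 := ℝ)).const_add (b - a)).div_const D
    rwa [add_zero] at this
  rw [← h2.liminf_eq]
  exact liminf_le_liminf (Eventually.of_forall fun N =>
    hg.meshMeasure_Ioo_inter_Ioi_le hz (hpos N) hD a b)

theorem LogConvexKernel.exists_isResolventLaw (hg : LogConvexKernel g) (hz : 0 < z) :
    ∃ P, IsResolventLaw g z P :=
  let ⟨P, hP, _⟩ := hg.exists_isResolventLaw_Ioo_le hz
  ⟨P, hP⟩

lemma IsResolventLaw.measure_Ioo_inter_Ioi_le (hg : LogConvexKernel g) (hz : 0 < z)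
    {P : Measure ℝ} (hP : IsResolventLaw g z P) {D : ℝ} (hD : 0 < D) (a b : ℝ) :
    P (Ioo a b ∩ Ioi D) ≤ ENNReal.ofReal ((b - a) / D) := by
  obtain ⟨Q, hQ, h⟩ := hg.exists_isResolventLaw_Ioo_le hz
  rw [hP.unique hQ]
  exact h D a b hD

/-- Away from the origin, a resolvent law has a bounded density. -/
lemma IsResolventLaw.smul_restrict_le_volume (hg : LogConvexKernel g) (hz : 0 < z)
    {P : Measure ℝ} (hP : IsResolventLaw g z P) {D : ℝ} (hD : 0 < D) :
    ENNReal.ofReal D • P.restrict (Ioi D) ≤ volume := by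
  -- Lebesgue measure is the one-dimensional Hausdorff measure, so it suffices to compare with the
  -- diameter on small sets, each contained in a slightly larger open interval.
  rw [← hausdorffMeasure_real]
  refine Measure.le_hausdorffMeasure 1 _ 1 one_pos fun s hs => ?_
  rw [ENNReal.rpow_one]
  rcases s.eq_empty_or_nonempty with rfl | hne
  · simp
  have hbd : Bornology.IsBounded s :=
    Metric.isBounded_iff_ediam_ne_top.2 (ne_top_of_le_ne_top ENNReal.one_ne_top hs)
  have hsub : s ⊆ Icc (sInf s) (sSup s) := fun x hx =>
    ⟨csInf_le hbd.bddBelow hx, le_csSup hbd.bddAbove hx⟩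
  rw [Real.ediam_eq hbd]
  set a := sInf s
  set b := sSup s
  have h1 : ∀ ε : ℝ, 0 < ε → (ENNReal.ofReal D • P.restrict (Ioi D)) s ≤
      ENNReal.ofReal (b - a + 2 * ε) := by
    intro ε hε
    have h2 : (P.restrict (Ioi D)) s ≤ ENNReal.ofReal ((b - a + 2 * ε) / D) := by
      refine (measure_mono (t := Ioo (a - ε) (b + ε)) fun x hx => ?_).trans ?_
      · have := hsub hx
        exact ⟨by linarith [this.1], by linarith [this.2]⟩
      · rw [Measure.restrict_apply measurableSet_Ioo]
        refine (hP.measure_Ioo_inter_Ioi_le hg hz hD _ _).trans (le_of_eq ?_)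
        congr 2
        ring
    rw [Measure.smul_apply, smul_eq_mul]
    calc ENNReal.ofReal D * (P.restrict (Ioi D)) s
        ≤ ENNReal.ofReal D * ENNReal.ofReal ((b - a + 2 * ε) / D) := by gcongr
      _ = ENNReal.ofReal (b - a + 2 * ε) := by
        rw [← ENNReal.ofReal_mul hD.le, mul_div_cancel₀ _ hD.ne']
  have h3 : Tendsto (fun ε : ℝ => ENNReal.ofReal (b - a + 2 * ε)) (𝓝[>] 0)
      (𝓝 (ENNReal.ofReal (b - a))) := by
    have : Continuous fun ε : ℝ => ENNReal.ofReal (b - a + 2 * ε) :=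
      ENNReal.continuous_ofReal.comp (by fun_prop)
    have h4 : Tendsto (fun ε : ℝ => ENNReal.ofReal (b - a + 2 * ε)) (𝓝[>] 0)
        (𝓝 (ENNReal.ofReal (b - a + 2 * 0))) := (this.tendsto 0).mono_left nhdsWithin_le_nhds
    simpa using h4
  refine ge_of_tendsto h3 ?_
  filter_upwards [self_mem_nhdsWithin] with ε hε using h1 ε hε

/-- The atom at 0 is at most the Laplace transform at every p, which tends to 0 since ℒ → ∞. -/
lemma IsResolventLaw.measure_zero (hg : LogConvexKernel g) {P : Measure ℝ} (hP : IsResolventLaw g z P) : P {0} = 0 := by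
  have h1 : Tendsto (fun p => ENNReal.ofReal (z / (z + laplaceL g p))) atTop (𝓝 0) := by
    rw [← ENNReal.ofReal_zero]
    refine ENNReal.tendsto_ofReal ?_
    exact Tendsto.div_atTop tendsto_const_nhds
      (tendsto_atTop_add_const_left _ z hg.laplaceL_infty)
  refine le_antisymm (ge_of_tendsto h1 ?_) zero_le
  filter_upwards [eventually_gt_atTop 0] with p hp
  rw [← hP.lap_eq p hp, ← lintegral_indicator_one (measurableSet_singleton 0)]
  refine lintegral_mono fun x => ?_
  by_cases hx : x = 0
  · simp [hx]
  · simp [hx]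

lemma IsResolventLaw.absolutelyContinuous (hg : LogConvexKernel g) (hz : 0 < z)
    {P : Measure ℝ} (hP : IsResolventLaw g z P) : P ≪ volume := by
  intro N hN
  have hpos : ∀ n : ℕ, 0 < 1 / ((n : ℝ) + 1) := fun n => Nat.one_div_pos_of_nat
  have h1 : N ⊆ (Iio 0 ∪ {0}) ∪ ⋃ n : ℕ, N ∩ Ioi (1 / ((n : ℝ) + 1)) := by
    intro x hx
    rcases lt_trichotomy x 0 with h | h | h
    · exact Or.inl (Or.inl h)
    · exact Or.inl (Or.inr h)
    · obtain ⟨n, hn⟩ := exists_nat_one_div_lt h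
      exact Or.inr (mem_iUnion.2 ⟨n, hx, hn⟩)
  refine measure_mono_null h1 (measure_union_null (measure_union_null hP.Iio_zero
    (hP.measure_zero hg)) (measure_iUnion_null fun n => ?_))
  have h2 := (hP.smul_restrict_le_volume hg hz (hpos n)) N
  rw [hN, Measure.smul_apply, smul_eq_mul, nonpos_iff_eq_zero, mul_eq_zero] at h2
  rcases h2 with h2 | h2
  · exact absurd (hpos n) (not_lt.2 (ENNReal.ofReal_eq_zero.1 h2))
  · rwa [Measure.restrict_apply' measurableSet_Ioi] at h2

end Resolvent

/-! ### Subordinator laws and the convolution formula -/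

section Subordinator
variable {g k : ℝ → ℝ} {z : ℝ}

lemma toReal_lap (μ : Measure ℝ) (p : ℝ) : (lap μ p).toReal = ∫ τ, exp (-p * τ) ∂μ := by
  rw [integral_eq_lintegral_of_nonneg_ae (ae_of_all _ fun x => (exp_pos _).le) (by fun_prop), lap]

/-- Exponential formula: e^{-sℒ} is the limit of (1 + sℒ/n)^{-n}, the transform of the n-th
convolution power of the resolvent law with parameter n/s. -/
lemma LogConvexKernel.exists_subordinatorLaw (hg : LogConvexKernel g) {s : ℝ} (hs : 0 ≤ s) :
    ∃ ν : Measure ℝ, IsProbabilityMeasure ν ∧ ν (Iio 0) = 0 ∧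
      ∀ p, 0 < p → lap ν p = ENNReal.ofReal (exp (-s * laplaceL g p)) := by
  rcases hs.eq_or_lt with rfl | hs
  · exact ⟨Measure.dirac 0, inferInstance, by simp, fun p _ => by simp [lap]⟩
  have hz : ∀ n : ℕ, 0 < ((n : ℝ) + 1) / s := fun n => by positivity
  choose P hP using fun n => hg.exists_isResolventLaw (hz n)
  have hpow : ∀ n : ℕ, ∃ ν : Measure ℝ, IsProbabilityMeasure ν ∧ ν (Iio 0) = 0 ∧
      ∀ p, lap ν p = lap (P n) p ^ (n + 1) := fun n =>
    have := (hP n).isProbabilityMeasure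
    exists_lap_pow (P n) (hP n).Iio_zero (n + 1)
  choose R hR1 hR2 hR3 using hpow
  have hlim : Tendsto (fun p => ENNReal.ofReal (exp (-s * laplaceL g p))) (𝓝[>] 0) (𝓝 1) := by
    rw [← ENNReal.ofReal_one, ← exp_zero]
    refine ENNReal.tendsto_ofReal ((continuous_exp.tendsto _).comp ?_)
    have := hg.laplaceL_zero.const_mul (-s)
    rwa [mul_zero] at this
  have hconv : ∀ p, 0 < p → Tendsto (fun n => lap (R n) p) atTop
      (𝓝 (ENNReal.ofReal (exp (-s * laplaceL g p)))) := by
    intro p hp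
    have hL := hg.laplaceL_nonneg hp
    have h1 : Tendsto (fun n : ℕ => ((1 + s * laplaceL g p / ((n + 1 : ℕ) : ℝ)) ^ (n + 1))⁻¹) atTop
        (𝓝 (exp (s * laplaceL g p))⁻¹) :=
      ((Real.tendsto_one_add_div_pow_exp (s * laplaceL g p)).comp (tendsto_add_atTop_nat 1)).inv₀
        (exp_pos _).ne'
    rw [← Real.exp_neg, ← neg_mul] at h1
    refine (ENNReal.tendsto_ofReal h1).congr fun n => ?_
    rw [hR3 n p, (hP n).lap_eq p hp, ← ENNReal.ofReal_pow (by positivity)]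
    congr 1
    rw [← inv_pow]
    congr 1
    have hn : (0 : ℝ) < (n : ℝ) + 1 := by positivity
    have hne : ((n : ℝ) + 1) / s + laplaceL g p ≠ 0 := by positivity
    have hne' : (n : ℝ) + 1 + s * laplaceL g p ≠ 0 := by positivity
    push_cast
    field_simp
  obtain ⟨Q, hQ0, hQφ, -⟩ := exists_tendsto_of_tendsto_lap
    (P := fun n => (⟨R n, hR1 n⟩ : ProbabilityMeasure ℝ)) hR2 hconv hlim
  exact ⟨Q, Q.2, hQ0, hQφ⟩

lemma LogConvexKernel.isSubordinatorLaw_subordinatorLaw (hg : LogConvexKernel g)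
    (hL : laplaceL k = laplaceL g) {s : ℝ} (hs : 0 ≤ s) :
    IsSubordinatorLaw k s (subordinatorLaw k s) := by
  have h : ∃ ν : Measure ℝ, IsSubordinatorLaw k s ν := by
    obtain ⟨ν, h1, h2, h3⟩ := hg.exists_subordinatorLaw hs
    refine ⟨ν, h1, h2, fun p hp => ?_⟩
    rw [← toReal_lap, h3 p hp, ENNReal.toReal_ofReal (exp_pos _).le, hL]
  rw [subordinatorLaw, dif_pos h]
  exact h.choose_spec

lemma IsSubordinatorLaw.lap_eq {s : ℝ} {ν : Measure ℝ} (hν : IsSubordinatorLaw k s ν) {p : ℝ}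
    (hp : 0 < p) : lap ν p = ENNReal.ofReal (exp (-s * laplaceL k p)) := by
  have := hν.1
  rw [← hν.2.2 p hp, ← toReal_lap, ENNReal.ofReal_toReal]
  exact ne_top_of_le_ne_top ENNReal.one_ne_top (lap_le_one hν.2.1 hp.le)

lemma conv_Iic_le {μ ν : Measure ℝ} [SFinite μ] [IsProbabilityMeasure ν] (hν : ν (Iio 0) = 0)
    (x : ℝ) : (μ.conv ν) (Iic x) ≤ μ (Iic x) := by
  rw [← lintegral_indicator_one measurableSet_Iic, ← lintegral_indicator_one measurableSet_Iic,
    Measure.lintegral_conv (measurable_one.indicator measurableSet_Iic)]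
  refine lintegral_mono fun a => ?_
  have h1 : ∫⁻ _, (Iic x).indicator 1 a ∂ν = (Iic x).indicator (1 : ℝ → ℝ≥0∞) a := by simp
  rw [← h1]
  refine lintegral_mono_ae ?_
  filter_upwards [ae_nonneg_of_Iio hν] with b hb
  by_cases h : a + b ∈ Iic x
  · have h' : a ∈ Iic x := by
      have : a + b ≤ x := h
      show a ≤ x
      linarith
    rw [indicator_of_mem h, indicator_of_mem h']
    simp
  · rw [indicator_of_notMem h]
    exact zero_le

/-- The subordinator laws, extended to negative times as a Dirac mass at the origin. -/
def subordinatorKernel (k : ℝ → ℝ) (s : ℝ) : Measure ℝ := subordinatorLaw k (max s 0)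

lemma LogConvexKernel.isSubordinatorLaw_subordinatorKernel (hg : LogConvexKernel g)
    (hL : laplaceL k = laplaceL g) (s : ℝ) :
    IsSubordinatorLaw k (max s 0) (subordinatorKernel k s) :=
  hg.isSubordinatorLaw_subordinatorLaw hL (le_max_right s 0)

lemma LogConvexKernel.subordinatorLaw_add (hg : LogConvexKernel g)
    (hL : laplaceL k = laplaceL g) {s u : ℝ} (hs : 0 ≤ s) (hu : 0 ≤ u) :
    subordinatorLaw k (s + u) = (subordinatorLaw k s).conv (subordinatorLaw k u) := by
  have h1 := hg.isSubordinatorLaw_subordinatorLaw hL hs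
  have h2 := hg.isSubordinatorLaw_subordinatorLaw hL hu
  have h3 := hg.isSubordinatorLaw_subordinatorLaw hL (add_nonneg hs hu)
  have := h1.1
  have := h2.1
  refine ext_of_lap (fun p hp => ?_) fun p hp => (h3.lap_eq hp).trans_ne ENNReal.ofReal_ne_top
  rw [lap_conv, h1.lap_eq hp, h2.lap_eq hp, h3.lap_eq hp, ← ENNReal.ofReal_mul (exp_pos _).le,
    ← Real.exp_add]
  ring_nf

/-- By the semigroup property, increasing s convolves with a law on [0, ∞), which moves mass to the
right. So the distribution function at a fixed point is antitone in s, hence measurable. -/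
lemma LogConvexKernel.measurable_subordinatorKernel (hg : LogConvexKernel g)
    (hL : laplaceL k = laplaceL g) : Measurable (subordinatorKernel k) := by
  have hprob : ∀ s, IsProbabilityMeasure (subordinatorKernel k s) := fun s =>
    (hg.isSubordinatorLaw_subordinatorKernel hL s).1
  refine .measure_of_isPiSystem_of_isProbabilityMeasure (borel_eq_generateFrom_Iic ℝ)
    isPiSystem_Iic ?_
  rintro _ ⟨x, rfl⟩
  refine Antitone.measurable fun s u hsu => ?_
  have h0 : max s 0 ≤ max u 0 := max_le_max_right 0 hsu
  have h1 := hg.subordinatorLaw_add hL (le_max_right s 0) (sub_nonneg.2 h0)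
  rw [add_sub_cancel] at h1
  have h2 := hg.isSubordinatorLaw_subordinatorLaw hL (sub_nonneg.2 h0)
  have := h2.1
  have := (hg.isSubordinatorLaw_subordinatorLaw hL (le_max_right s 0)).1
  simp only [subordinatorKernel]
  rw [h1]
  exact conv_Iic_le h2.2.1 x

/-- The integral of e^{-zs} e^{-sℒ} over s > 0 is 1/(z + ℒ), so the mixture of subordinator laws is
z⁻¹ times the resolvent law. -/
lemma LogConvexKernel.lintegral_subordinatorKernel (hg : LogConvexKernel g)
    (hL : laplaceL k = laplaceL g) (hz : 0 < z) {P : Measure ℝ} (hP : IsResolventLaw g z P)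
    {f : ℝ → ℝ≥0∞} (hf : Measurable f) :
    ∫⁻ s in Ioi 0, ENNReal.ofReal (exp (-z * s)) * ∫⁻ τ, f τ ∂(subordinatorKernel k s) =
      ENNReal.ofReal z⁻¹ * ∫⁻ τ, f τ ∂P := by
  set m : Measure ℝ := (volume.restrict (Ioi 0)).withDensity
    fun s => ENNReal.ofReal (exp (-z * s)) with hm
  set U : Measure ℝ := m.bind (subordinatorKernel k) with hU
  have hmeas := hg.measurable_subordinatorKernel hL
  have hbind : ∀ f : ℝ → ℝ≥0∞, Measurable f → ∫⁻ τ, f τ ∂U =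
      ∫⁻ s in Ioi 0, ENNReal.ofReal (exp (-z * s)) * ∫⁻ τ, f τ ∂(subordinatorKernel k s) := by
    intro f hf
    rw [hU, Measure.lintegral_bind hmeas.aemeasurable hf.aemeasurable, hm,
      lintegral_withDensity_eq_lintegral_mul _ (measurable_ofReal_exp_mul _)]
    · rfl
    · exact (Measure.measurable_lintegral hf).comp hmeas
  rw [← hbind f hf]
  have hzU : U = ENNReal.ofReal z⁻¹ • P := by
    have hlapU : ∀ p, 0 < p → lap U p = ENNReal.ofReal (z + laplaceL g p)⁻¹ := by
      intro p hp
      rw [lap, hbind _ (measurable_ofReal_exp_mul _),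
        ← lintegral_exp_neg_mul_Ioi (add_pos_of_pos_of_nonneg hz (hg.laplaceL_nonneg hp))]
      refine setLIntegral_congr_fun measurableSet_Ioi fun s hs => ?_
      have h1 := (hg.isSubordinatorLaw_subordinatorKernel hL s).lap_eq hp
      rw [lap] at h1
      rw [h1, max_eq_left (le_of_lt hs), ← ENNReal.ofReal_mul (exp_pos _).le, ← Real.exp_add, hL]
      ring_nf
    refine ext_of_lap (fun p hp => ?_) fun p hp => (hlapU p hp).trans_ne ENNReal.ofReal_ne_top
    rw [hlapU p hp, lap, lintegral_smul_measure, smul_eq_mul]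
    have h2 := hP.lap_eq p hp
    rw [lap] at h2
    rw [h2, ← ENNReal.ofReal_mul (inv_pos.2 hz).le]
    congr 1
    field_simp
  rw [hzU, lintegral_smul_measure, smul_eq_mul]

/-- The kernel `g`, extended by zero to the half-line `(-∞, 0]`. -/
def extKernel (g : ℝ → ℝ) : ℝ → ℝ≥0∞ := (Ioi 0).indicator fun x => ENNReal.ofReal (g x)

lemma LogConvexKernel.measurable_extKernel (hg : LogConvexKernel g) :
    Measurable (extKernel g) := hg.measurable.ennreal_ofReal.indicator measurableSet_Ioi

theorem LogConvexKernel.subExp_eq (hg : LogConvexKernel g) (hkg : k =ᵐ[volume.restrict (Ioi 0)] g)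
    (hL : laplaceL k = laplaceL g) (hz : 0 < z) {P : Measure ℝ} (hP : IsResolventLaw g z P)
    (t : ℝ) : subExp k t (-z) = ENNReal.ofReal z⁻¹ * ∫⁻ τ, extKernel g (t - τ) ∂P := by
  have hf : Measurable fun τ => extKernel g (t - τ) := hg.measurable_extKernel.comp (by fun_prop)
  rw [← hg.lintegral_subordinatorKernel hL hz hP hf, subExp]
  -- The point τ = t must be excluded as well: there `k 0` is uncontrolled, while `extKernel g 0` is
  -- zero. Absolute continuity makes the exceptional set null for P, hence null for μ_s for almost
  -- every s.
  have hae : ∀ᵐ τ ∂(volume : Measure ℝ), (t - τ ∈ Ioi 0 → k (t - τ) = g (t - τ)) ∧ τ ≠ t := by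
    rw [EventuallyEq, ae_restrict_iff' measurableSet_Ioi] at hkg
    exact ((Measure.measurePreserving_sub_left volume t).quasiMeasurePreserving.ae hkg).and
      (Measure.ae_ne volume t)
  have haeP := (hP.absolutelyContinuous hg hz).ae_le hae
  obtain ⟨N, hNsub, hNm, hN0⟩ := exists_measurable_superset_of_null (ae_iff.1 haeP)
  have hNs : ∀ᵐ s ∂volume.restrict (Ioi (0 : ℝ)), subordinatorKernel k s N = 0 := by
    have h1 := hg.lintegral_subordinatorKernel hL hz hP (f := N.indicator 1)
      (measurable_one.indicator hNm)
    simp only [lintegral_indicator_one hNm, hN0, mul_zero] at h1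
    rw [lintegral_eq_zero_iff] at h1
    · filter_upwards [h1] with s hs
      simpa [(exp_pos _).not_ge] using hs
    · exact (measurable_ofReal_exp_mul _).mul
        ((Measure.measurable_coe hNm).comp (hg.measurable_subordinatorKernel hL))
  refine lintegral_congr_ae ?_
  filter_upwards [hNs, ae_restrict_mem measurableSet_Ioi] with s hs hs0
  congr 1
  have hs0' : 0 < s := hs0
  rw [subKernel, ← lintegral_indicator measurableSet_Icc]
  have hlaw : subordinatorKernel k s = subordinatorLaw k s := by
    rw [subordinatorKernel, max_eq_left hs0'.le]
  rw [hlaw] at hs ⊢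
  have h0 := (hg.isSubordinatorLaw_subordinatorLaw hL hs0'.le).2.1
  refine lintegral_congr_ae ?_
  have hτ : ∀ᵐ τ ∂(subordinatorLaw k s),
      (t - τ ∈ Ioi 0 → k (t - τ) = g (t - τ)) ∧ τ ≠ t :=
    ae_iff.2 (measure_mono_null hNsub hs)
  filter_upwards [hτ, ae_nonneg_of_Iio h0] with τ hτ hτ0
  by_cases h : τ ∈ Icc 0 t
  · have hpos : t - τ ∈ Ioi (0 : ℝ) := sub_pos.2 (lt_of_le_of_ne h.2 hτ.2)
    rw [indicator_of_mem h, extKernel, indicator_of_mem hpos, hτ.1 hpos]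
  · have hneg : t - τ ∉ Ioi (0 : ℝ) := fun hpos => h ⟨hτ0, (sub_pos.1 hpos).le⟩
    rw [indicator_of_notMem h, extKernel, indicator_of_notMem hneg]

end Subordinator

/-! ### The convolution as the tail of the resolvent law -/

section Tail
variable {g : ℝ → ℝ} {z : ℝ} {P : Measure ℝ}

lemma extKernel_of_pos {x : ℝ} (hx : 0 < x) : extKernel g x = ENNReal.ofReal (g x) :=
  indicator_of_mem (show x ∈ Ioi (0 : ℝ) from hx) _

lemma extKernel_of_nonpos {x : ℝ} (hx : x ≤ 0) : extKernel g x = 0 :=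
  indicator_of_notMem (show x ∉ Ioi (0 : ℝ) from not_lt.2 hx) _

lemma LogConvexKernel.measurable_exp_mul_extKernel (hg : LogConvexKernel g) (p : ℝ) :
    Measurable fun t : ℝ => ENNReal.ofReal (exp (p * t)) * extKernel g t :=
  (measurable_ofReal_exp_mul p).mul hg.measurable_extKernel

lemma LogConvexKernel.measurable_extKernel_const_sub (hg : LogConvexKernel g) (t : ℝ) :
    Measurable fun τ : ℝ => extKernel g (t - τ) := hg.measurable_extKernel.comp (by fun_prop)

lemma LogConvexKernel.lintegral_exp_mul_extKernel (hg : LogConvexKernel g) {p : ℝ} (hp : 0 < p) :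
    ∫⁻ t, ENNReal.ofReal (exp (-p * t)) * extKernel g t = ENNReal.ofReal (laplaceK g p) := by
  rw [← hg.lintegral_exp_mul hp, ← lintegral_indicator measurableSet_Ioi]
  refine lintegral_congr fun t => ?_
  by_cases ht : 0 < t
  · rw [extKernel_of_pos ht, indicator_of_mem (show t ∈ Ioi (0 : ℝ) from ht),
      ENNReal.ofReal_mul (exp_pos _).le]
  · rw [extKernel_of_nonpos (not_lt.1 ht), mul_zero,
      indicator_of_notMem (show t ∉ Ioi (0 : ℝ) from ht)]

lemma LogConvexKernel.lintegral_Iic_extKernel_ne_top (hg : LogConvexKernel g) (T : ℝ) :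
    ∫⁻ t in Iic T, extKernel g t ≠ ⊤ := by
  have h1 : ∫⁻ t in Iic T, extKernel g t ≤
      ENNReal.ofReal (exp T) * ENNReal.ofReal (laplaceK g 1) := by
    rw [← hg.lintegral_exp_mul_extKernel one_pos, ← lintegral_const_mul _
      (hg.measurable_exp_mul_extKernel _),
      ← lintegral_indicator measurableSet_Iic]
    refine lintegral_mono fun t => ?_
    by_cases ht : t ∈ Iic T
    · rw [indicator_of_mem ht, ← mul_assoc, ← ENNReal.ofReal_mul (exp_pos _).le, ← Real.exp_add]
      refine le_mul_of_one_le_left zero_le ?_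
      rw [ENNReal.one_le_ofReal, Real.one_le_exp_iff]
      have : t ≤ T := ht
      linarith
    · rw [indicator_of_notMem ht]
      exact zero_le
  exact ne_top_of_le_ne_top (ENNReal.mul_ne_top ENNReal.ofReal_ne_top ENNReal.ofReal_ne_top) h1

/-- The convolution `z⁻¹ (g * P)`, which for a resolvent law `P` is the function
`A(t, -z)`. -/
def resolventConv (g : ℝ → ℝ) (z : ℝ) (P : Measure ℝ) (t : ℝ) : ℝ≥0∞ :=
  ENNReal.ofReal z⁻¹ * ∫⁻ τ, extKernel g (t - τ) ∂P

lemma LogConvexKernel.measurable_extKernel_sub (hg : LogConvexKernel g) :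
    Measurable fun x : ℝ × ℝ => extKernel g (x.1 - x.2) :=
  hg.measurable_extKernel.comp (by fun_prop)

lemma LogConvexKernel.measurable_resolventConv (hg : LogConvexKernel g) [SFinite P] :
    Measurable (resolventConv g z P) :=
  (Measurable.lintegral_prod_right' hg.measurable_extKernel_sub).const_mul _

lemma IsResolventLaw.lap_resolventConv (hg : LogConvexKernel g) (hz : 0 < z)
    (hP : IsResolventLaw g z P) {p : ℝ} (hp : 0 < p) :
    ∫⁻ t in Ioi 0, ENNReal.ofReal (exp (-p * t)) * resolventConv g z P t =
      ENNReal.ofReal (laplaceK g p / (z + laplaceL g p)) := by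
  have := hP.isProbabilityMeasure
  have hm := hg.measurable_extKernel_sub
  have hL := hg.laplaceL_nonneg hp
  have h1 : ∀ t, ENNReal.ofReal (exp (-p * t)) * resolventConv g z P t =
      ENNReal.ofReal z⁻¹ * ∫⁻ τ, ENNReal.ofReal (exp (-p * t)) * extKernel g (t - τ) ∂P := by
    intro t
    rw [resolventConv, mul_left_comm, lintegral_const_mul _ (hg.measurable_extKernel_const_sub t)]
  have hm2 : Measurable fun x : ℝ × ℝ => ENNReal.ofReal (exp (-p * x.1)) * extKernel g (x.1 - x.2) :=
    ((measurable_ofReal_exp_mul _).comp measurable_fst).mul hm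
  simp_rw [h1]
  rw [lintegral_const_mul _ (Measurable.lintegral_prod_right' hm2),
    lintegral_lintegral_swap hm2.aemeasurable]
  have h2 : ∀ᵐ τ ∂P, ∫⁻ t in Ioi 0, ENNReal.ofReal (exp (-p * t)) * extKernel g (t - τ) =
      ENNReal.ofReal (exp (-p * τ)) * ENNReal.ofReal (laplaceK g p) := by
    filter_upwards [ae_nonneg_of_Iio hP.Iio_zero] with τ hτ
    rw [← hg.lintegral_exp_mul_extKernel hp, ← lintegral_const_mul _
      (hg.measurable_exp_mul_extKernel _),
      ← lintegral_sub_right_eq_self (μ := volume) _ τ, ← lintegral_indicator measurableSet_Ioi]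
    refine lintegral_congr fun t => ?_
    rw [← mul_assoc, ← ENNReal.ofReal_mul (exp_pos _).le, ← Real.exp_add,
      show -p * τ + -p * (t - τ) = -p * t by ring]
    by_cases ht : 0 < t
    · rw [indicator_of_mem (show t ∈ Ioi (0 : ℝ) from ht)]
    · rw [indicator_of_notMem (show t ∉ Ioi (0 : ℝ) from ht), extKernel_of_nonpos (by linarith),
        mul_zero]
  rw [lintegral_congr_ae h2, lintegral_mul_const _ (measurable_ofReal_exp_mul _)]
  have h3 := hP.lap_eq p hp
  rw [lap] at h3
  rw [h3, ← ENNReal.ofReal_mul (by positivity), ← ENNReal.ofReal_mul (by positivity)]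
  congr 1
  field_simp

lemma measurable_measure_Iic (P : Measure ℝ) : Measurable fun t => P (Iic t) :=
  Monotone.measurable fun _ _ h => measure_mono (Iic_subset_Iic.2 h)

lemma lintegral_exp_mul_measure_Iic [SFinite P] (hP : P (Iio 0) = 0) {p : ℝ} (hp : 0 < p) :
    ∫⁻ t in Ioi 0, ENNReal.ofReal (exp (-p * t)) * P (Iic t) = ENNReal.ofReal p⁻¹ * lap P p := by
  have hS : MeasurableSet {x : ℝ × ℝ | x.2 ≤ x.1} := measurableSet_le measurable_snd measurable_fst
  have hm : Measurable fun x : ℝ × ℝ => ENNReal.ofReal (exp (-p * x.1)) *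
      {x : ℝ × ℝ | x.2 ≤ x.1}.indicator 1 x :=
    ((measurable_ofReal_exp_mul _).comp measurable_fst).mul (measurable_one.indicator hS)
  have h1 : ∀ t, ENNReal.ofReal (exp (-p * t)) * P (Iic t) = ∫⁻ τ, ENNReal.ofReal (exp (-p * t)) *
      {x : ℝ × ℝ | x.2 ≤ x.1}.indicator 1 (t, τ) ∂P := by
    intro t
    have h2 : Measurable fun τ : ℝ => {x : ℝ × ℝ | x.2 ≤ x.1}.indicator (1 : ℝ × ℝ → ℝ≥0∞) (t, τ) :=
      (measurable_one.indicator hS).comp measurable_prodMk_left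
    rw [lintegral_const_mul _ h2, ← lintegral_indicator_one measurableSet_Iic]
    rfl
  simp_rw [h1]
  rw [lintegral_lintegral_swap hm.aemeasurable, lap,
    ← lintegral_const_mul _ (measurable_ofReal_exp_mul _)]
  refine lintegral_congr_ae ?_
  filter_upwards [ae_nonneg_of_Iio hP] with τ hτ
  have h2 : ∫⁻ t in Ioi τ, ENNReal.ofReal (exp (-p * t)) =
      ENNReal.ofReal p⁻¹ * ENNReal.ofReal (exp (-p * τ)) := by
    rw [← ofReal_integral_eq_lintegral_ofReal (exp_neg_integrableOn_Ioi τ hp)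
      (ae_of_all _ fun x => (exp_pos _).le), integral_exp_mul_Ioi (neg_lt_zero.2 hp),
      ← ENNReal.ofReal_mul (inv_pos.2 hp).le]
    congr 1
    field_simp
  rw [← h2, ← setLIntegral_congr (Ioi_ae_eq_Ici (a := τ)).symm,
    ← lintegral_indicator measurableSet_Ioi, ← lintegral_indicator measurableSet_Ici]
  refine lintegral_congr_ae ?_
  filter_upwards [Measure.ae_ne volume 0] with t ht
  by_cases h : τ ≤ t
  · have h0 : t ∈ Ioi (0 : ℝ) := lt_of_le_of_ne (hτ.trans h) (Ne.symm ht)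
    rw [indicator_of_mem h0, indicator_of_mem (show t ∈ Ici τ from h),
      indicator_of_mem (show (t, τ) ∈ {x : ℝ × ℝ | x.2 ≤ x.1} from h)]
    simp
  · rw [indicator_of_notMem (show t ∉ Ici τ from h)]
    by_cases h0 : t ∈ Ioi (0 : ℝ)
    · rw [indicator_of_mem h0,
        indicator_of_notMem (show (t, τ) ∉ {x : ℝ × ℝ | x.2 ≤ x.1} from h), mul_zero]
    · rw [indicator_of_notMem h0]

/-- Convolution and distribution function have Laplace transforms 𝒦/(z + ℒ) and p⁻¹ z/(z + ℒ), which
add up to p⁻¹, the transform of 1. -/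
lemma IsResolventLaw.resolventConv_ae_eq (hg : LogConvexKernel g) (hz : 0 < z)
    (hP : IsResolventLaw g z P) :
    ∀ᵐ t ∂volume.restrict (Ioi 0), resolventConv g z P t = P (Ioi t) := by
  have := hP.isProbabilityMeasure
  have hm : Measurable fun t => resolventConv g z P t + P (Iic t) :=
    hg.measurable_resolventConv.add (measurable_measure_Iic P)
  have key : (fun t => resolventConv g z P t + P (Iic t)) =ᵐ[volume.restrict (Ioi 0)]
      fun _ => 1 := by
    rw [← withDensity_eq_iff_of_sigmaFinite hm.aemeasurable aemeasurable_const]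
    have h1 : ∀ p, 0 < p → lap ((volume.restrict (Ioi 0)).withDensity fun _ => 1) p =
        ENNReal.ofReal p⁻¹ := by
      intro p hp
      rw [← lintegral_exp_neg_mul_Ioi hp, lap, lintegral_withDensity_eq_lintegral_mul _
        measurable_const (measurable_ofReal_exp_mul _)]
      simp
    refine (ext_of_lap (fun p hp => ?_) fun p hp => (h1 p hp).trans_ne ENNReal.ofReal_ne_top).symm
    have hL := hg.laplaceL_nonneg hp
    have hK := hg.laplaceK_nonneg p
    rw [h1 p hp, lap, lintegral_withDensity_eq_lintegral_mul _ hm (measurable_ofReal_exp_mul _)]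
    simp only [Pi.mul_apply, add_mul]
    have hm1 : Measurable fun t => resolventConv g z P t * ENNReal.ofReal (exp (-p * t)) :=
      hg.measurable_resolventConv.mul (measurable_ofReal_exp_mul _)
    rw [lintegral_add_left hm1]
    simp_rw [mul_comm (resolventConv g z P _), mul_comm (P (Iic _))]
    rw [hP.lap_resolventConv hg hz hp, lintegral_exp_mul_measure_Iic hP.Iio_zero hp,
      hP.lap_eq p hp, ← ENNReal.ofReal_mul (by positivity),
      ← ENNReal.ofReal_add (by positivity) (by positivity)]
    congr 1
    have hne : z + p * laplaceK g p ≠ 0 := by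
      have : 0 ≤ p * laplaceK g p := hL
      positivity
    rw [laplaceL]
    field_simp
    ring
  filter_upwards [key] with t ht
  have h1 : P (Iic t) + P (Ioi t) = 1 := by
    rw [← compl_Iic, prob_add_prob_compl measurableSet_Iic]
  rw [← h1, add_comm] at ht
  exact (ENNReal.add_right_inj (measure_ne_top P _)).1 ht

lemma LogConvexKernel.extKernel_le_liminf (hg : LogConvexKernel g) {x : ℝ} {u : ℕ → ℝ}
    (hu : Tendsto u atTop (𝓝 x)) :
    extKernel g x ≤ liminf (fun n => extKernel g (u n)) atTop := by
  by_cases hx : 0 < x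
  · have h1 : Tendsto (fun n => ENNReal.ofReal (g (u n))) atTop (𝓝 (ENNReal.ofReal (g x))) :=
      ENNReal.tendsto_ofReal
        (((hg.continuousOn.continuousAt (Ioi_mem_nhds hx)).tendsto).comp hu)
    have h2 : Tendsto (fun n => extKernel g (u n)) atTop (𝓝 (ENNReal.ofReal (g x))) := by
      refine h1.congr' ?_
      filter_upwards [hu.eventually_const_lt hx] with n hn
      rw [extKernel_of_pos hn]
    rw [extKernel_of_pos hx, h2.liminf_eq]
  · rw [extKernel_of_nonpos (not_lt.1 hx)]
    exact zero_le

/-- Fatou's lemma along points u_n decreasing to t at which the almost-everywhere identity holds;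
`extKernel` is lower semicontinuous because it vanishes at 0. -/
lemma IsResolventLaw.resolventConv_le (hg : LogConvexKernel g) (hz : 0 < z)
    (hP : IsResolventLaw g z P) {t : ℝ} (ht : 0 < t) : resolventConv g z P t ≤ P (Ioi t) := by
  have hae := hP.resolventConv_ae_eq hg hz
  have hex : ∀ n : ℕ, ∃ u ∈ Ioo t (t + 1 / ((n : ℝ) + 1)), resolventConv g z P u = P (Ioi u) := by
    intro n
    have hpos : 0 < 1 / ((n : ℝ) + 1) := Nat.one_div_pos_of_nat
    rw [ae_restrict_iff' measurableSet_Ioi] at hae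
    by_contra hcon
    push Not at hcon
    have h1 : volume (Ioo t (t + 1 / ((n : ℝ) + 1))) = 0 := by
      refine measure_mono_null (fun u hu => ?_) (ae_iff.1 hae)
      exact fun h => hcon u hu (h (ht.trans hu.1))
    rw [Real.volume_Ioo, ENNReal.ofReal_eq_zero] at h1
    linarith
  choose u hu hue using hex
  have hlim : Tendsto u atTop (𝓝 t) := by
    have h1 : Tendsto (fun n : ℕ => t + 1 / ((n : ℝ) + 1)) atTop (𝓝 t) := by
      have := (tendsto_one_div_add_atTop_nhds_zero_nat (𝕜 := ℝ)).const_add t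
      rwa [add_zero] at this
    exact tendsto_of_tendsto_of_tendsto_of_le_of_le tendsto_const_nhds h1
      (fun n => (hu n).1.le) fun n => (hu n).2.le
  have h1 : ∫⁻ τ, extKernel g (t - τ) ∂P ≤
      liminf (fun n => ∫⁻ τ, extKernel g (u n - τ) ∂P) atTop :=
    (lintegral_mono fun τ => hg.extKernel_le_liminf (hlim.sub_const τ)).trans
      (lintegral_liminf_le fun n => hg.measurable_extKernel.comp (by fun_prop))
  have h2 : ∀ n, ∫⁻ τ, extKernel g (u n - τ) ∂P ≤ ENNReal.ofReal z * P (Ioi t) := by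
    intro n
    have h3 : ENNReal.ofReal z * resolventConv g z P (u n) = ∫⁻ τ, extKernel g (u n - τ) ∂P := by
      rw [resolventConv, ← mul_assoc, ← ENNReal.ofReal_mul hz.le, mul_inv_cancel₀ hz.ne',
        ENNReal.ofReal_one, one_mul]
    rw [← h3, hue n]
    gcongr
    exact (hu n).1.le
  have h4 : ∫⁻ τ, extKernel g (t - τ) ∂P ≤ ENNReal.ofReal z * P (Ioi t) := by
    refine h1.trans ((liminf_le_liminf (Eventually.of_forall h2)).trans ?_)
    rw [liminf_const]
  calc resolventConv g z P t ≤ ENNReal.ofReal z⁻¹ * (ENNReal.ofReal z * P (Ioi t)) := by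
        rw [resolventConv]; gcongr
    _ = P (Ioi t) := by
      rw [← mul_assoc, ← ENNReal.ofReal_mul (inv_pos.2 hz).le, inv_mul_cancel₀ hz.ne',
        ENNReal.ofReal_one, one_mul]

lemma LogConvexKernel.tendsto_lintegral_Iic_extKernel (hg : LogConvexKernel g) :
    Tendsto (fun n : ℕ => ∫⁻ x in Iic (1 / ((n : ℝ) + 1)), extKernel g x) atTop (𝓝 0) := by
  have h1 : ∀ n : ℕ, ∫⁻ x in Iic (1 / ((n : ℝ) + 1)), extKernel g x =
      ∫⁻ x in Ioc 0 (1 / ((n : ℝ) + 1)), extKernel g x ∂(volume.restrict (Iic 1)) := by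
    intro n
    rw [Measure.restrict_restrict measurableSet_Ioc, ← lintegral_indicator measurableSet_Iic,
      ← lintegral_indicator (measurableSet_Ioc.inter measurableSet_Iic)]
    refine lintegral_congr fun x => ?_
    have hn1 : 1 / ((n : ℝ) + 1) ≤ 1 := by
      rw [div_le_one (by positivity)]
      have : (0 : ℝ) ≤ n := by positivity
      linarith
    by_cases hx : x ≤ 0
    · simp [indicator, extKernel_of_nonpos hx]
    · push Not at hx
      by_cases h : x ≤ 1 / ((n : ℝ) + 1)
      · rw [indicator_of_mem (show x ∈ Iic _ from h), indicator_of_mem]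
        exact ⟨⟨hx, h⟩, h.trans hn1⟩
      · rw [indicator_of_notMem (show x ∉ Iic _ from h), indicator_of_notMem]
        exact fun h' => h h'.1.2
  simp_rw [h1]
  refine tendsto_setLIntegral_zero (hg.lintegral_Iic_extKernel_ne_top 1) ?_
  have h2 : Tendsto (fun n : ℕ => ENNReal.ofReal (1 / ((n : ℝ) + 1))) atTop (𝓝 0) := by
    have := ENNReal.tendsto_ofReal (tendsto_one_div_add_atTop_nhds_zero_nat (𝕜 := ℝ))
    rwa [ENNReal.ofReal_zero] at this
  refine tendsto_of_tendsto_of_tendsto_of_le_of_le tendsto_const_nhds h2 (fun _ => zero_le)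
    fun n => ?_
  refine (Measure.restrict_apply_le _ _).trans ?_
  rw [Real.volume_Ioc, sub_zero]

lemma LogConvexKernel.extKernel_anti (hg : LogConvexKernel g) {x y : ℝ} (hx : 0 < x)
    (hxy : x ≤ y) : extKernel g y ≤ extKernel g x := by
  rw [extKernel_of_pos hx, extKernel_of_pos (hx.trans_le hxy)]
  exact ENNReal.ofReal_le_ofReal (hg.antitone hx (hx.trans_le hxy) hxy)

lemma IsResolventLaw.measure_Ioc_le (hg : LogConvexKernel g) (hz : 0 < z)
    (hP : IsResolventLaw g z P) {t h : ℝ} (ht : 0 < t) :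
    P (Ioc t (t + h)) ≤ ENNReal.ofReal t⁻¹ * ENNReal.ofReal h := by
  have h1 := hP.smul_restrict_le_volume hg hz ht (Ioc t (t + h))
  rw [Measure.smul_apply, smul_eq_mul, Measure.restrict_apply measurableSet_Ioc,
    inter_eq_self_of_subset_left Ioc_subset_Ioi_self, Real.volume_Ioc, add_sub_cancel_left] at h1
  calc P (Ioc t (t + h)) = ENNReal.ofReal t⁻¹ * (ENNReal.ofReal t * P (Ioc t (t + h))) := by
        rw [← mul_assoc, ← ENNReal.ofReal_mul (inv_pos.2 ht).le, inv_mul_cancel₀ ht.ne',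
          ENNReal.ofReal_one, one_mul]
    _ ≤ _ := by gcongr

/-- Average the almost-everywhere identity over (t, t+h]. Points τ < t contribute at most h g(t -
τ), by monotonicity. Points τ in (t, t+h] meet the singularity of g, but have total mass at most h/t
by the density bound, so their contribution divided by h vanishes as h → 0. -/
lemma IsResolventLaw.measure_Ioi_add_le (hg : LogConvexKernel g) (hz : 0 < z)
    (hP : IsResolventLaw g z P) {t h : ℝ} (ht : 0 < t) (hh : 0 < h) :
    P (Ioi (t + h)) ≤ resolventConv g z P t +
      ENNReal.ofReal z⁻¹ * ENNReal.ofReal t⁻¹ * ∫⁻ x in Iic h, extKernel g x := by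
  have := hP.isProbabilityMeasure
  have hm := hg.measurable_extKernel_sub
  set C := ∫⁻ x in Iic h, extKernel g x with hC
  have hvol : volume (Ioc t (t + h)) = ENNReal.ofReal h := by
    rw [Real.volume_Ioc, add_sub_cancel_left]
  have h1 : P (Ioi (t + h)) * ENNReal.ofReal h ≤
      ∫⁻ u in Ioc t (t + h), resolventConv g z P u := by
    have h2 : ∀ᵐ u ∂volume.restrict (Ioc t (t + h)), resolventConv g z P u = P (Ioi u) :=
      ae_restrict_of_ae_restrict_of_subset (fun u hu => ht.trans hu.1)
        (hP.resolventConv_ae_eq hg hz)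
    rw [lintegral_congr_ae h2, ← hvol, ← setLIntegral_const]
    exact setLIntegral_mono' measurableSet_Ioc fun u hu =>
      measure_mono (Ioi_subset_Ioi hu.2)
  have h3 : ∫⁻ u in Ioc t (t + h), resolventConv g z P u = ENNReal.ofReal z⁻¹ *
      ∫⁻ τ, (∫⁻ u in Ioc t (t + h), extKernel g (u - τ)) ∂P := by
    simp only [resolventConv]
    rw [lintegral_const_mul _ (Measurable.lintegral_prod_right' hm),
      lintegral_lintegral_swap hm.aemeasurable]
  have h4 : ∀ᵐ τ ∂P, ∫⁻ u in Ioc t (t + h), extKernel g (u - τ) ≤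
      ENNReal.ofReal h * extKernel g (t - τ) + (Ioc t (t + h)).indicator (fun _ => C) τ := by
    filter_upwards [(hP.absolutelyContinuous hg hz).ae_le (Measure.ae_ne volume t)] with τ hτ
    rcases lt_or_gt_of_ne hτ with hlt | hlt
    · refine le_add_right ?_
      rw [← hvol, mul_comm, ← setLIntegral_const]
      exact setLIntegral_mono' measurableSet_Ioc fun u hu =>
        hg.extKernel_anti (sub_pos.2 hlt) (by linarith [hu.1])
    · refine le_add_left ?_
      by_cases h' : τ ≤ t + h
      · rw [indicator_of_mem (show τ ∈ Ioc t _ from ⟨hlt, h'⟩), hC,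
          ← lintegral_indicator measurableSet_Iic, ← lintegral_sub_right_eq_self (μ := volume) _ τ,
          ← lintegral_indicator measurableSet_Ioc]
        refine lintegral_mono fun u => ?_
        by_cases hu : u ∈ Ioc t (t + h)
        · rw [indicator_of_mem hu, indicator_of_mem]
          show u - τ ≤ _
          linarith [hu.2]
        · rw [indicator_of_notMem hu]
          exact zero_le
      · rw [indicator_of_notMem (fun hτ => h' hτ.2), nonpos_iff_eq_zero,
          setLIntegral_congr_fun (g := fun _ => 0) measurableSet_Ioc, lintegral_zero]
        intro u hu
        exact extKernel_of_nonpos (by linarith [hu.2])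
  have h5 : P (Ioi (t + h)) * ENNReal.ofReal h ≤ (resolventConv g z P t +
      ENNReal.ofReal z⁻¹ * ENNReal.ofReal t⁻¹ * C) * ENNReal.ofReal h := by
    rw [h3] at h1
    refine h1.trans ?_
    calc ENNReal.ofReal z⁻¹ * ∫⁻ τ, (∫⁻ u in Ioc t (t + h), extKernel g (u - τ)) ∂P
        ≤ ENNReal.ofReal z⁻¹ * ∫⁻ τ, (ENNReal.ofReal h * extKernel g (t - τ) +
            (Ioc t (t + h)).indicator (fun _ => C) τ) ∂P := by
          gcongr ENNReal.ofReal z⁻¹ * ?_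
          exact lintegral_mono_ae h4
      _ = ENNReal.ofReal h * resolventConv g z P t +
            ENNReal.ofReal z⁻¹ * (C * P (Ioc t (t + h))) := by
          rw [lintegral_add_right _ (measurable_const.indicator measurableSet_Ioc),
            lintegral_const_mul _ (hg.measurable_extKernel_const_sub t),
            lintegral_indicator_const measurableSet_Ioc, resolventConv]
          ring
      _ ≤ ENNReal.ofReal h * resolventConv g z P t +
            ENNReal.ofReal z⁻¹ * (C * (ENNReal.ofReal t⁻¹ * ENNReal.ofReal h)) := by
          gcongr
          exact hP.measure_Ioc_le hg hz ht
      _ = _ := by ring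
  exact (ENNReal.mul_le_mul_iff_left (by simpa using hh) ENNReal.ofReal_ne_top).1 h5

/-- The convolution `z⁻¹ (g * P)` is the tail of the resolvent law, at every point. -/
theorem IsResolventLaw.resolventConv_eq (hg : LogConvexKernel g) (hz : 0 < z)
    (hP : IsResolventLaw g z P) {t : ℝ} (ht : 0 < t) : resolventConv g z P t = P (Ioi t) := by
  refine le_antisymm (hP.resolventConv_le hg hz ht) ?_
  have hpos : ∀ n : ℕ, 0 < 1 / ((n : ℝ) + 1) := fun n => Nat.one_div_pos_of_nat
  have hmono : Monotone fun n : ℕ => Ioi (t + 1 / ((n : ℝ) + 1)) := fun m n hmn =>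
    Ioi_subset_Ioi (add_le_add le_rfl (Nat.one_div_le_one_div hmn))
  have hU : ⋃ n : ℕ, Ioi (t + 1 / ((n : ℝ) + 1)) = Ioi t := by
    ext x
    simp only [mem_iUnion, mem_Ioi]
    refine ⟨fun ⟨n, hn⟩ => by linarith [hpos n], fun hx => ?_⟩
    obtain ⟨n, hn⟩ := exists_nat_one_div_lt (sub_pos.2 hx)
    exact ⟨n, by linarith⟩
  have h1 := tendsto_measure_iUnion_atTop (μ := P) hmono
  rw [hU] at h1
  have h2 : Tendsto (fun n : ℕ => resolventConv g z P t + ENNReal.ofReal z⁻¹ * ENNReal.ofReal t⁻¹ *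
      ∫⁻ x in Iic (1 / ((n : ℝ) + 1)), extKernel g x) atTop (𝓝 (resolventConv g z P t)) := by
    have := (ENNReal.Tendsto.const_mul hg.tendsto_lintegral_Iic_extKernel
      (a := ENNReal.ofReal z⁻¹ * ENNReal.ofReal t⁻¹)
      (Or.inr (ENNReal.mul_ne_top ENNReal.ofReal_ne_top ENNReal.ofReal_ne_top))).const_add
      (resolventConv g z P t)
    rwa [mul_zero, add_zero] at this
  exact le_of_tendsto_of_tendsto' h1 h2 fun n => hP.measure_Ioi_add_le hg hz ht (hpos n)

end Tail

/-! ### Two-sided bounds of the tail by the kernel -/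

section Intermittency
variable {g : ℝ → ℝ} {z : ℝ} {P : Measure ℝ}

lemma lintegral_mul_exp_Ioc {c m : ℝ} (hc : 0 ≤ c) (hm : 0 ≤ m) :
    (∫⁻ x in Ioc 0 m, ENNReal.ofReal (c * exp (c * x))) + 1 = ENNReal.ofReal (exp (c * m)) := by
  have h1 : ∫ x in (0 : ℝ)..m, c * exp (c * x) = exp (c * m) - 1 := by
    simp
  have h2 : 0 ≤ exp (c * m) - 1 := sub_nonneg.2 (one_le_exp (mul_nonneg hc hm))
  rw [← ofReal_integral_eq_lintegral_ofReal, ← intervalIntegral.integral_of_le hm, h1,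
    ← ENNReal.ofReal_one, ← ENNReal.ofReal_add h2 zero_le_one, sub_add_cancel]
  · exact ((by fun_prop : Continuous fun x => c * exp (c * x)).integrableOn_Icc).mono_set
      Ioc_subset_Icc_self
  · exact ae_of_all _ fun x => mul_nonneg hc (exp_pos _).le

/-- Integration by parts: both sides equal the expectation of e^{c min(τ, t)}. -/
lemma lintegral_mul_exp_mul_measure_Ioi [IsProbabilityMeasure P] (hP : P (Iio 0) = 0) {c t : ℝ}
    (hc : 0 ≤ c) (ht : 0 ≤ t) :
    (∫⁻ x in Ioc 0 t, ENNReal.ofReal (c * exp (c * x)) * P (Ioi x)) + 1 =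
      ∫⁻ τ in Iic t, ENNReal.ofReal (exp (c * τ)) ∂P + ENNReal.ofReal (exp (c * t)) * P (Ioi t) := by
  have hS : MeasurableSet {x : ℝ × ℝ | x.1 < x.2} := measurableSet_lt measurable_fst measurable_snd
  have hm : Measurable fun x : ℝ × ℝ => ENNReal.ofReal (c * exp (c * x.1)) *
      {x : ℝ × ℝ | x.1 < x.2}.indicator 1 x :=
    (by fun_prop : Measurable fun x : ℝ × ℝ => ENNReal.ofReal (c * exp (c * x.1))).mul
      (measurable_one.indicator hS)
  have h1 : ∀ x, ENNReal.ofReal (c * exp (c * x)) * P (Ioi x) =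
      ∫⁻ τ, ENNReal.ofReal (c * exp (c * x)) *
        {x : ℝ × ℝ | x.1 < x.2}.indicator 1 (x, τ) ∂P := by
    intro x
    have h2 : Measurable fun τ : ℝ => {x : ℝ × ℝ | x.1 < x.2}.indicator (1 : ℝ × ℝ → ℝ≥0∞) (x, τ) :=
      (measurable_one.indicator hS).comp measurable_prodMk_left
    rw [lintegral_const_mul _ h2, ← lintegral_indicator_one measurableSet_Ioi]
    rfl
  have h3 : ∀ᵐ τ ∂P, (∫⁻ x in Ioc 0 t, ENNReal.ofReal (c * exp (c * x)) *
        {x : ℝ × ℝ | x.1 < x.2}.indicator 1 (x, τ)) + 1 =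
      (Iic t).indicator (fun τ => ENNReal.ofReal (exp (c * τ))) τ +
        (Ioi t).indicator (fun _ => ENNReal.ofReal (exp (c * t))) τ := by
    filter_upwards [ae_nonneg_of_Iio hP] with τ hτ
    have h4 : ∫⁻ x in Ioc 0 t, ENNReal.ofReal (c * exp (c * x)) *
        {x : ℝ × ℝ | x.1 < x.2}.indicator 1 (x, τ) =
        ∫⁻ x in Ioc 0 (min τ t), ENNReal.ofReal (c * exp (c * x)) := by
      rw [← setLIntegral_congr (Ioo_ae_eq_Ioc (a := 0) (b := t)),
        ← setLIntegral_congr (Ioo_ae_eq_Ioc (a := 0) (b := min τ t)),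
        ← lintegral_indicator measurableSet_Ioo, ← lintegral_indicator measurableSet_Ioo]
      refine lintegral_congr fun x => ?_
      by_cases hx : x ∈ Ioo 0 t <;> by_cases hxτ : x < τ
      · rw [indicator_of_mem hx, indicator_of_mem (show x ∈ Ioo 0 (min τ t) from
          ⟨hx.1, lt_min hxτ hx.2⟩), indicator_of_mem (show (x, τ) ∈ _ from hxτ)]
        simp
      · rw [indicator_of_mem hx, indicator_of_notMem fun h : x ∈ Ioo 0 (min τ t) =>
          hxτ (lt_min_iff.1 h.2).1, indicator_of_notMem (show (x, τ) ∉ _ from hxτ), mul_zero]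
      · rw [indicator_of_notMem hx, indicator_of_notMem fun h : x ∈ Ioo 0 (min τ t) =>
          hx ⟨h.1, (lt_min_iff.1 h.2).2⟩]
      · rw [indicator_of_notMem hx, indicator_of_notMem fun h : x ∈ Ioo 0 (min τ t) =>
          hx ⟨h.1, (lt_min_iff.1 h.2).2⟩]
    rw [h4, lintegral_mul_exp_Ioc hc (le_min hτ ht)]
    by_cases h : τ ≤ t
    · rw [min_eq_left h, indicator_of_mem (show τ ∈ Iic t from h),
        indicator_of_notMem (show τ ∉ Ioi t from not_lt.2 h), add_zero]
    · rw [min_eq_right (not_le.1 h).le, indicator_of_notMem (show τ ∉ Iic t from h),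
        indicator_of_mem (show τ ∈ Ioi t from not_le.1 h), zero_add]
  have h5 := lintegral_congr_ae h3
  rw [lintegral_add_right _ measurable_const, lintegral_add_right _
    (measurable_const.indicator measurableSet_Ioi), lintegral_indicator measurableSet_Iic,
    lintegral_indicator_const measurableSet_Ioi] at h5
  simp only [lintegral_const, measure_univ, mul_one] at h5
  rw [← h5]
  simp_rw [h1]
  rw [lintegral_lintegral_swap hm.aemeasurable]

/-- An exponential bound for the tail of a resolvent law. -/
theorem IsResolventLaw.measure_Ioi_le_exp (hg : LogConvexKernel g) (hz : 0 < z)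
    (hP : IsResolventLaw g z P) {c t : ℝ} (hc : 0 ≤ c) (ht : 0 < t)
    (hJ : ENNReal.ofReal c * ∫⁻ x in Iic t, ENNReal.ofReal (exp (c * x)) * extKernel g x ≤
      ENNReal.ofReal z) : P (Ioi t) ≤ ENNReal.ofReal (exp (-c * t)) := by
  have := hP.isProbabilityMeasure
  have hm := hg.measurable_extKernel_sub
  set M := ∫⁻ τ in Iic t, ENNReal.ofReal (exp (c * τ)) ∂P with hM
  set J := ∫⁻ x in Iic t, ENNReal.ofReal (exp (c * x)) * extKernel g x with hJdef
  have hMfin : M ≠ ⊤ := by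
    have h1 : M ≤ ∫⁻ _ in Iic t, ENNReal.ofReal (exp (c * t)) ∂P :=
      setLIntegral_mono' measurableSet_Iic fun τ hτ =>
        ENNReal.ofReal_le_ofReal (exp_le_exp.2 (mul_le_mul_of_nonneg_left hτ hc))
    refine ne_top_of_le_ne_top ?_ h1
    rw [setLIntegral_const]
    exact ENNReal.mul_ne_top ENNReal.ofReal_ne_top (measure_ne_top _ _)
  have key := lintegral_mul_exp_mul_measure_Ioi hP.Iio_zero hc ht.le
  have hm2 : Measurable fun x : ℝ × ℝ => ENNReal.ofReal (exp (c * x.1)) * extKernel g (x.1 - x.2) :=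
    ((measurable_ofReal_exp_mul _).comp measurable_fst).mul hm
  have hswap : ∫⁻ x in Ioc 0 t, ENNReal.ofReal (c * exp (c * x)) * P (Ioi x) =
      ENNReal.ofReal c * (ENNReal.ofReal z⁻¹ *
        ∫⁻ τ, (∫⁻ x in Ioc 0 t, ENNReal.ofReal (exp (c * x)) * extKernel g (x - τ)) ∂P) := by
    rw [← lintegral_lintegral_swap hm2.aemeasurable, ← lintegral_const_mul _
      (Measurable.lintegral_prod_right' hm2), ← lintegral_const_mul _
      ((Measurable.lintegral_prod_right' hm2).const_mul _)]
    refine setLIntegral_congr_fun measurableSet_Ioc fun x hx => ?_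
    simp only
    rw [← hP.resolventConv_eq hg hz hx.1, resolventConv, ENNReal.ofReal_mul hc,
      lintegral_const_mul _ (hg.measurable_extKernel_const_sub x)]
    ring
  have hinner : ∀ᵐ τ ∂P, ∫⁻ x in Ioc 0 t, ENNReal.ofReal (exp (c * x)) * extKernel g (x - τ) ≤
      (Iic t).indicator (fun τ => ENNReal.ofReal (exp (c * τ)) * J) τ := by
    filter_upwards [ae_nonneg_of_Iio hP.Iio_zero] with τ hτ
    by_cases h : τ ≤ t
    · rw [indicator_of_mem (show τ ∈ Iic t from h), hJdef, ← lintegral_const_mul _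
        (hg.measurable_exp_mul_extKernel _), ← lintegral_indicator measurableSet_Iic,
        ← lintegral_sub_right_eq_self (μ := volume) _ τ, ← lintegral_indicator measurableSet_Ioc]
      refine lintegral_mono fun x => ?_
      by_cases hx : x ∈ Ioc 0 t
      · rw [indicator_of_mem hx, indicator_of_mem (show x - τ ∈ Iic t from ?_), ← mul_assoc,
          ← ENNReal.ofReal_mul (exp_pos _).le, ← Real.exp_add,
          show c * τ + c * (x - τ) = c * x by ring]
        show x - τ ≤ t
        linarith [hx.2]
      · rw [indicator_of_notMem hx]
        exact zero_le
    · rw [indicator_of_notMem (show τ ∉ Iic t from h), nonpos_iff_eq_zero,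
        setLIntegral_congr_fun (g := fun _ => 0) measurableSet_Ioc, lintegral_zero]
      intro x hx
      simp only
      rw [extKernel_of_nonpos (by linarith [hx.2]), mul_zero]
  -- Writing the tail as z⁻¹ (g * P), the left side is at most (c J / z) M ≤ M. In the integration
  -- by parts formula the finite M then cancels, leaving e^{ct} P(t, ∞) ≤ 1.
  have hle : ∫⁻ x in Ioc 0 t, ENNReal.ofReal (c * exp (c * x)) * P (Ioi x) ≤ M := by
    rw [hswap]
    calc ENNReal.ofReal c * (ENNReal.ofReal z⁻¹ *
          ∫⁻ τ, (∫⁻ x in Ioc 0 t, ENNReal.ofReal (exp (c * x)) * extKernel g (x - τ)) ∂P)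
        ≤ ENNReal.ofReal c * (ENNReal.ofReal z⁻¹ * ∫⁻ τ,
            (Iic t).indicator (fun τ => ENNReal.ofReal (exp (c * τ)) * J) τ ∂P) := by
          gcongr ENNReal.ofReal c * (ENNReal.ofReal z⁻¹ * ?_)
          exact lintegral_mono_ae hinner
      _ = (ENNReal.ofReal c * J) * ENNReal.ofReal z⁻¹ * M := by
          rw [lintegral_indicator measurableSet_Iic, lintegral_mul_const _
            (measurable_ofReal_exp_mul _)]
          ring
      _ ≤ ENNReal.ofReal z * ENNReal.ofReal z⁻¹ * M := by gcongr
      _ = M := by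
          rw [← ENNReal.ofReal_mul hz.le, mul_inv_cancel₀ hz.ne', ENNReal.ofReal_one, one_mul]
  have h6 : M + ENNReal.ofReal (exp (c * t)) * P (Ioi t) ≤ M + 1 := by
    rw [← key]
    gcongr
  have h7 := (ENNReal.add_le_add_iff_left hMfin).1 h6
  calc P (Ioi t) = ENNReal.ofReal (exp (-c * t)) * (ENNReal.ofReal (exp (c * t)) * P (Ioi t)) := by
        rw [← mul_assoc, ← ENNReal.ofReal_mul (exp_pos _).le, ← Real.exp_add]
        simp
    _ ≤ ENNReal.ofReal (exp (-c * t)) * 1 := by gcongr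
    _ = _ := mul_one _

lemma LogConvexKernel.le_rpow_of_le_one (hg : LogConvexKernel g) {x₀ x t : ℝ} (h0 : 0 < x₀)
    (h1 : g x₀ ≤ 1) (hx : x₀ ≤ x) (hxt : x ≤ t) (ht : x₀ < t) :
    g x ≤ g t ^ ((x - x₀) / (t - x₀)) := by
  have hd : 0 < t - x₀ := sub_pos.2 ht
  set θ := (x - x₀) / (t - x₀) with hθ
  have hθ0 : 0 ≤ θ := div_nonneg (sub_nonneg.2 hx) hd.le
  have hθ1 : θ ≤ 1 := (div_le_one hd).2 (by linarith)
  have e : (1 - θ) * x₀ + θ * t = x := by rw [hθ]; field_simp; ring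
  have h2 := hg.le_rpow_mul_rpow x₀ t θ h0 (h0.trans ht) hθ0 hθ1
  rw [e] at h2
  refine h2.trans (mul_le_of_le_one_left (rpow_nonneg (hg.pos t (h0.trans ht)).le _) ?_)
  exact rpow_le_one (hg.pos _ h0).le h1 (sub_nonneg.2 hθ1)

lemma lintegral_Ioi_exp_neg_sub {c x₀ : ℝ} (hc : 0 < c) :
    ∫⁻ x in Ioi x₀, ENNReal.ofReal (exp (-c * (x - x₀))) = ENNReal.ofReal c⁻¹ := by
  rw [← lintegral_exp_neg_mul_Ioi hc, ← lintegral_indicator measurableSet_Ioi,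
    ← lintegral_indicator measurableSet_Ioi]
  refine Eq.trans ?_ (lintegral_sub_right_eq_self (μ := volume)
    ((Ioi (0 : ℝ)).indicator fun x => ENNReal.ofReal (exp (-c * x))) x₀)
  refine lintegral_congr fun x => ?_
  simp [indicator]

/-- A log-convex kernel which is not integrable decays subexponentially. -/
lemma LogConvexKernel.eventually_exp_le (hg : LogConvexKernel g) {ε : ℝ} (hε : 0 < ε) :
    ∀ᶠ t in atTop, exp (-ε * t) ≤ g t := by
  by_contra hcon
  rw [not_eventually] at hcon
  obtain ⟨x₀, hx1, hx0⟩ := ((hg.tendsto_zero.eventually_le_const one_pos).and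
    (eventually_gt_atTop 0)).exists
  -- If g(t) < e^{-εt} for arbitrarily large t, log-convex interpolation between x₀ and such t
  -- spreads exponential decay to all x > x₀. Then g is integrable, against 𝒦(0+) = ∞.
  have hbound : ∀ x, x₀ < x → g x ≤ exp (-ε * (x - x₀)) := by
    intro x hx
    obtain ⟨t, ht, htx⟩ := (hcon.and_eventually (eventually_ge_atTop x)).exists
    push Not at ht
    have hd : 0 < t - x₀ := by linarith
    refine (hg.le_rpow_of_le_one hx0 hx1 hx.le htx (hx.trans_le htx)).trans ?_
    refine (rpow_le_rpow (hg.pos t (by linarith)).le ht.le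
      (div_nonneg (by linarith) hd.le)).trans ?_
    rw [← Real.exp_mul, exp_le_exp, neg_mul, neg_mul, neg_mul, neg_le_neg_iff, mul_assoc]
    refine mul_le_mul_of_nonneg_left ?_ hε.le
    rw [mul_div_assoc', le_div_iff₀ hd]
    nlinarith
  have hC : (∫⁻ x in Iic x₀, extKernel g x) + ENNReal.ofReal ε⁻¹ ≠ ⊤ :=
    ENNReal.add_ne_top.2 ⟨hg.lintegral_Iic_extKernel_ne_top x₀, ENNReal.ofReal_ne_top⟩
  obtain ⟨p, hp, hp0⟩ := ((hg.laplaceK_zero.eventually_gt_atTop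
    ((∫⁻ x in Iic x₀, extKernel g x) + ENNReal.ofReal ε⁻¹).toReal).and
      self_mem_nhdsWithin).exists
  have hp0 : 0 < p := hp0
  refine absurd hp (not_lt.2 ?_)
  rw [← ENNReal.ofReal_le_iff_le_toReal hC, ← hg.lintegral_exp_mul_extKernel hp0,
    ← lintegral_Ioi_exp_neg_sub (x₀ := x₀) hε, ← lintegral_add_compl _ (measurableSet_Iic (a := x₀)),
    compl_Iic]
  refine add_le_add ?_ ?_
  · refine setLIntegral_mono' measurableSet_Iic fun x _ => ?_
    by_cases hx : 0 < x
    · refine mul_le_of_le_one_left zero_le ?_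
      rw [ENNReal.ofReal_le_one, exp_le_one_iff]
      nlinarith
    · rw [extKernel_of_nonpos (not_lt.1 hx), mul_zero]
  · refine setLIntegral_mono' measurableSet_Ioi fun x hx => ?_
    have hx' : x₀ < x := hx
    rw [extKernel_of_pos (hx0.trans hx'), ← ENNReal.ofReal_mul (exp_pos _).le]
    refine ENNReal.ofReal_le_ofReal ((mul_le_of_le_one_left (hg.pos x (hx0.trans hx')).le ?_).trans
      (hbound x hx'))
    rw [exp_le_one_iff]
    nlinarith

/-- The tail of a resolvent law is eventually bounded by the power `3 / 4` of the kernel. -/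
theorem IsResolventLaw.eventually_measure_Ioi_le (hg : LogConvexKernel g) (hz : 0 < z)
    (hP : IsResolventLaw g z P) :
    ∀ᶠ t in atTop, P (Ioi t) ≤ ENNReal.ofReal (g t ^ (3 / 4 : ℝ)) := by
  obtain ⟨x₀, hx1, hx0⟩ := ((hg.tendsto_zero.eventually_le_const one_pos).and
    (eventually_gt_atTop 0)).exists
  -- The constant 12 is 2 · 6: the bound 2 for e^{c x₀}, and the integral 6/c of e^{-(c/6)(x - x₀)}.
  have hpow : Tendsto (fun T => 12 * g T ^ (1 / 8 : ℝ)) atTop (𝓝 0) := by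
    have := (hg.tendsto_zero.rpow_const (p := 1 / 8) (Or.inr (by norm_num))).const_mul 12
    rwa [zero_rpow (by norm_num), mul_zero] at this
  obtain ⟨T, hT, hTx⟩ := ((hpow.eventually_le_const (half_pos hz)).and
    (eventually_ge_atTop x₀)).exists
  set C := (∫⁻ x in Iic T, extKernel g x).toReal with hC
  have hC0 : 0 ≤ C := ENNReal.toReal_nonneg
  have hCe : ∫⁻ x in Iic T, extKernel g x = ENNReal.ofReal C :=
    (ENNReal.ofReal_toReal (hg.lintegral_Iic_extKernel_ne_top T)).symm
  have hsmall : ∀ᶠ c in 𝓝 (0 : ℝ), c * (exp (c * T) * C) ≤ z / 2 ∧ exp (c * x₀) ≤ 2 := by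
    have h1 : Tendsto (fun c : ℝ => c * (exp (c * T) * C)) (𝓝 0) (𝓝 0) := by
      have : Continuous fun c : ℝ => c * (exp (c * T) * C) := by fun_prop
      simpa using this.tendsto 0
    have h2 : Tendsto (fun c : ℝ => exp (c * x₀)) (𝓝 0) (𝓝 1) := by
      have : Continuous fun c : ℝ => exp (c * x₀) := by fun_prop
      simpa using this.tendsto 0
    exact (h1.eventually_le_const (half_pos hz)).and (h2.eventually_le_const one_lt_two)
  obtain ⟨ε, hε, hball⟩ := Metric.eventually_nhds_iff.1 hsmall
  filter_upwards [eventually_gt_atTop T, eventually_gt_atTop (2 * x₀),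
    hg.tendsto_zero.eventually_lt_const one_pos,
    hg.eventually_exp_le (half_pos hε)] with t htT htx hg1 hexp
  have ht : 0 < t := by linarith
  have hd : 0 < t - x₀ := by linarith
  have hgt := hg.pos t ht
  have hlog : log (g t) < 0 := log_neg hgt hg1
  -- This makes e^{-c(t - x₀)} = g(t)^{3/4}, so interpolation gives g(x) ≤ e^{-(4/3)c(x - x₀)},
  -- which beats the weight e^{cx}. Subexponential decay of g makes c as small as desired.
  set c := 3 / 4 * (-log (g t)) / (t - x₀) with hcdef
  have hc : 0 < c := div_pos (by linarith) hd
  have hcε : c < ε := by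
    have h1 : -(ε / 2) * t ≤ log (g t) := (le_log_iff_exp_le hgt).2 hexp
    rw [hcdef, div_lt_iff₀ hd]
    nlinarith
  have hcsmall := hball (y := c) (by rw [dist_zero_right, Real.norm_of_nonneg hc.le]; exact hcε)
  have hgc : ∀ x, g t ^ ((x - x₀) / (t - x₀)) = exp (-(4 / 3 * c) * (x - x₀)) := by
    intro x
    rw [rpow_def_of_pos hgt, hcdef]
    congr 1
    field_simp
  have hbound : ∀ x ∈ Ioc T t, exp (c * x) * g x ≤
      2 * g T ^ (1 / 8 : ℝ) * exp (-(c / 6) * (x - x₀)) := by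
    intro x hx
    have hxx : x₀ ≤ x := hTx.trans hx.1.le
    have hx0' : 0 < x := by linarith
    have h1 := hg.le_rpow_of_le_one hx0 hx1 hxx hx.2 (by linarith)
    rw [hgc] at h1
    have h2 : g x ≤ g T := hg.antitone (show 0 < T by linarith) hx0' hx.1.le
    have hgx := hg.pos x hx0'
    -- The power 7/8 still beats the weight, since 7/8 · 4/3 = 7/6 > 1, leaving decay rate c/6. The
    -- power 1/8 is kept to supply the small constant g(T)^{1/8}.
    have h3 : g x = g x ^ (1 / 8 : ℝ) * g x ^ (7 / 8 : ℝ) := by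
      rw [← rpow_add hgx]
      norm_num
    have h4 : g x ^ (7 / 8 : ℝ) ≤ exp (-(7 / 6 * c) * (x - x₀)) := by
      refine (rpow_le_rpow hgx.le h1 (by norm_num)).trans (le_of_eq ?_)
      rw [← Real.exp_mul]
      congr 1
      ring
    have h5 : g x ^ (1 / 8 : ℝ) ≤ g T ^ (1 / 8 : ℝ) := rpow_le_rpow hgx.le h2 (by norm_num)
    have h6 : 0 ≤ g T ^ (1 / 8 : ℝ) := rpow_nonneg (hg.pos T (by linarith)).le _
    calc exp (c * x) * g x
        = exp (c * x₀) * exp (c * (x - x₀)) * (g x ^ (1 / 8 : ℝ) * g x ^ (7 / 8 : ℝ)) := by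
          rw [← h3, ← Real.exp_add]
          congr 2
          ring
      _ ≤ 2 * exp (c * (x - x₀)) * (g T ^ (1 / 8 : ℝ) * exp (-(7 / 6 * c) * (x - x₀))) := by
          gcongr
          exact hcsmall.2
      _ = 2 * g T ^ (1 / 8 : ℝ) * (exp (c * (x - x₀)) * exp (-(7 / 6 * c) * (x - x₀))) := by ring
      _ = _ := by
          rw [← Real.exp_add]
          congr 2
          ring
  have hJ : ENNReal.ofReal c * ∫⁻ x in Iic t, ENNReal.ofReal (exp (c * x)) * extKernel g x ≤
      ENNReal.ofReal z := by
    rw [← Iic_union_Ioc_eq_Iic htT.le]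
    calc ENNReal.ofReal c * ∫⁻ x in Iic T ∪ Ioc T t, ENNReal.ofReal (exp (c * x)) * extKernel g x
        ≤ ENNReal.ofReal c * ((∫⁻ x in Iic T, ENNReal.ofReal (exp (c * x)) * extKernel g x) +
            ∫⁻ x in Ioc T t, ENNReal.ofReal (exp (c * x)) * extKernel g x) := by
          gcongr
          exact lintegral_union_le _ _ _
      _ ≤ ENNReal.ofReal c * (ENNReal.ofReal (exp (c * T) * C) +
            ENNReal.ofReal (2 * g T ^ (1 / 8 : ℝ) * (c / 6)⁻¹)) := by
          gcongr
          · rw [ENNReal.ofReal_mul (exp_pos _).le, ← hCe,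
              ← lintegral_const_mul _ hg.measurable_extKernel]
            refine setLIntegral_mono' measurableSet_Iic fun x hx => ?_
            gcongr
            exact hx
          · rw [ENNReal.ofReal_mul (mul_nonneg zero_le_two (rpow_nonneg
              (hg.pos T (by linarith)).le _)), ← lintegral_Ioi_exp_neg_sub (x₀ := x₀)
              (show 0 < c / 6 by positivity), ← lintegral_const_mul _ (by fun_prop)]
            refine (setLIntegral_mono' measurableSet_Ioc fun x hx => ?_).trans
              (lintegral_mono_set fun x hx => hTx.trans_lt hx.1)
            rw [extKernel_of_pos (by linarith [hx.1]), ← ENNReal.ofReal_mul (exp_pos _).le,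
              ← ENNReal.ofReal_mul (mul_nonneg zero_le_two (rpow_nonneg
              (hg.pos T (by linarith)).le _))]
            exact ENNReal.ofReal_le_ofReal (hbound x hx)
      _ = ENNReal.ofReal (c * (exp (c * T) * C) + 12 * g T ^ (1 / 8 : ℝ)) := by
          have h0 : 0 ≤ g T ^ (1 / 8 : ℝ) := rpow_nonneg (hg.pos T (by linarith)).le _
          rw [← ENNReal.ofReal_add (by positivity) (by positivity), ← ENNReal.ofReal_mul hc.le]
          congr 1
          field_simp
          ring
      _ ≤ ENNReal.ofReal z := ENNReal.ofReal_le_ofReal (by linarith [hcsmall.1])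
  refine (hP.measure_Ioi_le_exp hg hz hc.le ht hJ).trans (ENNReal.ofReal_le_ofReal ?_)
  rw [rpow_def_of_pos hgt, exp_le_exp]
  have h1 : 3 / 4 * (-log (g t)) = c * (t - x₀) := by rw [hcdef]; field_simp
  nlinarith

lemma tendsto_measure_Ioi_atTop (P : Measure ℝ) [IsFiniteMeasure P] :
    Tendsto (fun t => P (Ioi t)) atTop (𝓝 0) := by
  have h1 := tendsto_measure_iInter_atTop (μ := P) (s := fun t : ℝ => Ioi t)
    (fun _ => measurableSet_Ioi.nullMeasurableSet) (fun _ _ h => Ioi_subset_Ioi h)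
    ⟨0, measure_ne_top _ _⟩
  have h2 : ⋂ t : ℝ, Ioi t = ∅ := by
    ext x
    simp only [mem_iInter, mem_Ioi, mem_empty_iff_false, iff_false, not_forall, not_lt]
    exact ⟨x, le_rfl⟩
  rw [h2, measure_empty] at h1
  exact h1

/-- In the convolution keep only τ ≤ t: there g(t - τ) ≥ g(t), and these τ eventually carry mass at
least 1/2. -/
lemma IsResolventLaw.eventually_le_measure_Ioi (hg : LogConvexKernel g) (hz : 0 < z)
    (hP : IsResolventLaw g z P) :
    ∀ᶠ t in atTop, ENNReal.ofReal (g t / (2 * z)) ≤ P (Ioi t) := by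
  have := hP.isProbabilityMeasure
  have h1 : ∀ᶠ t in atTop, P (Ioi t) < ENNReal.ofReal (1 / 2) :=
    (tendsto_measure_Ioi_atTop P).eventually_lt_const (by simp)
  filter_upwards [h1, eventually_gt_atTop 0] with t hPt ht
  have h2 : ENNReal.ofReal (1 / 2) ≤ P (Iic t) := by
    have h3 : P (Iic t) + P (Ioi t) = 1 := by
      rw [← compl_Iic, prob_add_prob_compl measurableSet_Iic]
    by_contra hcon
    push Not at hcon
    have h4 := ENNReal.add_lt_add hcon hPt
    rw [h3, ← ENNReal.ofReal_add (by norm_num) (by norm_num)] at h4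
    norm_num at h4
  rw [← hP.resolventConv_eq hg hz ht, resolventConv]
  calc ENNReal.ofReal (g t / (2 * z)) = ENNReal.ofReal z⁻¹ * (ENNReal.ofReal (g t) *
        ENNReal.ofReal (1 / 2)) := by
        rw [← ENNReal.ofReal_mul (hg.pos t ht).le, ← ENNReal.ofReal_mul (inv_pos.2 hz).le]
        congr 1
        field_simp
    _ ≤ ENNReal.ofReal z⁻¹ * (ENNReal.ofReal (g t) * P (Iic t)) := by gcongr
    _ ≤ ENNReal.ofReal z⁻¹ * ∫⁻ τ, extKernel g (t - τ) ∂P := by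
        gcongr
        rw [← lintegral_indicator_const measurableSet_Iic]
        refine lintegral_mono_ae ?_
        filter_upwards [ae_nonneg_of_Iio hP.Iio_zero,
          (hP.absolutelyContinuous hg hz).ae_le (Measure.ae_ne volume t)] with τ hτ hne
        by_cases h : τ ≤ t
        · have hlt : 0 < t - τ := sub_pos.2 (lt_of_le_of_ne h hne)
          rw [indicator_of_mem (show τ ∈ Iic t from h), extKernel_of_pos hlt]
          exact ENNReal.ofReal_le_ofReal (hg.antitone hlt ht (by linarith))
        · rw [indicator_of_notMem (show τ ∉ Iic t from h)]
          exact zero_le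

end Intermittency

/-! ### Karamata's Tauberian theorem -/

open ProbabilityTheory in
lemma lap_gammaMeasure {γ : ℝ} (hγ : 0 < γ) {q : ℝ} (hq : 0 < q) :
    lap (gammaMeasure γ 1) q = ENNReal.ofReal ((1 + q) ^ (-γ)) := by
  have hm : ∀ r, Measurable (gammaPDF γ r) := fun r => (measurable_gammaPDFReal γ r).ennreal_ofReal
  have h1 : (0 : ℝ) < 1 + q := by positivity
  rw [lap, gammaMeasure, lintegral_withDensity_eq_lintegral_mul _ (hm 1) (measurable_ofReal_exp_mul _)]
  have : ∀ x, (gammaPDF γ 1 * fun x => ENNReal.ofReal (exp (-q * x))) x =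
      ENNReal.ofReal ((1 + q) ^ (-γ)) * gammaPDF γ (1 + q) x := by
    intro x
    rw [Pi.mul_apply]
    rcases lt_or_ge x 0 with hx | hx
    · rw [gammaPDF_of_neg hx, gammaPDF_of_neg hx, zero_mul, mul_zero]
    · have hG := Gamma_pos_of_pos hγ
      rw [gammaPDF_of_nonneg hx, gammaPDF_of_nonneg hx, ← ENNReal.ofReal_mul (by positivity),
        ← ENNReal.ofReal_mul (by positivity), one_rpow, rpow_neg h1.le]
      have h2 : exp (-((1 + q) * x)) = exp (-(1 * x)) * exp (-q * x) := by
        rw [← Real.exp_add]; ring_nf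
      have h3 : (1 + q) ^ γ ≠ 0 := (rpow_pos_of_pos h1 _).ne'
      rw [h2]
      congr 1
      field_simp
  rw [lintegral_congr this, lintegral_const_mul _ (hm _), lintegral_gammaPDF_eq_one hγ h1, mul_one]

/-- The limit law in Karamata's Tauberian theorem of index `γ ∈ [0, 1]`, exponentially tilted. -/
def tiltedPowerLaw (γ : ℝ) : Measure ℝ :=
  if γ = 0 then Measure.dirac 0 else ProbabilityTheory.gammaMeasure γ 1

lemma lap_tiltedPowerLaw {γ : ℝ} (hγ : 0 ≤ γ) {q : ℝ} (hq : 0 < q) :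
    lap (tiltedPowerLaw γ) q = ENNReal.ofReal ((1 + q) ^ (-γ)) := by
  rcases hγ.eq_or_lt with rfl | hγ
  · rw [tiltedPowerLaw, if_pos rfl, lap, lintegral_dirac' _ (measurable_ofReal_exp_mul _)]
    simp
  · rw [tiltedPowerLaw, if_neg hγ.ne', lap_gammaMeasure hγ hq]

/-- For γ = 0 the conventions `Gamma 0 = 0` and `x / 0 = 0` make the density zero, in agreement with
the Dirac mass away from the origin. -/
lemma tiltedPowerLaw_apply {γ : ℝ} (hγ : 0 ≤ γ) {s : Set ℝ} (hs : MeasurableSet s)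
    (hs0 : s ⊆ Ioi 0) :
    tiltedPowerLaw γ s =
      ∫⁻ x in s, ENNReal.ofReal (x ^ (γ - 1) / Gamma γ) * ENNReal.ofReal (exp (-x)) := by
  rcases hγ.eq_or_lt with rfl | hγ
  · rw [tiltedPowerLaw, if_pos rfl, Measure.dirac_apply' _ hs, indicator_of_notMem
      (fun h => lt_irrefl (0 : ℝ) (hs0 h))]
    simp [Gamma_zero]
  · rw [tiltedPowerLaw, if_neg hγ.ne', ProbabilityTheory.gammaMeasure, withDensity_apply _ hs]
    refine setLIntegral_congr_fun hs fun x hx => ?_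
    have hx0 : 0 < x := hs0 hx
    have hG := Gamma_pos_of_pos hγ
    rw [ProbabilityTheory.gammaPDF_of_nonneg hx0.le, ← ENNReal.ofReal_mul (by positivity),
      one_rpow, one_mul]
    congr 1
    ring

lemma tiltedPowerLaw_singleton {γ x : ℝ} (hγ : 0 ≤ γ) (hx : 0 < x) : tiltedPowerLaw γ {x} = 0 := by
  rw [tiltedPowerLaw_apply hγ (measurableSet_singleton x) (singleton_subset_iff.2 hx)]
  simp

lemma tiltedPowerLaw_frontier_Icc {γ a b : ℝ} (hγ : 0 ≤ γ) (ha : 0 < a) (hab : a < b) :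
    tiltedPowerLaw γ (frontier (Icc a b)) = 0 := by
  rw [frontier_Icc hab.le, insert_eq]
  exact measure_union_null (tiltedPowerLaw_singleton hγ ha)
    (tiltedPowerLaw_singleton hγ (ha.trans hab))

lemma tiltedPowerLaw_Icc_le {γ a b : ℝ} (hγ : 0 ≤ γ) (hγ1 : γ ≤ 1) (ha : 0 < a) :
    tiltedPowerLaw γ (Icc a b) ≤
      ENNReal.ofReal (a ^ (γ - 1) / Gamma γ) * ∫⁻ x in Icc a b, ENNReal.ofReal (exp (-x)) := by
  rw [tiltedPowerLaw_apply hγ measurableSet_Icc fun x hx => ha.trans_le hx.1,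
    ← lintegral_const_mul _ (by fun_prop)]
  refine setLIntegral_mono (by fun_prop) fun x hx => ?_
  have := Gamma_nonneg_of_nonneg hγ
  gcongr ENNReal.ofReal (?_ / _) * _
  exact rpow_le_rpow_of_nonpos ha hx.1 (by linarith)

lemma le_tiltedPowerLaw_Icc {γ a b : ℝ} (hγ : 0 ≤ γ) (hγ1 : γ ≤ 1) (ha : 0 < a) :
    ENNReal.ofReal (b ^ (γ - 1) / Gamma γ) * ∫⁻ x in Icc a b, ENNReal.ofReal (exp (-x)) ≤
      tiltedPowerLaw γ (Icc a b) := by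
  rw [tiltedPowerLaw_apply hγ measurableSet_Icc fun x hx => ha.trans_le hx.1,
    ← lintegral_const_mul _ (by fun_prop)]
  refine setLIntegral_mono (by fun_prop) fun x hx => ?_
  have := Gamma_nonneg_of_nonneg hγ
  gcongr ENNReal.ofReal (?_ / _) * _
  exact rpow_le_rpow_of_nonpos (ha.trans_le hx.1) hx.2 (by linarith)

lemma lintegral_Ioi_comp_mul_left (f : ℝ → ℝ≥0∞) {c : ℝ} (hc : 0 < c) (hf : Measurable f) :
    ∫⁻ x in Ioi 0, f (c * x) = ENNReal.ofReal c⁻¹ * ∫⁻ t in Ioi 0, f t := by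
  have hmap : Measure.map (c * ·) (volume : Measure ℝ) = ENNReal.ofReal c⁻¹ • volume := by
    rw [Real.map_volume_mul_left hc.ne', abs_of_pos (inv_pos.2 hc)]
  rw [← smul_eq_mul, ← lintegral_smul_measure, ← Measure.restrict_smul, ← hmap,
    Measure.restrict_map (by fun_prop) measurableSet_Ioi, lintegral_map hf (by fun_prop)]
  congr 2
  ext x
  simp [hc]

/-- The tilted and rescaled measure `c e^{-x} F (u x) dx` on the half-line. -/
def rescaledLaw (F : ℝ → ℝ≥0∞) (c u : ℝ) : Measure ℝ :=
  (volume.restrict (Ioi 0)).withDensity fun x =>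
    ENNReal.ofReal c * (F (u * x) * ENNReal.ofReal (exp (-x)))

lemma rescaledLaw_apply (F : ℝ → ℝ≥0∞) (c u : ℝ) {s : Set ℝ} (hs : MeasurableSet s)
    (hs0 : s ⊆ Ioi 0) :
    rescaledLaw F c u s =
      ∫⁻ x in s, ENNReal.ofReal c * (F (u * x) * ENNReal.ofReal (exp (-x))) := by
  rw [rescaledLaw, withDensity_apply _ hs, Measure.restrict_restrict hs,
    inter_eq_self_of_subset_left hs0]

/-- The tilt e^{-x} makes the rescaled measure finite, with total mass 1 at q = 0, so the continuity
theorem for probability measures applies. -/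
lemma lap_rescaledLaw {F : ℝ → ℝ≥0∞} (hF : Measurable F) {Φ : ℝ → ℝ}
    (hΦ : ∀ p, 0 < p → ∫⁻ t in Ioi 0, ENNReal.ofReal (exp (-p * t)) * F t = ENNReal.ofReal (Φ p))
    {u : ℝ} (hu : 0 < u) (hΦu : 0 < Φ u⁻¹) {q : ℝ} (hq : 0 ≤ q) :
    lap (rescaledLaw F (u / Φ u⁻¹) u) q = ENNReal.ofReal (Φ ((1 + q) * u⁻¹) / Φ u⁻¹) := by
  have hm : Measurable fun x => ENNReal.ofReal (u / Φ u⁻¹) * (F (u * x) * ENNReal.ofReal (exp (-x))) := by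
    fun_prop
  have hm2 : Measurable fun t => ENNReal.ofReal (exp (-((1 + q) * u⁻¹) * t)) * F t := by fun_prop
  rw [lap, rescaledLaw, lintegral_withDensity_eq_lintegral_mul _ hm (measurable_ofReal_exp_mul _)]
  have : ∀ x, ((fun x => ENNReal.ofReal (u / Φ u⁻¹) * (F (u * x) * ENNReal.ofReal (exp (-x)))) *
      fun x => ENNReal.ofReal (exp (-q * x))) x = ENNReal.ofReal (u / Φ u⁻¹) *
        (fun t => ENNReal.ofReal (exp (-((1 + q) * u⁻¹) * t)) * F t) (u * x) := by
    intro x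
    have h1 : -((1 + q) * u⁻¹) * (u * x) = -x + -q * x := by field_simp; ring
    simp only [Pi.mul_apply]
    rw [h1, Real.exp_add, ENNReal.ofReal_mul (exp_pos _).le]
    ring
  rw [lintegral_congr this, lintegral_const_mul _ (by fun_prop),
    lintegral_Ioi_comp_mul_left _ hu hm2, hΦ _ (by positivity), ← mul_assoc,
    ← ENNReal.ofReal_mul (by positivity), ← ENNReal.ofReal_mul (by positivity)]
  congr 1
  field_simp

lemma isProbabilityMeasure_rescaledLaw {F : ℝ → ℝ≥0∞} (hF : Measurable F) {Φ : ℝ → ℝ}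
    (hΦ : ∀ p, 0 < p → ∫⁻ t in Ioi 0, ENNReal.ofReal (exp (-p * t)) * F t = ENNReal.ofReal (Φ p))
    {u : ℝ} (hu : 0 < u) (hΦu : 0 < Φ u⁻¹) :
    IsProbabilityMeasure (rescaledLaw F (u / Φ u⁻¹) u) := by
  have := lap_rescaledLaw hF hΦ hu hΦu le_rfl
  rw [add_zero, one_mul, div_self hΦu.ne'] at this
  exact ⟨by simpa [lap] using this⟩

lemma rescaledLaw_Iio (F : ℝ → ℝ≥0∞) (c u : ℝ) : rescaledLaw F c u (Iio 0) = 0 := by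
  refine withDensity_absolutelyContinuous _ _ ?_
  rw [Measure.restrict_apply measurableSet_Iio]
  have : Iio (0 : ℝ) ∩ Ioi 0 = ∅ := by ext x; simp; intro h; exact h.le
  simp [this]

lemma setLIntegral_exp_neg_Icc_ne_zero {a b : ℝ} (hab : a < b) :
    ∫⁻ x in Icc a b, ENNReal.ofReal (exp (-x)) ≠ 0 := by
  rw [← pos_iff_ne_zero, setLIntegral_pos_iff (by fun_prop)]
  have : Function.support (fun x => ENNReal.ofReal (exp (-x))) = univ := by
    ext x; simp [exp_pos]
  rw [this, univ_inter, Real.volume_Icc]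
  simpa using hab

lemma setLIntegral_exp_neg_Icc_ne_top (a b : ℝ) :
    ∫⁻ x in Icc a b, ENNReal.ofReal (exp (-x)) ≠ ⊤ :=
  (Continuous.integrableOn_Icc (by fun_prop)).lintegral_lt_top.ne

/-- Karamata's Tauberian theorem for nonincreasing functions of regularly varying Laplace
transform. For `γ = 0` the limit is `1 / Γ(0) = 0`. -/
theorem tendsto_mul_of_lap_regularlyVarying {F : ℝ → ℝ≥0∞} (hF : Measurable F)
    (hanti : AntitoneOn F (Ioi 0)) {Φ : ℝ → ℝ}
    (hΦ : ∀ p, 0 < p → ∫⁻ t in Ioi 0, ENNReal.ofReal (exp (-p * t)) * F t = ENNReal.ofReal (Φ p))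
    (hpos : ∀ᶠ p in 𝓝[>] 0, 0 < Φ p) {γ : ℝ} (hγ : 0 ≤ γ) (hγ1 : γ ≤ 1)
    (hreg : ∀ q, 0 < q → Tendsto (fun p => Φ (q * p) / Φ p) (𝓝[>] 0) (𝓝 (q ^ (-γ)))) :
    Tendsto (fun t => ENNReal.ofReal (t / Φ t⁻¹) * F t) atTop (𝓝 (ENNReal.ofReal (1 / Gamma γ))) := by
  refine tendsto_of_seq_tendsto fun v hv => ?_
  have hgood : ∀ᶠ n in atTop, 0 < v n ∧ 0 < Φ (v n)⁻¹ :=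
    (hv.eventually_gt_atTop 0).and ((tendsto_inv_atTop_nhdsGT_zero.comp hv).eventually hpos)
  obtain ⟨N, hN⟩ := eventually_atTop.1 hgood
  rw [← tendsto_add_atTop_iff_nat N]
  set u : ℕ → ℝ := fun n => v (n + N) with hu
  have hu0 : ∀ n, 0 < u n := fun n => (hN _ (Nat.le_add_left _ _)).1
  have hΦu : ∀ n, 0 < Φ (u n)⁻¹ := fun n => (hN _ (Nat.le_add_left _ _)).2
  have hut : Tendsto u atTop atTop := hv.comp (tendsto_add_atTop_nat N)
  set R : ℕ → ProbabilityMeasure ℝ := fun n =>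
    ⟨rescaledLaw F (u n / Φ (u n)⁻¹) (u n), isProbabilityMeasure_rescaledLaw hF hΦ (hu0 n) (hΦu n)⟩
    with hR
  obtain ⟨S, -, hS, hRS⟩ := exists_tendsto_of_tendsto_lap (P := R)
    (φ := fun q => ENNReal.ofReal ((1 + q) ^ (-γ))) (fun n => rescaledLaw_Iio _ _ _) (by
      intro q hq
      have h1 : ∀ n, lap (R n) q = ENNReal.ofReal (Φ ((1 + q) * (u n)⁻¹) / Φ (u n)⁻¹) :=
        fun n => lap_rescaledLaw hF hΦ (hu0 n) (hΦu n) hq.le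
      simp_rw [h1]
      exact ENNReal.tendsto_ofReal
        ((hreg (1 + q) (by positivity)).comp (tendsto_inv_atTop_nhdsGT_zero.comp hut))) (by
      have : ContinuousAt (fun q : ℝ => ENNReal.ofReal ((1 + q) ^ (-γ))) 0 :=
        ENNReal.continuous_ofReal.continuousAt.comp
          (ContinuousAt.rpow_const (by fun_prop) (Or.inl (by norm_num)))
      simpa using this.tendsto.mono_left nhdsWithin_le_nhds)
  have hSeq : (S : Measure ℝ) = tiltedPowerLaw γ :=
    ext_of_lap (fun q hq => (hS q hq).trans (lap_tiltedPowerLaw hγ hq).symm)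
      fun q hq => by rw [hS q hq]; exact ENNReal.ofReal_ne_top
  -- Weak convergence on intervals whose endpoints are not charged by the limit; dividing by the
  -- integral of e^{-x} gives averages of the rescaled F.
  have hlim : ∀ a b : ℝ, 0 < a → a < b → Tendsto
      (fun n => rescaledLaw F (u n / Φ (u n)⁻¹) (u n) (Icc a b) /
        ∫⁻ x in Icc a b, ENNReal.ofReal (exp (-x))) atTop
      (𝓝 (tiltedPowerLaw γ (Icc a b) / ∫⁻ x in Icc a b, ENNReal.ofReal (exp (-x)))) := by
    intro a b ha hab
    refine ENNReal.Tendsto.div_const ?_ (Or.inr (setLIntegral_exp_neg_Icc_ne_zero hab))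
    rw [← hSeq]
    exact ProbabilityMeasure.tendsto_measure_of_null_frontier_of_tendsto' hRS
      (by rw [hSeq]; exact tiltedPowerLaw_frontier_Icc hγ ha hab)
  have hcont : ContinuousAt (fun a : ℝ => ENNReal.ofReal (a ^ (γ - 1) / Gamma γ)) 1 :=
    ENNReal.continuous_ofReal.continuousAt.comp
      ((ContinuousAt.rpow_const (by fun_prop) (Or.inl (by norm_num))).div_const _)
  have hcont' : Tendsto (fun a : ℝ => ENNReal.ofReal (a ^ (γ - 1) / Gamma γ)) (𝓝 1)
      (𝓝 (ENNReal.ofReal (1 / Gamma γ))) := by simpa using hcont.tendsto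
  rw [tendsto_order]
  constructor
  -- Since F decreases, its value at u_n dominates its average over [1, b]; then b ↓ 1. The other
  -- half uses [a, 1] with a ↑ 1.
  · intro y hy
    obtain ⟨b, hby, hb⟩ := (((hcont'.mono_left nhdsWithin_le_nhds).eventually_const_lt hy).and
      (self_mem_nhdsWithin : Ioi (1 : ℝ) ∈ 𝓝[>] 1)).exists
    have hb1 : (1 : ℝ) < b := hb
    have hE0 := setLIntegral_exp_neg_Icc_ne_zero hb1
    have hEt := setLIntegral_exp_neg_Icc_ne_top 1 b
    have hy' : y < tiltedPowerLaw γ (Icc 1 b) / ∫⁻ x in Icc 1 b, ENNReal.ofReal (exp (-x)) :=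
      hby.trans_le ((ENNReal.le_div_iff_mul_le (Or.inl hE0) (Or.inl hEt)).2
        (le_tiltedPowerLaw_Icc hγ hγ1 one_pos))
    filter_upwards [(hlim 1 b one_pos hb1).eventually_const_lt hy'] with n hn
    refine hn.trans_le ((ENNReal.div_le_iff hE0 hEt).2 ?_)
    rw [rescaledLaw_apply _ _ _ measurableSet_Icc fun x hx => one_pos.trans_le hx.1,
      ← lintegral_const_mul _ (by fun_prop)]
    refine setLIntegral_mono (by fun_prop) fun x hx => ?_
    simp only [Function.comp, mul_assoc]
    gcongr
    exact hanti (hu0 n) (mul_pos (hu0 n) (one_pos.trans_le hx.1))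
      (le_mul_of_one_le_right (hu0 n).le hx.1)
  · intro y hy
    obtain ⟨a, ⟨hay, ha⟩, ha0⟩ := (((hcont'.mono_left nhdsWithin_le_nhds).eventually_lt_const hy).and
      (self_mem_nhdsWithin : Iio (1 : ℝ) ∈ 𝓝[<] 1)).and
      (mem_nhdsWithin_of_mem_nhds (Ioi_mem_nhds one_pos) : Ioi (0 : ℝ) ∈ 𝓝[<] 1) |>.exists
    have ha1 : a < 1 := ha
    have ha0 : 0 < a := ha0
    have hE0 := setLIntegral_exp_neg_Icc_ne_zero ha1
    have hEt := setLIntegral_exp_neg_Icc_ne_top a 1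
    have hy' : tiltedPowerLaw γ (Icc a 1) / ∫⁻ x in Icc a 1, ENNReal.ofReal (exp (-x)) < y :=
      ((ENNReal.div_le_iff hE0 hEt).2 (tiltedPowerLaw_Icc_le hγ hγ1 ha0)).trans_lt hay
    filter_upwards [(hlim a 1 ha0 ha1).eventually_lt_const hy'] with n hn
    refine lt_of_le_of_lt ((ENNReal.le_div_iff_mul_le (Or.inl hE0) (Or.inl hEt)).2 ?_) hn
    rw [rescaledLaw_apply _ _ _ measurableSet_Icc fun x hx => ha0.trans_le hx.1,
      ← lintegral_const_mul _ (by fun_prop)]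
    refine setLIntegral_mono (by fun_prop) fun x hx => ?_
    simp only [Function.comp, mul_assoc]
    gcongr
    exact hanti (mul_pos (hu0 n) (ha0.trans_le hx.1)) (hu0 n)
      (mul_le_of_le_one_right (hu0 n).le hx.2)

/-! ### Asymptotics of the tail and the intermittency ratio -/

section

variable {k g : ℝ → ℝ} {z : ℝ} {P : Measure ℝ}

lemma laplaceK_congr (h : k =ᵐ[volume.restrict (Ioi 0)] g) : laplaceK k = laplaceK g := by
  ext p
  refine integral_congr_ae ?_
  filter_upwards [h] with t ht
  rw [ht]

lemma correlation_exp_eq (k : ℝ → ℝ) (β : ℝ) (n : ℕ) (t : ℝ) :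
    correlation k (fun s => exp (-β * s)) n t = subExp k t (-(n * β)) := by
  refine lintegral_congr fun s => ?_
  rw [Finset.prod_const, Finset.card_univ, Fintype.card_fin, ← ENNReal.ofReal_pow (exp_pos _).le,
    ← Real.exp_nat_mul, mul_comm]
  congr 3
  ring

lemma LogConvexKernel.subExp_eq_measure_Ioi (hg : LogConvexKernel g)
    (hkg : k =ᵐ[volume.restrict (Ioi 0)] g) (hz : 0 < z) (hP : IsResolventLaw g z P) {t : ℝ}
    (ht : 0 < t) : subExp k t (-z) = P (Ioi t) := by
  have hL : laplaceL k = laplaceL g := by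
    ext p; rw [laplaceL, laplaceL, laplaceK_congr hkg]
  rw [hg.subExp_eq hkg hL hz hP, ← hP.resolventConv_eq hg hz ht, resolventConv]

/-- A function equivalent to `p ^ (-γ) Q(1/p)` at the origin is regularly varying there. -/
lemma IsSlowlyVarying.tendsto_div {Q Φ : ℝ → ℝ} (hQ : IsSlowlyVarying Q) {γ c : ℝ} (hc : 0 < c)
    (hΦ : Φ ~[𝓝[>] 0] fun p => c * (p ^ (-γ) * Q (1 / p))) {q : ℝ} (hq : 0 < q) :
    Tendsto (fun p => Φ (q * p) / Φ p) (𝓝[>] 0) (𝓝 (q ^ (-γ))) := by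
  have hscale : Tendsto (fun p : ℝ => q * p) (𝓝[>] 0) (𝓝[>] 0) := by
    refine tendsto_nhdsWithin_iff.2 ⟨?_, ?_⟩
    · have : Tendsto (fun p : ℝ => q * p) (𝓝 0) (𝓝 (q * 0)) := tendsto_id.const_mul q
      rw [mul_zero] at this
      exact this.mono_left nhdsWithin_le_nhds
    · filter_upwards [self_mem_nhdsWithin] with p hp using mul_pos hq hp
  have hone : Tendsto (fun p : ℝ => 1 / p) (𝓝[>] 0) atTop := by
    simpa [one_div] using tendsto_inv_nhdsGT_zero (𝕜 := ℝ)
  have h1 := (hΦ.comp_tendsto hscale).div hΦ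
  refine (h1.tendsto_nhds_iff).2 ?_
  have h2 := ((hQ.2 q⁻¹ (inv_pos.2 hq)).comp hone).const_mul (q ^ (-γ))
  rw [mul_one] at h2
  refine h2.congr' ?_
  filter_upwards [self_mem_nhdsWithin, hone.eventually hQ.1] with p hp hQp
  have hp0 : 0 < p := hp
  have h3 : 1 / (q * p) = q⁻¹ * (1 / p) := by field_simp
  have h4 : p ^ (-γ) ≠ 0 := (rpow_pos_of_pos hp0 _).ne'
  simp only [Pi.div_apply, Function.comp, h3]
  rw [mul_rpow hq.le hp0.le]
  field_simp

/-- Since ℒ → 0 at the origin, the denominator tends to z. -/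
lemma LogConvexKernel.isEquivalent_laplaceK_div (hg : LogConvexKernel g) (hz : 0 < z) {Q : ℝ → ℝ} {γ : ℝ}
    (hK : laplaceK g ~[𝓝[>] 0] fun p => p ^ (-γ) * Q (1 / p)) :
    (fun p => laplaceK g p / (z + laplaceL g p)) ~[𝓝[>] 0]
      fun p => z⁻¹ * (p ^ (-γ) * Q (1 / p)) := by
  have h1 : (fun p => z + laplaceL g p) ~[𝓝[>] 0] fun _ => z := by
    refine (isEquivalent_const_iff_tendsto hz.ne').2 ?_
    simpa using hg.laplaceL_zero.const_add z
  refine (hK.div h1).congr_right ?_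
  filter_upwards with p
  simp only [Pi.div_apply, div_eq_inv_mul]

theorem IsResolventLaw.tendsto_mul_measure_Ioi (hg : LogConvexKernel g) (hz : 0 < z)
    (hP : IsResolventLaw g z P) {Q : ℝ → ℝ} (hQ : IsSlowlyVarying Q) {γ : ℝ} (hγ : 0 ≤ γ)
    (hγ1 : γ ≤ 1) (hK : laplaceK g ~[𝓝[>] 0] fun p => p ^ (-γ) * Q (1 / p)) :
    Tendsto (fun t => (P (Ioi t)).toReal / (t ^ (γ - 1) * Q t)) atTop (𝓝 (1 / (Gamma γ * z))) := by
  have := hP.isProbabilityMeasure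
  set Φ : ℝ → ℝ := fun p => laplaceK g p / (z + laplaceL g p) with hΦ
  have hequiv : Φ ~[𝓝[>] 0] fun p => z⁻¹ * (p ^ (-γ) * Q (1 / p)) :=
    hg.isEquivalent_laplaceK_div hz hK
  have hpos : ∀ᶠ p in 𝓝[>] 0, 0 < Φ p := by
    filter_upwards [self_mem_nhdsWithin, hg.laplaceK_zero.eventually_gt_atTop 0] with p hp hKp
    exact div_pos hKp (add_pos_of_pos_of_nonneg hz (hg.laplaceL_nonneg hp))
  have hanti : Antitone fun t => P (Ioi t) := fun s t h => measure_mono (Ioi_subset_Ioi h)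
  have h1 := tendsto_mul_of_lap_regularlyVarying (F := fun t => P (Ioi t)) (Φ := Φ)
    hanti.measurable (hanti.antitoneOn _) (fun p hp => by
      rw [← hP.lap_resolventConv hg hz hp]
      exact setLIntegral_congr_fun measurableSet_Ioi fun t ht => by
        rw [hP.resolventConv_eq hg hz ht]) hpos hγ hγ1
    (fun q hq => hQ.tendsto_div (inv_pos.2 hz) hequiv hq)
  have h2 := (ENNReal.tendsto_toReal ENNReal.ofReal_ne_top).comp h1
  rw [ENNReal.toReal_ofReal (by have := Gamma_nonneg_of_nonneg hγ; positivity)] at h2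
  have h3 : Tendsto (fun t => Φ t⁻¹ / (z⁻¹ * (t ^ γ * Q t))) atTop (𝓝 1) := by
    have hne : ∀ᶠ t in atTop, z⁻¹ * (t ^ γ * Q t) ≠ 0 := by
      filter_upwards [hQ.1, eventually_gt_atTop 0] with t hQt ht
      positivity
    refine (isEquivalent_iff_tendsto_one hne).1 ?_
    refine (hequiv.comp_tendsto tendsto_inv_atTop_nhdsGT_zero).congr_right ?_
    filter_upwards [eventually_gt_atTop 0] with t ht
    simp only [Function.comp]
    rw [inv_rpow ht.le, rpow_neg ht.le, inv_inv, one_div, inv_inv]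
  have h4 := (h2.mul h3).mul_const z⁻¹
  have h5 : 1 / Gamma γ * 1 * z⁻¹ = 1 / (Gamma γ * z) := by
    rw [mul_one, one_div, one_div, mul_inv]
  rw [h5] at h4
  refine h4.congr' ?_
  filter_upwards [hQ.1, eventually_gt_atTop 0,
    tendsto_inv_atTop_nhdsGT_zero.eventually hpos] with t hQt ht hΦt
  have h6 : t ^ γ = t ^ (γ - 1) * t := by
    rw [← rpow_add_one ht.ne']; congr 1; ring
  have h7 : t ^ (γ - 1) ≠ 0 := (rpow_pos_of_pos ht _).ne'
  simp only [Function.comp]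
  rw [ENNReal.toReal_mul, ENNReal.toReal_ofReal (by positivity), h6]
  generalize Φ t⁻¹ = y at hΦt ⊢
  field_simp

/-- The numerator is at least g/(2z) and the product of l ≥ 2 tails at most (g^{3/4})² = g^{3/2}.
Any exponent above 1/2 in the upper bound would serve. -/
theorem tendsto_measure_Ioi_div_prod {l : ℕ} (hg : LogConvexKernel g) (hz : 0 < z)
    (hP : IsResolventLaw g z P) (hl : 2 ≤ l) {w : Fin l → ℝ} (hw : ∀ j, 0 < w j)
    {R : Fin l → Measure ℝ} (hR : ∀ j, IsResolventLaw g (w j) (R j)) :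
    Tendsto (fun t => (P (Ioi t)).toReal / ∏ j, (R j (Ioi t)).toReal) atTop atTop := by
  have := hP.isProbabilityMeasure
  have := fun j => (hR j).isProbabilityMeasure
  have hlow : ∀ {v : ℝ} {S : Measure ℝ}, 0 < v → IsResolventLaw g v S →
      ∀ᶠ t in atTop, g t / (2 * v) ≤ (S (Ioi t)).toReal := by
    intro v S hv hS
    have := hS.isProbabilityMeasure
    filter_upwards [hS.eventually_le_measure_Ioi hg hv] with t ht
    exact (ENNReal.ofReal_le_iff_le_toReal (measure_ne_top _ _)).1 ht
  have hsmall : Tendsto (fun t => g t ^ (-(1 / 2) : ℝ) / (2 * z)) atTop atTop := by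
    refine Tendsto.atTop_div_const (by positivity) ?_
    refine (tendsto_rpow_neg_nhdsGT_zero (by norm_num)).comp ?_
    refine tendsto_nhdsWithin_iff.2 ⟨hg.tendsto_zero, ?_⟩
    filter_upwards [eventually_gt_atTop 0] with t ht using hg.pos t ht
  refine tendsto_atTop_mono' _ ?_ hsmall
  filter_upwards [hlow hz hP, eventually_all.2 fun j => hlow (hw j) (hR j),
    eventually_all.2 fun j => (hR j).eventually_measure_Ioi_le hg (hw j), eventually_gt_atTop 0,
    hg.tendsto_zero.eventually_le_const one_pos] with t h1 h2 h3 ht hg1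
  have hgt := hg.pos t ht
  have hRpos : ∀ j, 0 < (R j (Ioi t)).toReal := fun j =>
    (div_pos hgt (mul_pos two_pos (hw j))).trans_le (h2 j)
  have hprod : ∏ j, (R j (Ioi t)).toReal ≤ g t ^ (3 / 2 : ℝ) := by
    calc ∏ j, (R j (Ioi t)).toReal ≤ ∏ _j : Fin l, g t ^ (3 / 4 : ℝ) :=
          Finset.prod_le_prod (fun j _ => (hRpos j).le) fun j _ =>
            ENNReal.toReal_le_of_le_ofReal (by positivity) (h3 j)
      _ = (g t ^ (3 / 4 : ℝ)) ^ l := by simp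
      _ ≤ (g t ^ (3 / 4 : ℝ)) ^ 2 :=
          pow_le_pow_of_le_one (by positivity) (rpow_le_one hgt.le hg1 (by norm_num)) hl
      _ = g t ^ (3 / 2 : ℝ) := by
          rw [← rpow_natCast, ← rpow_mul hgt.le]; norm_num
  rw [le_div_iff₀ (Finset.prod_pos fun j _ => hRpos j)]
  calc g t ^ (-(1 / 2) : ℝ) / (2 * z) * ∏ j, (R j (Ioi t)).toReal
      ≤ g t ^ (-(1 / 2) : ℝ) / (2 * z) * g t ^ (3 / 2 : ℝ) := by gcongr
    _ = g t / (2 * z) := by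
        rw [div_mul_eq_mul_div, ← rpow_add hgt]; norm_num
    _ ≤ _ := h1

end

end FractionalKinetics

end

theorem theorem4p2 (k : ℝ → ℝ) (hk : FractionalKinetics.IsAdmissibleKernel k)
    (γ : ℝ) (hγ0 : 0 ≤ γ) (hγ1 : γ ≤ 1)
    (Q : ℝ → ℝ) (hQ : FractionalKinetics.IsSlowlyVarying Q)
    (hK : FractionalKinetics.laplaceK k ~[𝓝[>] (0 : ℝ)] fun p => p ^ (-γ) * Q (1 / p)) :
    (∀ z : ℝ, 0 < z →
      (∀ t : ℝ, 0 < t → FractionalKinetics.subExp k t (-z) < ⊤) ∧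
      (0 < γ →
        (fun t : ℝ => (FractionalKinetics.subExp k t (-z)).toReal) ~[atTop]
          fun t : ℝ => t ^ (γ - 1) * Q t / (Real.Gamma γ * z)) ∧
      (γ = 0 →
        (fun t : ℝ => (FractionalKinetics.subExp k t (-z)).toReal) =o[atTop]
          fun t : ℝ => t ^ (γ - 1) * Q t)) ∧
    (∀ β : ℝ, 0 < β → ∀ n : ℕ, 1 < n → ∀ l : ℕ, 2 ≤ l → ∀ m : Fin l → ℕ,
      (∀ j, 1 ≤ m j) → ∑ j, m j = n →
      Tendsto
        (fun t : ℝ =>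
          (FractionalKinetics.correlation k (fun s => Real.exp (-β * s)) n t).toReal /
            ∏ j, (FractionalKinetics.correlation k (fun s => Real.exp (-β * s)) (m j) t).toReal)
        atTop atTop) := by
  obtain ⟨g, hg, hkg⟩ := hk.exists_logConvexKernel
  have htail : ∀ z : ℝ, 0 < z → ∃ P : Measure ℝ, FractionalKinetics.IsResolventLaw g z P ∧
      ∀ t, 0 < t → FractionalKinetics.subExp k t (-z) = P (Ioi t) := fun z hz => by
    obtain ⟨P, hP⟩ := hg.exists_isResolventLaw hz
    exact ⟨P, hP, fun t ht => hg.subExp_eq_measure_Ioi hkg hz hP ht⟩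
  refine ⟨fun z hz => ?_, fun β hβ n hn l hl m hm _ => ?_⟩
  · obtain ⟨P, hP, hPt⟩ := htail z hz
    have := hP.isProbabilityMeasure
    have hlim := hP.tendsto_mul_measure_Ioi hg hz hQ hγ0 hγ1 (FractionalKinetics.laplaceK_congr hkg ▸ hK)
    have hcongr : (fun t => (P (Ioi t)).toReal) =ᶠ[atTop] fun t => (FractionalKinetics.subExp k t (-z)).toReal := by
      filter_upwards [eventually_gt_atTop 0] with t ht
      rw [hPt t ht]
    have hne : ∀ᶠ t in atTop, t ^ (γ - 1) * Q t ≠ 0 := by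
      filter_upwards [hQ.1, eventually_gt_atTop 0] with t hQt ht
      positivity
    refine ⟨fun t ht => (hPt t ht).trans_lt (measure_lt_top _ _), fun hγ => ?_, fun hγ => ?_⟩
    · have hG := Real.Gamma_pos_of_pos hγ
      refine IsEquivalent.congr_left ?_ hcongr
      refine (isEquivalent_iff_tendsto_one (hne.mono fun t ht => ?_)).2 ?_
      · exact div_ne_zero ht (by positivity)
      · have := hlim.mul_const (Real.Gamma γ * z)
        rw [one_div_mul_cancel (by positivity)] at this
        refine this.congr fun t => ?_
        simp only [Pi.div_apply]
        rw [div_div_eq_mul_div, div_mul_eq_mul_div]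
    -- With `Gamma 0 = 0` and division by zero equal to zero, the limit 1/(Γ(γ) z) becomes the limit
    -- 0 that the little-o statement requires.
    · rw [hγ, Real.Gamma_zero, zero_mul, div_zero] at hlim
      rw [hγ] at hne ⊢
      refine IsLittleO.congr' ?_ hcongr EventuallyEq.rfl
      exact (isLittleO_iff_tendsto' (hne.mono fun t ht h0 => absurd h0 ht)).2 hlim
  · have hmpos : ∀ j, 0 < (m j : ℝ) * β := fun j =>
      mul_pos (Nat.cast_pos.2 (hm j)) hβ
    have hnpos : 0 < (n : ℝ) * β := mul_pos (Nat.cast_pos.2 (by omega)) hβ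
    obtain ⟨P, hP, hPt⟩ := htail _ hnpos
    choose R hR hRt using fun j => htail _ (hmpos j)
    refine (FractionalKinetics.tendsto_measure_Ioi_div_prod hg hnpos hP hl hmpos hR).congr' ?_
    filter_upwards [eventually_gt_atTop 0] with t ht
    simp_rw [FractionalKinetics.correlation_exp_eq, hPt t ht, hRt _ t ht]
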